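/- **Setup.** Let $\Bbbk$ be an algebraically closed field and $A=\bigoplus_{i,j\in\mathbf I}1_iA1_j$ a locally unital $\mathbb Z$-graded $\Bbbk$-algebra with mutually orthogonal distinguished idempotents $1_i$ of degree $0$, locally finite-dimensional and bounded below: every $1_iA_d1_j$ is finite-dimensional, and for all $i,j$ one has $1_iA_d1_j=0$ for $d\ll 0$. Assume that $A$ has a *graded triangular basis*: a subset $\mathbf S\subseteq\mathbf I$, a poset $\Lambda$ in which every $\{\mu\le\lambda\}$ is finite, a map $\mathbf S\to\Lambda$, $s\mapsto\dot s$, with finite fibers $\mathbf S_\lambda$, and homogeneous sets $\mathrm X(i,s)\subset 1_iA1_s$, $\mathrm H(s,t)\subset 1_sA1_t$, $\mathrm Y(t,j)\subset 1_tA1_j$ ($i,j\in\mathbf I$, $s,t\in\mathbf S$) such that * the products $xhy$ for $(x,h,y)\in\bigcup_{i,j\in\mathbf I,\,s,t\in\mathbf S}\mathrm X(i,s)\times\mathrm H(s,t)\times\mathrm Y(t,j)$ form a basis of $A$; * $\mathrm X(s,s)=\mathrm Y(s,s)=\{1_s\}$ for $s\in\mathbf S$; * for $s\ne t$ in $\mathbf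 S$: $\mathrm X(s,t)\ne\varnothing\Rightarrow\dot s>\dot t$, $\mathrm H(s,t)\neq\varnothing\Rightarrow\dot s=\dot t$, $\mathrm Y(s,t)\ne\varnothing\Rightarrow\dot s<\dot t$; * for each $i\in\mathbf I\setminus\mathbf S$ there are only finitely many $s\in\mathbf S$ with $\mathrm X(i,s)\cup\mathrm Y(s,i)\neq\varnothing$. Graded modules are left modules $V=\bigoplus_{i\in\mathbf I}1_iV$ (locally unital), and $A\text{-gmod}$ is the abelian category of graded modules and degree-preserving homomorphisms. Write $(q^dV)_n=V_{n+d}$, $\operatorname{Hom}_A(V,W)=\bigoplus_d\operatorname{Hom}_A(V,W)_d$ with $\operatorname{Hom}_A(V,W)_d=\operatorname{Hom}_{A\text{-gmod}}(V,q^dW)$, likewise $\operatorname{Ext}^n_A(V,W)=\bigoplus_d\operatorname{Ext}^n_{A\text{-gmod}}(V,q^dW)$, and $\dim_qU=\sum_d(\dim U_d)q^{-d}$. A graded module $V$ is *locally finite-dimensional* if all $1_iV_d$ are finite-dimensional, and *bounded above* if for each $i$ one has $1_iV_d=0$ for $d\gg0$. The same notions are used for the other locally unital graded algebras below. Put $e_\lambda=\sum_{s\in\mathbf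 S_\lambda}1_s$. Let $A_{\ge\lambda}$ be the quotient of $A$ by the two-sided ideal generated by all $e_\mu$ with $\mu\not\ge\lambda$, let $\bar e_\lambda,\bar 1_i\in A_{\ge\lambda}$ be the images of $e_\lambda,1_i$, and let $A_\lambda=\bar e_\lambda A_{\ge\lambda}\bar e_\lambda$. Define functors from $A_\lambda\text{-gmod}$ to $A_{\ge\lambda}\text{-gmod}\subseteq A\text{-gmod}$ by $j^\lambda_!=A_{\ge\lambda}\bar e_\lambda\otimes_{A_\lambda}-$ and $j^\lambda_*=\bigoplus_{i\in\mathbf I}\operatorname{Hom}_{A_\lambda}(\bar e_\lambda A_{\ge\lambda}\bar 1_i,-)$. Let $L_\lambda(b)$ ($b\in\mathbf B_\lambda$) be a full set of irreducible graded $A_\lambda$-modules up to isomorphism and degree shift, let $P_\lambda(b)$ be a projective cover of $L_\lambda(b)$ in $A_\lambda\text{-gmod}$, let $\mathbf B=\coprod_\lambda\mathbf B_\lambda$, write $\dot b=\lambda$ for $b\in\mathbf B_\lambda$, and set $\Delta(b)=j^\lambda_!P_\lambda(b)$, $\bar\Delta(b)=j^\lambda_!L_\lambda(b)$. A *$\nabla$-layer*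 (resp. *$\bar\nabla$-layer*) *of type $\lambda$* is a graded $A$-module isomorphic to $j^\lambda_*\bar V$ for an injective (resp. arbitrary) graded $A_\lambda$-module $\bar V$ that is locally finite-dimensional and bounded above. A graded module $V$ has a *$\nabla$-flag* (resp. *$\bar\nabla$-flag*) if for some $n\ge0$ there are a filtration $V=V_0\supsetneq V_1\supsetneq\dots\supsetneq V_n=0$ by graded submodules and distinct $\lambda_1,\dots,\lambda_n\in\Lambda$ such that $V_{r-1}/V_r$ is a $\nabla$-layer (resp. $\bar\nabla$-layer) of type $\lambda_r$ for each $r$. Let $\operatorname{supp}_\nabla(V)=\{\dot b: b\in\mathbf B,\ \operatorname{Hom}_A(\bar\Delta(b),V)\ne0\}$, $\operatorname{supp}_{\bar\nabla}(V)=\{\dot b: b\in\mathbf B,\ \operatorname{Hom}_A(\Delta(b),V)\neq0\}$, $(V:\nabla(b))_q=\dim_q\operatorname{Hom}_A(\bar\Delta(b),V)$ and $(V:\bar\nabla(b))_q=\dim_q\operatorname{Hom}_A(\Delta(b),V)$. For a finite lower set $\Gamma\subseteq\Lambda$ let $e_\Gamma=\sum_{\lambda\in\Gamma}e_\lambda$,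 $V^\Gamma=\{v\in V: e_\Gamma Av=0\}$, $A_\Gamma=e_\Gamma Ae_\Gamma$ (with distinguished idempotents $1_s$, $\dot s\in\Gamma$, all special, and weight poset $\Gamma$) and $j^\Gamma V=e_\Gamma V\in A_\Gamma\text{-gmod}$. $V$ has a *descending $\nabla$-flag* (resp. *descending $\bar\nabla$-flag*) if $V/V^\Gamma$ has a $\nabla$-flag (resp. $\bar\nabla$-flag) for every finite lower set $\Gamma\subseteq\Lambda$. **Theorem.** Let $V$ be a graded left $A$-module that is locally finite-dimensional and bounded above. *(A1)* The following are equivalent: (a) $V$ has a $\nabla$-flag; (b) $|\operatorname{supp}_\nabla(V)|<\infty$ and $\operatorname{Ext}^1_A(\bar\Delta(b),V)=0$ for all $b\in\mathbf B$; (c) $|\operatorname{supp}_\nabla(V)|<\infty$ and $\operatorname{Ext}^n_A(\bar\Delta(b),V)=0$ for all $b\in\mathbf B$ and $n\ge1$. *(A2)* The following are equivalent: (a) $V$ has a $\bar\nabla$-flag; (b) $|\operatorname{supp}_{\bar\nabla}(V)|<\infty$ and $\operatorname{Ext}^1_A(\Delta(b),V)=0$ for all $b\in\mathbf B$; (c)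 $|\operatorname{supp}_{\bar\nabla}(V)|<\infty$ and $\operatorname{Ext}^n_A(\Delta(b),V)=0$ for all $b\in\mathbf B$ and $n\ge1$. *(B1)* The following are equivalent: (a) $V$ has a descending $\nabla$-flag; (b) $j^\Gamma V$ has a $\nabla$-flag (over $A_\Gamma$) for all finite lower sets $\Gamma\subseteq\Lambda$; (c) $\operatorname{Ext}^1_A(\bar\Delta(b),V)=0$ for all $b\in\mathbf B$; (d) $\operatorname{Ext}^n_A(\bar\Delta(b),V)=0$ for all $b\in\mathbf B$ and $n\ge1$. When this holds, for every finite lower set $\Gamma\subseteq\Lambda$ both $V/V^\Gamma$ and $V^\Gamma$ have descending $\nabla$-flags, and for every $b\in\mathbf B$ the series $(V:\nabla(b))_q$, $(V/V^\Gamma:\nabla(b))_q$ and $(V^\Gamma:\nabla(b))_q$ are well-defined elements of $\mathbb N(\!(q)\!)$, with $$(V/V^\Gamma:\nabla(b))_q=\begin{cases}(V:\nabla(b))_q&\dot b\in\Gamma\\0&\dot b\notin\Gamma,\end{cases}\qquad (V^\Gamma:\nabla(b))_q=\begin{cases}0&\dot b\in\Gamma\\(V:\nabla(b))_q&\dot b\notin\Gamma.\end{cases}$$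 *(B2)* The same as (B1) with $\nabla$ replaced by $\bar\nabla$ and $\bar\Delta(b)$ replaced by $\Delta(b)$ throughout. -/

import Mathlib

open CategoryTheory CategoryTheory.Limits
open scoped TensorProduct

universe u v w

namespace GradedTriangular

/-! ### Locally unital graded algebras -/

/-- A locally unital graded algebra `A = ⨁_{i,j ∈ I, d ∈ ℤ} 1_i A_d 1_j`, given by its homogeneous
blocks `blk i j d = 1_i A_d 1_j`, the distinguished idempotents `one i = 1_i ∈ 1_i A_0 1_i`,
and the multiplication maps `1_i A_d 1_j × 1_j A_e 1_l → 1_i A_{d+e} 1_l`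
(the product of two blocks whose inner indices differ is zero). -/
structure LUGAlgebra (k : Type u) [Field k] (I : Type u) where
  blk : I → I → ℤ → Type u
  [addCommGroup : ∀ i j d, AddCommGroup (blk i j d)]
  [module : ∀ i j d, Module k (blk i j d)]
  one : ∀ i, blk i i 0
  mul : ∀ {i j l : I} {d e f : ℤ}, d + e = f → (blk i j d →ₗ[k] blk j l e →ₗ[k] blk i l f)
  one_mul : ∀ {i j : I} {d : ℤ} (a : blk i j d), mul (zero_add d) (one i) a = a
  mul_one : ∀ {i j : I} {d : ℤ} (a : blk i j d), mul (add_zero d) a (one j) = a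
  mul_assoc : ∀ {i j l m : I} {d e f de ef x : ℤ} (h₁ : d + e = de) (h₂ : e + f = ef)
    (h₃ : de + f = x) (h₄ : d + ef = x) (a : blk i j d) (b : blk j l e) (c : blk l m f),
    mul h₃ (mul h₁ a b) c = mul h₄ a (mul h₂ b c)

attribute [instance] LUGAlgebra.addCommGroup LUGAlgebra.module

section Field

variable {k : Type u} [Field k] {I : Type u}

namespace LUGAlgebra

variable (A : LUGAlgebra k I)

/-- All `1_i A_d 1_j` are finite-dimensional. -/
def LocallyFiniteDimensional : Prop := ∀ i j d, Module.Finite k (A.blk i j d)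

/-- For all `i, j` one has `1_i A_d 1_j = 0` for `d ≪ 0`. -/
def BoundedBelow : Prop := ∀ i j, ∃ N : ℤ, ∀ d < N, Subsingleton (A.blk i j d)

/-- A homogeneous two-sided ideal `J = ⨁ 1_i J_d 1_j`. -/
structure GIdeal where
  carrier : ∀ i j d, Submodule k (A.blk i j d)
  mul_mem_left : ∀ {i j l : I} {d e f : ℤ} (h : d + e = f) (a : A.blk i j d) {b : A.blk j l e},
    b ∈ carrier j l e → A.mul h a b ∈ carrier i l f
  mul_mem_right : ∀ {i j l : I} {d e f : ℤ} (h : d + e = f) {a : A.blk i j d} (b : A.blk j l e),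
    a ∈ carrier i j d → A.mul h a b ∈ carrier i l f

/-- The two-sided ideal of `A` generated by the idempotents `1_t`, `t ∈ T`. -/
def idealGen (T : Set I) : A.GIdeal where
  carrier i j d := Submodule.span k
    {x | ∃ t ∈ T, ∃ (c e : ℤ) (h : c + e = d) (a : A.blk i t c) (b : A.blk t j e),
      x = A.mul h a b}
  mul_mem_left {i j l d e f} h a {b} hb := by
    induction hb using Submodule.span_induction with
    | mem x hx =>
      obtain ⟨t, ht, c, e', h', a', b', rfl⟩ := hx
      refine Submodule.subset_span ⟨t, ht, d + c, e', by omega, A.mul rfl a a', b', ?_⟩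
      exact (A.mul_assoc _ _ _ _ _ _ _).symm
    | zero => rw [map_zero]; exact Submodule.zero_mem _
    | add x y _ _ hx hy => rw [map_add]; exact Submodule.add_mem _ hx hy
    | smul r x _ hx => rw [map_smul]; exact Submodule.smul_mem _ r hx
  mul_mem_right {i j l d e f} h {a} b ha := by
    induction ha using Submodule.span_induction with
    | mem x hx =>
      obtain ⟨t, ht, c, e', h', a', b', rfl⟩ := hx
      refine Submodule.subset_span ⟨t, ht, c, e' + e, by omega, a', A.mul rfl b' b, ?_⟩
      exact A.mul_assoc _ _ _ _ _ _ _
    | zero => rw [map_zero, LinearMap.zero_apply]; exact Submodule.zero_mem _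
    | add x y _ _ hx hy => rw [map_add, LinearMap.add_apply]; exact Submodule.add_mem _ hx hy
    | smul r x _ hx => rw [map_smul, LinearMap.smul_apply]; exact Submodule.smul_mem _ r hx

variable {A}

/-- The multiplication of the quotient algebra `A / J`. -/
def GIdeal.quotMul (J : A.GIdeal) {i j l : I} {d e f : ℤ} (h : d + e = f) :
    (A.blk i j d ⧸ J.carrier i j d) →ₗ[k] (A.blk j l e ⧸ J.carrier j l e) →ₗ[k]
      (A.blk i l f ⧸ J.carrier i l f) :=
  (J.carrier i j d).liftQ
    ((J.carrier j l e).liftQ ((A.mul h).compr₂ (J.carrier i l f).mkQ).flip (by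
      intro b hb
      ext a
      simpa using J.mul_mem_left h a hb)).flip (by
    intro a ha
    ext b
    exact (Submodule.Quotient.mk_eq_zero _).2 (J.mul_mem_right h b ha))

@[simp]
lemma GIdeal.quotMul_mk (J : A.GIdeal) {i j l : I} {d e f : ℤ} (h : d + e = f)
    (a : A.blk i j d) (b : A.blk j l e) :
    J.quotMul h ((J.carrier i j d).mkQ a) ((J.carrier j l e).mkQ b)
      = (J.carrier i l f).mkQ (A.mul h a b) := rfl

variable (A)

/-- The quotient algebra `A / J`, with distinguished idempotents the images of the `1_i`. -/
def quot (J : A.GIdeal) : LUGAlgebra k I where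
  blk i j d := A.blk i j d ⧸ J.carrier i j d
  one i := (J.carrier i i 0).mkQ (A.one i)
  mul h := J.quotMul h
  one_mul {i j d} a := by
    obtain ⟨a, rfl⟩ := (J.carrier _ _ _).mkQ_surjective a
    rw [GIdeal.quotMul_mk, A.one_mul]
  mul_one {i j d} a := by
    obtain ⟨a, rfl⟩ := (J.carrier _ _ _).mkQ_surjective a
    rw [GIdeal.quotMul_mk, A.mul_one]
  mul_assoc {i j l m d e f de ef x} h₁ h₂ h₃ h₄ a b c := by
    obtain ⟨a, rfl⟩ := (J.carrier _ _ _).mkQ_surjective a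
    obtain ⟨b, rfl⟩ := (J.carrier _ _ _).mkQ_surjective b
    obtain ⟨c, rfl⟩ := (J.carrier _ _ _).mkQ_surjective c
    simp only [GIdeal.quotMul_mk]
    rw [A.mul_assoc h₁ h₂ h₃ h₄]

/-- The idempotent truncation `⨁_{s,t ∈ T} 1_s A 1_t`; this is the unital algebra `e A e` with
`e = ∑_{t ∈ T} 1_t` if `T` is finite. -/
def trunc (T : Set I) : LUGAlgebra k T where
  blk s t d := A.blk s t d
  one s := A.one s
  mul h := A.mul h
  one_mul a := A.one_mul a
  mul_one a := A.mul_one a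
  mul_assoc h₁ h₂ h₃ h₄ a b c := A.mul_assoc h₁ h₂ h₃ h₄ a b c

end LUGAlgebra

/-! ### Graded modules -/

/-- A (locally unital) graded left `A`-module `V = ⨁_{i ∈ I, d ∈ ℤ} 1_i V_d`, given by its
homogeneous pieces `pc i d = 1_i V_d` and the action maps
`1_i A_d 1_j × 1_j V_e → 1_i V_{d+e}`. -/
structure GMod (A : LUGAlgebra k I) where
  pc : I → ℤ → Type u
  [addCommGroup : ∀ i d, AddCommGroup (pc i d)]
  [module : ∀ i d, Module k (pc i d)]
  act : ∀ {i j : I} {d e f : ℤ}, d + e = f → (A.blk i j d →ₗ[k] pc j e →ₗ[k] pc i f)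
  one_act : ∀ {i : I} {d : ℤ} (v : pc i d), act (zero_add d) (A.one i) v = v
  mul_act : ∀ {i j l : I} {d e f de ef x : ℤ} (h₁ : d + e = de) (h₂ : e + f = ef)
    (h₃ : de + f = x) (h₄ : d + ef = x) (a : A.blk i j d) (b : A.blk j l e) (v : pc l f),
    act h₃ (A.mul h₁ a b) v = act h₄ a (act h₂ b v)

attribute [instance] GMod.addCommGroup GMod.module

namespace GMod

variable {A : LUGAlgebra k I}

/-- A degree-preserving homomorphism of graded modules. -/
@[ext]
structure Hom (M N : GMod A) where
  app : ∀ i d, M.pc i d →ₗ[k] N.pc i d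
  app_act : ∀ {i j : I} {d e f : ℤ} (h : d + e = f) (a : A.blk i j d) (v : M.pc j e),
    app i f (M.act h a v) = N.act h a (app j e v)

/-- The category `A-gmod` of graded left `A`-modules and degree-preserving homomorphisms. -/
instance : Category.{u} (GMod A) where
  Hom M N := Hom M N
  id M := ⟨fun _ _ => LinearMap.id, fun _ _ _ => rfl⟩
  comp f g := ⟨fun i d => (g.app i d).comp (f.app i d), fun h a v => by
    simp [f.app_act, g.app_act]⟩

@[ext]
lemma hom_ext {M N : GMod A} {f g : M ⟶ N} (h : ∀ i d v, f.app i d v = g.app i d v) : f = g :=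
  Hom.ext (funext fun i => funext fun d => LinearMap.ext (h i d))

@[simp] lemma id_app (M : GMod A) (i : I) (d : ℤ) : (𝟙 M : M ⟶ M).app i d = LinearMap.id := rfl

@[simp] lemma comp_app {M N P : GMod A} (f : M ⟶ N) (g : N ⟶ P) (i : I) (d : ℤ) :
    (f ≫ g).app i d = (g.app i d).comp (f.app i d) := rfl

section HomModule

variable {M N : GMod A}

instance : Zero (M ⟶ N) := ⟨⟨fun _ _ => 0, fun _ _ _ => by simp⟩⟩
instance : Add (M ⟶ N) :=
  ⟨fun f g => ⟨fun i d => f.app i d + g.app i d, fun h a v => by simp [f.app_act, g.app_act]⟩⟩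
instance : Neg (M ⟶ N) := ⟨fun f => ⟨fun i d => -f.app i d, fun h a v => by simp [f.app_act]⟩⟩
instance : Sub (M ⟶ N) :=
  ⟨fun f g => ⟨fun i d => f.app i d - g.app i d, fun h a v => by simp [f.app_act, g.app_act]⟩⟩
instance {R : Type*} [Monoid R] [DistribMulAction R k] [∀ i d, DistribMulAction R (N.pc i d)]
    [∀ i d, SMulCommClass k R (N.pc i d)] [∀ i d, IsScalarTower R k (N.pc i d)] :
    SMul R (M ⟶ N) :=
  ⟨fun r f => ⟨fun i d => r • f.app i d, fun {i j d e f'} h a v => by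
    rw [LinearMap.smul_apply, LinearMap.smul_apply, f.app_act,
      ← smul_one_smul k r (N.act h a _), ← smul_one_smul k r (f.app j e v), map_smul]⟩⟩

/-- The family of components of a homomorphism. -/
def toPi (f : M ⟶ N) : ∀ i d, M.pc i d →ₗ[k] N.pc i d := f.app

lemma toPi_injective : Function.Injective (toPi (M := M) (N := N)) := fun _ _ h => Hom.ext h

instance : AddCommGroup (M ⟶ N) :=
  toPi_injective.addCommGroup toPi rfl (fun _ _ => rfl) (fun _ => rfl) (fun _ _ => rfl)
    (fun _ _ => rfl) (fun _ _ => rfl)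

/-- `toPi` as an additive map. -/
def toPiHom : (M ⟶ N) →+ ∀ i d, M.pc i d →ₗ[k] N.pc i d where
  toFun := toPi
  map_zero' := rfl
  map_add' _ _ := rfl

instance : Module k (M ⟶ N) := toPi_injective.module k toPiHom (fun _ _ => rfl)

@[simp] lemma zero_app (i : I) (d : ℤ) : (0 : M ⟶ N).app i d = 0 := rfl
@[simp] lemma add_app (f g : M ⟶ N) (i : I) (d : ℤ) :
    (f + g).app i d = f.app i d + g.app i d := rfl
@[simp] lemma smul_app (r : k) (f : M ⟶ N) (i : I) (d : ℤ) :
    (r • f).app i d = r • f.app i d := rfl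

end HomModule

instance : Preadditive (GMod A) where
  add_comp _ _ _ _ _ _ := by ext; simp
  comp_add _ _ _ _ _ _ := by ext; simp

instance : Linear k (GMod A) where
  smul_comp _ _ _ _ _ _ := by ext; simp
  comp_smul _ _ _ _ _ _ := by ext; simp

end GMod

/-- A graded submodule of a graded module. -/
@[ext]
structure GSub {A : LUGAlgebra k I} (M : GMod A) where
  carrier : ∀ i d, Submodule k (M.pc i d)
  act_mem : ∀ {i j : I} {d e f : ℤ} (h : d + e = f) (a : A.blk i j d) {v : M.pc j e},
    v ∈ carrier j e → M.act h a v ∈ carrier i f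

namespace GSub

variable {A : LUGAlgebra k I} {M N : GMod A}

instance : PartialOrder (GSub M) := PartialOrder.lift carrier fun _ _ h => GSub.ext h
instance : Top (GSub M) := ⟨⟨fun _ _ => ⊤, fun _ _ _ _ => trivial⟩⟩
instance : Bot (GSub M) := ⟨⟨fun _ _ => ⊥, fun h a v hv => by
  rw [Submodule.mem_bot] at hv ⊢; rw [hv, map_zero]⟩⟩

/-- A graded submodule as a graded module. -/
def toGMod (U : GSub M) : GMod A where
  pc i d := U.carrier i d
  act {i j d e f} h := LinearMap.mk₂ k
    (fun a (v : U.carrier j e) => (⟨M.act h a v, U.act_mem h a v.2⟩ : U.carrier i f))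
    (fun _ _ _ => by ext; simp) (fun _ _ _ => by ext; simp)
    (fun _ _ _ => by ext; simp) (fun _ _ _ => by ext; simp)
  one_act v := Subtype.ext (M.one_act v.1)
  mul_act h₁ h₂ h₃ h₄ a b v := Subtype.ext (M.mul_act h₁ h₂ h₃ h₄ a b v.1)

/-- The inclusion of a graded submodule. -/
def ι (U : GSub M) : U.toGMod ⟶ M := ⟨fun i d => (U.carrier i d).subtype, fun _ _ _ => rfl⟩

/-- The preimage of a graded submodule. -/
def comap (f : M ⟶ N) (U : GSub N) : GSub M where
  carrier i d := (U.carrier i d).comap (f.app i d)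
  act_mem h a v hv := by
    rw [Submodule.mem_comap, f.app_act]
    exact U.act_mem h a hv

/-- The image of a homomorphism. -/
def range (f : M ⟶ N) : GSub N where
  carrier i d := LinearMap.range (f.app i d)
  act_mem h a v hv := by
    obtain ⟨v, rfl⟩ := hv
    exact ⟨M.act h a v, f.app_act h a v⟩

/-- The quotient of a graded module by a graded submodule. -/
def quot (U : GSub M) : GMod A where
  pc i d := M.pc i d ⧸ U.carrier i d
  act {i j d e f} h :=
    ((U.carrier j e).liftQ ((M.act h).compr₂ (U.carrier i f).mkQ).flip (by
      intro v hv
      ext a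
      simpa using U.act_mem h a hv)).flip
  one_act {i d} v := by
    obtain ⟨v, rfl⟩ := (U.carrier _ _).mkQ_surjective v
    exact congrArg (U.carrier i d).mkQ (M.one_act v)
  mul_act {i j l d e f de ef x} h₁ h₂ h₃ h₄ a b v := by
    obtain ⟨v, rfl⟩ := (U.carrier _ _).mkQ_surjective v
    exact congrArg (U.carrier i x).mkQ (M.mul_act h₁ h₂ h₃ h₄ a b v)

/-- The quotient map. -/
def π (U : GSub M) : M ⟶ U.quot := ⟨fun i d => (U.carrier i d).mkQ, fun _ _ _ => rfl⟩

/-- The subquotient `W / U` for graded submodules `U ⊆ W`. -/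
def subquot (W U : GSub M) : GMod A := (comap W.ι U).quot

end GSub

/-! ### `A-gmod` is an abelian category -/

namespace GMod

variable {A : LUGAlgebra k I} {M N : GMod A}

/-- The kernel of a homomorphism. -/
def ker (f : M ⟶ N) : GSub M := GSub.comap f ⊥

lemma mem_ker {f : M ⟶ N} {i : I} {d : ℤ} {v : M.pc i d} :
    v ∈ (ker f).carrier i d ↔ f.app i d v = 0 := Iff.rfl

lemma ker_condition (f : M ⟶ N) : (ker f).ι ≫ f = 0 := by
  ext i d v
  exact v.2

/-- Maps killed by `f` factor through the kernel. -/
def kerLift {f : M ⟶ N} {T : GMod A} (g : T ⟶ M) (h : g ≫ f = 0) : T ⟶ (ker f).toGMod where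
  app i d := (g.app i d).codRestrict _ fun v => by
    have := congrArg (fun φ : T ⟶ N => φ.app i d v) h
    exact this
  app_act h a v := Subtype.ext (g.app_act h a v)

/-- `ker f` is a kernel. -/
def kerIsLimit (f : M ⟶ N) : IsLimit (KernelFork.ofι (ker f).ι (ker_condition f)) :=
  KernelFork.IsLimit.ofι _ _ (fun g h => kerLift g h) (fun _ _ => rfl) (fun g h m hm => by
    ext i d v
    apply Subtype.ext
    exact congrArg (fun φ : _ ⟶ M => φ.app i d v) hm)

lemma range_condition (f : M ⟶ N) : f ≫ (GSub.range f).π = 0 := by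
  ext i d v
  exact (Submodule.Quotient.mk_eq_zero _).2 ⟨v, rfl⟩

/-- Maps that vanish on a submodule factor through the quotient. -/
def quotDesc (U : GSub M) {T : GMod A} (g : M ⟶ T)
    (h : ∀ i d, ∀ v ∈ U.carrier i d, g.app i d v = 0) : U.quot ⟶ T where
  app i d := (U.carrier i d).liftQ (g.app i d) (h i d)
  app_act {i j d e f} h a v := by
    obtain ⟨v, rfl⟩ := (U.carrier _ _).mkQ_surjective v
    exact g.app_act h a v

/-- `N / im f` is a cokernel. -/
def cokerIsColimit (f : M ⟶ N) :
    IsColimit (CokernelCofork.ofπ (GSub.range f).π (range_condition f)) :=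
  CokernelCofork.IsColimit.ofπ _ _
    (fun g h => quotDesc _ g (by
      rintro i d _ ⟨v, rfl⟩
      exact congrArg (fun φ : M ⟶ _ => φ.app i d v) h))
    (fun _ _ => rfl) (fun g h m hm => by
      ext i d v
      obtain ⟨v, rfl⟩ := ((GSub.range f).carrier _ _).mkQ_surjective v
      exact congrArg (fun φ : N ⟶ _ => φ.app i d v) hm)

lemma injective_of_mono (f : M ⟶ N) [Mono f] (i : I) (d : ℤ) :
    Function.Injective (f.app i d) := by
  rw [injective_iff_map_eq_zero]
  intro v hv
  have h : (ker f).ι = 0 := by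
    rw [← cancel_mono f, ker_condition, zero_comp]
  exact congrArg (fun φ : (ker f).toGMod ⟶ M => φ.app i d ⟨v, hv⟩) h

lemma surjective_of_epi (f : M ⟶ N) [Epi f] (i : I) (d : ℤ) :
    Function.Surjective (f.app i d) := by
  intro v
  have h : (GSub.range f).π = 0 := by
    rw [← cancel_epi f, range_condition, comp_zero]
  exact (Submodule.Quotient.mk_eq_zero _).1
    (congrArg (fun φ : N ⟶ (GSub.range f).quot => φ.app i d v) h)

lemma exists_lift_of_injective (f : M ⟶ N) (hf : ∀ i d, Function.Injective (f.app i d))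
    {T : GMod A} (g : T ⟶ N) (hg : ∀ i d v, ∃ w, f.app i d w = g.app i d v) :
    ∃ l : T ⟶ M, l ≫ f = g := by
  choose l hl using hg
  refine ⟨⟨fun i d => ⟨⟨l i d, fun v w => hf i d ?_⟩, fun r v => hf i d ?_⟩, ?_⟩, ?_⟩
  · simp [hl]
  · simp [hl]
  · intro i j d e f' h a v
    apply hf
    change f.app _ _ (l _ _ _) = f.app _ _ (M.act h a (l _ _ _))
    rw [hl, f.app_act, hl, g.app_act]
  · ext i d v
    exact hl i d v

lemma exists_desc_of_surjective (f : M ⟶ N) (hf : ∀ i d, Function.Surjective (f.app i d))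
    {T : GMod A} (g : M ⟶ T) (hg : ∀ i d v, f.app i d v = 0 → g.app i d v = 0) :
    ∃ l : N ⟶ T, f ≫ l = g := by
  have key : ∀ i d v w, f.app i d v = f.app i d w → g.app i d v = g.app i d w := by
    intro i d v w h
    rw [← sub_eq_zero, ← map_sub]
    exact hg i d _ (by rw [map_sub, h, sub_self])
  choose s hs using hf
  refine ⟨⟨fun i d => ⟨⟨fun v => g.app i d (s i d v), fun v w => ?_⟩, fun r v => ?_⟩, ?_⟩, ?_⟩
  · rw [← map_add]
    exact key _ _ _ _ (by simp [hs])
  · rw [RingHom.id_apply, ← map_smul]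
    exact key _ _ _ _ (by simp [hs])
  · intro i j d e f' h a v
    change g.app _ _ _ = T.act h a (g.app _ _ _)
    rw [← g.app_act]
    exact key _ _ _ _ (by rw [hs, f.app_act, hs])
  · ext i d v
    exact key _ _ _ _ (hs _ _ _)

instance : IsNormalMonoCategory (GMod A) where
  normalMonoOfMono {M N} f _ := by
    have hl : ∀ {T : GMod A} (g : T ⟶ N), g ≫ (GSub.range f).π = 0 → ∃ l : T ⟶ M, l ≫ f = g :=
      fun {T} g hg => exists_lift_of_injective f (injective_of_mono f) g fun i d v =>
        (Submodule.Quotient.mk_eq_zero _).1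
          (congrArg (fun φ : T ⟶ (GSub.range f).quot => φ.app i d v) hg)
    exact ⟨⟨(GSub.range f).quot, (GSub.range f).π, range_condition f,
      KernelFork.IsLimit.ofι _ _ (fun g hg => (hl g hg).choose)
        (fun g hg => (hl g hg).choose_spec)
        (fun g hg m hm => by
          rw [← cancel_mono f, hm, (hl g hg).choose_spec])⟩⟩

instance : IsNormalEpiCategory (GMod A) where
  normalEpiOfEpi {M N} f _ := by
    have hl : ∀ {T : GMod A} (g : M ⟶ T), (ker f).ι ≫ g = 0 → ∃ l : N ⟶ T, f ≫ l = g :=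
      fun {T} g hg => exists_desc_of_surjective f (surjective_of_epi f) g fun i d v hv =>
        congrArg (fun φ : (ker f).toGMod ⟶ T => φ.app i d ⟨v, hv⟩) hg
    exact ⟨⟨(ker f).toGMod, (ker f).ι, ker_condition f,
      CokernelCofork.IsColimit.ofπ _ _ (fun g hg => (hl g hg).choose)
        (fun g hg => (hl g hg).choose_spec)
        (fun g hg m hm => by
          rw [← cancel_epi f, hm, (hl g hg).choose_spec])⟩⟩

/-- The zero module. -/
def zeroMod (A : LUGAlgebra k I) : GMod A where
  pc _ _ := PUnit
  act _ := 0
  one_act _ := rfl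
  mul_act _ _ _ _ _ _ _ := rfl

/-- The direct sum of two modules. -/
def prod (M N : GMod A) : GMod A where
  pc i d := M.pc i d × N.pc i d
  act {i j d e f} h := LinearMap.mk₂ k (fun a v => (M.act h a v.1, N.act h a v.2))
    (fun _ _ _ => by simp) (fun _ _ _ => by simp) (fun _ _ _ => by simp) (fun _ _ _ => by simp)
  one_act v := Prod.ext (M.one_act v.1) (N.one_act v.2)
  mul_act h₁ h₂ h₃ h₄ a b v :=
    Prod.ext (M.mul_act h₁ h₂ h₃ h₄ a b v.1) (N.mul_act h₁ h₂ h₃ h₄ a b v.2)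

instance : HasTerminal (GMod A) :=
  (IsTerminal.ofUniqueHom (Y := zeroMod A) (fun _ => 0) (fun _ _ => rfl)).hasTerminal

instance : HasBinaryProducts (GMod A) := by
  have : ∀ {M N : GMod A}, HasLimit (pair M N) := fun {M N} =>
    ⟨⟨⟨BinaryFan.mk (P := prod M N)
        ⟨fun _ _ => LinearMap.fst k _ _, fun _ _ _ => rfl⟩
        ⟨fun _ _ => LinearMap.snd k _ _, fun _ _ _ => rfl⟩,
      BinaryFan.IsLimit.mk _
        (fun f g => ⟨fun i d => (f.app i d).prod (g.app i d), fun h a v =>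
          Prod.ext (f.app_act h a v) (g.app_act h a v)⟩)
        (fun _ _ => rfl) (fun _ _ => rfl)
        (fun {T} f g m hf hg => by
          ext i d v
          exact Prod.ext (congrArg (fun φ : T ⟶ M => φ.app i d v) hf)
            (congrArg (fun φ : T ⟶ N => φ.app i d v) hg))⟩⟩⟩
  exact hasBinaryProducts_of_hasLimit_pair _

instance : Abelian (GMod A) where
  has_finite_products := hasFiniteProducts_of_has_binary_and_terminal
  has_kernels := ⟨fun f => ⟨⟨⟨_, kerIsLimit f⟩⟩⟩⟩
  has_cokernels := ⟨fun f => ⟨⟨⟨_, cokerIsColimit f⟩⟩⟩⟩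

instance : HasExt.{u + 1} (GMod A) := HasExt.standard _

/-! ### Degree shifts, finiteness conditions, functors -/

/-- The degree shift `q^n V`, with `(q^n V)_d = V_{d+n}`. -/
def shift (n : ℤ) (M : GMod A) : GMod A where
  pc i d := M.pc i (d + n)
  act h := M.act (by omega)
  one_act {i d} v := M.one_act v
  mul_act h₁ h₂ h₃ h₄ a b v := M.mul_act h₁ (by omega) (by omega) (by omega) a b v

/-- All `1_i V_d` are finite-dimensional. -/
def LocallyFiniteDimensional (M : GMod A) : Prop := ∀ i d, Module.Finite k (M.pc i d)

/-- For all `i` one has `1_i V_d = 0` for `d ≫ 0`. -/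
def BoundedAbove (M : GMod A) : Prop := ∀ i, ∃ N : ℤ, ∀ d > N, Subsingleton (M.pc i d)

/-- An `A / J`-module viewed as an `A`-module. -/
def inflate {J : A.GIdeal} (M : GMod (A.quot J)) : GMod A where
  pc i d := M.pc i d
  act {i j d _ _} h := (M.act h).comp (J.carrier i j d).mkQ
  one_act v := M.one_act v
  mul_act h₁ h₂ h₃ h₄ a b v := M.mul_act h₁ h₂ h₃ h₄ (Submodule.mkQ _ a) (Submodule.mkQ _ b) v

/-- The idempotent truncation functor `j`, `V ↦ eV = ⨁_{t ∈ T} 1_t V`, on objects. -/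
def jTrunc (T : Set I) (M : GMod A) : GMod (A.trunc T) where
  pc t d := M.pc t d
  act h := M.act h
  one_act v := M.one_act v
  mul_act h₁ h₂ h₃ h₄ a b v := M.mul_act h₁ h₂ h₃ h₄ a b v

section jStar

variable (T : Set I) (M : GMod (A.trunc T))

/-- Triples `(t, c, e)` with `t ∈ T` and `c + d = e`. -/
abbrev jStarIndex (d : ℤ) : Type u := {p : T × ℤ × ℤ // p.2.1 + d = p.2.2}

/-- The space `Hom_{eAe}(e A 1_i, V)_d` of `eAe`-module homomorphisms of degree `d`:
families `φ` of linear maps `1_t A_c 1_i → 1_t V_{c+d}` that commute with the action of `eAe`. -/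
def jStarPc (i : I) (d : ℤ) :
    Submodule k (∀ p : jStarIndex T d, A.blk p.1.1 i p.1.2.1 →ₗ[k] M.pc p.1.1 p.1.2.2) where
  carrier := {φ | ∀ (s t : T) (x c y e f : ℤ) (hx : x + c = y) (he : c + d = e) (hf : y + d = f)
    (hxe : x + e = f) (b : A.blk s t x) (a : A.blk t i c),
    φ ⟨(s, y, f), hf⟩ (A.mul hx b a) = M.act (A := A.trunc T) hxe b (φ ⟨(t, c, e), he⟩ a)}
  zero_mem' _ _ _ _ _ _ _ _ _ _ _ _ _ := by simp
  add_mem' hφ hψ s t x c y e f hx he hf hxe b a := by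
    simp [hφ s t x c y e f hx he hf hxe b a, hψ s t x c y e f hx he hf hxe b a]
  smul_mem' r φ hφ s t x c y e f hx he hf hxe b a := by
    simp [hφ s t x c y e f hx he hf hxe b a]

/-- The right adjoint `j_* V = ⨁_{i ∈ I} Hom_{eAe}(e A 1_i, V)` of `j`, on objects;
`a ∈ 1_{i'} A 1_i` acts by `(a φ)(x) = φ(x a)`. -/
def jStar : GMod A where
  pc i d := jStarPc T M i d
  act {i' i x d f} h := LinearMap.mk₂ k
    (fun (a : A.blk i' i x) (φ : jStarPc T M i d) =>
      (⟨fun p => (φ.1 ⟨(p.1.1, p.1.2.1 + x, p.1.2.2), by have := p.2; simp only; omega⟩).comp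
          ((A.mul rfl).flip a), by
        intro s t y c z e g hy he hg hye b b'
        simp only [LinearMap.comp_apply, LinearMap.flip_apply]
        rw [A.mul_assoc hy rfl rfl (by omega) b b' a]
        exact φ.2 s t y (c + x) (z + x) e g (by omega) (by omega) (by omega) hye b _⟩ :
        jStarPc T M i' f))
    (fun _ _ _ => by ext; simp) (fun _ _ _ => by ext; simp)
    (fun _ _ _ => by ext; simp) (fun _ _ _ => by ext; simp)
  one_act {i d} φ := by
    apply Subtype.ext
    funext ⟨⟨t, c, e⟩, he⟩
    ext b
    have key : ∀ (c' : ℤ) (hc : c' = c) (h' : c' + d = e) (b' : A.blk t i c'),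
        (hc ▸ b' : A.blk t i c) = b → φ.1 ⟨(t, c', e), h'⟩ b' = φ.1 ⟨(t, c, e), he⟩ b := by
      rintro c' rfl h' b' rfl
      rfl
    have h2 : ∀ (c' : ℤ) (hc : c' = c) (hc' : c + 0 = c'),
        (hc ▸ (A.mul hc' b (A.one i)) : A.blk t i c) = b := by
      rintro c' rfl hc'
      exact A.mul_one b
    exact key (c + 0) (add_zero c) _ _ (h2 _ _ _)
  mul_act {i j l d e f de ef x} h₁ h₂ h₃ h₄ a b φ := by
    apply Subtype.ext
    funext ⟨⟨t, c, y⟩, hy⟩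
    ext b'
    have key : ∀ (c₁ c₂ : ℤ) (hc : c₁ = c₂) (hc₁ : c₁ + f = y) (hc₂ : c₂ + f = y)
        (b₁ : A.blk t l c₁) (b₂ : A.blk t l c₂), (hc ▸ b₁ : A.blk t l c₂) = b₂ →
        φ.1 ⟨(t, c₁, y), hc₁⟩ b₁ = φ.1 ⟨(t, c₂, y), hc₂⟩ b₂ := by
      rintro c₁ _ rfl hc₁ hc₂ b₁ _ rfl
      rfl
    have h2 : ∀ (c₁ c₂ : ℤ) (hc : c₁ = c₂) (hc₁ : c + de = c₁) (hc₂ : c + d + e = c₂),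
        (hc ▸ (A.mul hc₁ b' (A.mul h₁ a b)) : A.blk t l c₂) = A.mul hc₂ (A.mul rfl b' a) b := by
      rintro c₁ _ rfl hc₁ hc₂
      exact (A.mul_assoc _ _ _ _ _ _ _).symm
    exact key (c + de) (c + d + e) (by omega) _ _ _ _ (h2 _ _ _ rfl rfl)

end jStar

section jShriek

open DirectSum

variable (T : Set I) (M : GMod (A.trunc T))

/-- Triples `(t, c, e)` with `t ∈ T` and `c + e = d`. -/
abbrev jIndex (d : ℤ) : Type u := {p : T × ℤ × ℤ // p.2.1 + p.2.2 = d}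

/-- The space `1_i (⨁_{t ∈ T} A 1_t ⊗_k 1_t V)_d`. -/
abbrev jRaw (i : I) (d : ℤ) : Type u :=
  ⨁ p : jIndex T d, A.blk i p.1.1 p.1.2.1 ⊗[k] M.pc p.1.1 p.1.2.2

open Classical in
/-- The pure tensor `a ⊗ v`. -/
noncomputable def jTmul {i : I} {d c e : ℤ} (t : T) (h : c + e = d) :
    A.blk i t c →ₗ[k] M.pc t e →ₗ[k] jRaw T M i d :=
  (TensorProduct.mk k _ _).compr₂
    (DirectSum.lof k (jIndex T d) (fun p => A.blk i p.1.1 p.1.2.1 ⊗[k] M.pc p.1.1 p.1.2.2)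
      ⟨(t, c, e), h⟩)

/-- The span of the relations `a b ⊗ v = a ⊗ b v` for `a ∈ A 1_s`, `b ∈ 1_s A 1_t`, `v ∈ 1_t V`,
`s, t ∈ T`. -/
noncomputable def jRel (i : I) (d : ℤ) : Submodule k (jRaw T M i d) :=
  Submodule.span k {z | ∃ (s t : T) (x c y e f : ℤ) (hy : x + c = y) (hf : c + e = f)
    (h : y + e = d) (h' : x + f = d) (a : A.blk i s x) (b : A.blk s t c) (v : M.pc t e),
    z = jTmul T M t h (A.mul hy a b) v - jTmul T M s h' a (M.act (A := A.trunc T) hf b v)}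

open Classical in
/-- Left multiplication on `⨁_{t ∈ T} A 1_t ⊗_k 1_t V`. -/
noncomputable def jRawAct {i j : I} {d e f : ℤ} (h : d + e = f) :
    A.blk i j d →ₗ[k] jRaw T M j e →ₗ[k] jRaw T M i f :=
  (DirectSum.toModule k (jIndex T e) (A.blk i j d →ₗ[k] jRaw T M i f) fun p =>
    (((LinearMap.rTensorHom (M.pc p.1.1 p.1.2.2)).comp
      (A.mul (i := i) (j := j) (l := p.1.1) (d := d) (e := p.1.2.1) rfl)).compr₂
      (DirectSum.lof k (jIndex T f) (fun p => A.blk i p.1.1 p.1.2.1 ⊗[k] M.pc p.1.1 p.1.2.2)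
        ⟨(p.1.1, d + p.1.2.1, p.1.2.2), by have := p.2; simp only; omega⟩)).flip).flip

lemma jRawAct_tmul {i j : I} {d e f c x : ℤ} (h : d + e = f) (t : T) (hc : c + x = e)
    (a : A.blk i j d) (b : A.blk j t c) (v : M.pc t x) (h' : d + c + x = f) :
    jRawAct T M h a (jTmul T M t hc b v) = jTmul T M t h' (A.mul rfl a b) v := by
  simp [jRawAct, jTmul]

lemma jTmul_congr {i : I} {d c c' e : ℤ} (t : T) (h : c + e = d) (h' : c' + e = d) (hc : c = c')
    (a : A.blk i t c) (a' : A.blk i t c') (ha : (hc ▸ a : A.blk i t c') = a') (v : M.pc t e) :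
    jTmul T M t h a v = jTmul T M t h' a' v := by
  subst hc
  subst ha
  rfl

lemma jRaw_ext {i : I} {d : ℤ} {P : Type u} [AddCommGroup P] [Module k P]
    {f g : jRaw T M i d →ₗ[k] P}
    (h : ∀ (t : T) (c e : ℤ) (hc : c + e = d) (a : A.blk i t c) (v : M.pc t e),
      f (jTmul T M t hc a v) = g (jTmul T M t hc a v)) : f = g := by
  classical
  refine DirectSum.linearMap_ext k fun p => TensorProduct.ext' fun a v => ?_
  exact h p.1.1 p.1.2.1 p.1.2.2 p.2 a v

lemma jRawAct_rel {i j : I} {d e f : ℤ} (h : d + e = f) (a : A.blk i j d) :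
    jRel T M j e ≤ (jRel T M i f).comap (jRawAct T M h a) := by
  refine Submodule.span_le.2 ?_
  rintro _ ⟨s, t, x, c, y, e', g, hy, hg, h1, h2, b, b', v, rfl⟩
  refine Submodule.subset_span ⟨s, t, d + x, c, d + y, e', g, by omega, hg, by omega, by omega,
    A.mul rfl a b, b', v, ?_⟩
  rw [map_sub, jRawAct_tmul T M h t h1 a _ v (by omega),
    jRawAct_tmul T M h s h2 a b _ (by omega), A.mul_assoc rfl hy (by omega) rfl]

/-- The left adjoint `j_! V = A e ⊗_{eAe} V` of `j`, on objects. -/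
noncomputable def jShriek : GMod A where
  pc i d := jRaw T M i d ⧸ jRel T M i d
  act {i j d e f} h :=
    ((jRel T M j e).liftQ ((jRawAct T M h).compr₂ (jRel T M i f).mkQ).flip (by
      intro v hv
      ext a
      simpa using jRawAct_rel T M h a hv)).flip
  one_act {i d} v := by
    obtain ⟨v, rfl⟩ := (jRel T M _ _).mkQ_surjective v
    have : jRawAct T M (zero_add d) (A.one i) = LinearMap.id := by
      refine jRaw_ext T M fun t c e hc a v => ?_
      rw [jRawAct_tmul T M _ t hc _ a v (by omega)]
      refine jTmul_congr T M t _ _ (zero_add c) _ _ ?_ v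
      have h2 : ∀ (c' : ℤ) (hc : c' = c) (hc' : 0 + c = c'),
          (hc ▸ (A.mul hc' (A.one i) a) : A.blk i t c) = a := by
        rintro c' rfl hc'
        exact A.one_mul a
      exact h2 _ _ _
    exact congrArg (jRel T M i d).mkQ (congrArg (fun φ => φ v) this)
  mul_act {i j l d e f de ef x} h₁ h₂ h₃ h₄ a b v := by
    obtain ⟨v, rfl⟩ := (jRel T M _ _).mkQ_surjective v
    have : jRawAct T M h₃ (A.mul h₁ a b) = (jRawAct T M h₄ a).comp (jRawAct T M h₂ b) := by
      refine jRaw_ext T M fun t c y hc a' v => ?_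
      rw [LinearMap.comp_apply, jRawAct_tmul T M h₃ t hc _ a' v (by omega),
        jRawAct_tmul T M h₂ t hc _ a' v (by omega), jRawAct_tmul T M h₄ t _ _ _ v (by omega)]
      refine jTmul_congr T M t _ _ (by omega) _ _ ?_ v
      have h2 : ∀ (c₁ c₂ : ℤ) (hc : c₁ = c₂) (hc₁ : de + c = c₁) (hc₂ : d + (e + c) = c₂),
          (hc ▸ (A.mul hc₁ (A.mul h₁ a b) a') : A.blk i t c₂) = A.mul hc₂ a (A.mul rfl b a') := by
        rintro c₁ _ rfl hc₁ hc₂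
        exact A.mul_assoc _ _ _ _ _ _ _
      exact h2 _ _ _ _ _
    exact congrArg (jRel T M i x).mkQ (congrArg (fun φ => φ v) this)

end jShriek

end GMod

/-! ### Weights and graded triangular bases -/

/-- A set `S ⊆ I` of special indices with a map `s ↦ ṡ` to the set of weights. -/
structure Weights (I : Type u) (Λ : Type v) where
  S : Set I
  dot : S → Λ

namespace Weights

variable {Λ : Type v} (W : Weights I Λ)

/-- `S_Γ = {s ∈ S | ṡ ∈ Γ}`, as a subset of `I`. -/
def specialOver (Γ : Set Λ) : Set I := {i | ∃ h : i ∈ W.S, W.dot ⟨i, h⟩ ∈ Γ}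

/-- The weight data for the truncation to `Γ`: every index in `S_Γ` is special. -/
def restrict (Γ : Set Λ) : Weights (W.specialOver Γ) Γ where
  S := Set.univ
  dot s := ⟨W.dot ⟨s.1.1, s.1.2.fst⟩, s.1.2.snd⟩

end Weights

variable {Λ : Type v} [PartialOrder Λ]

/-- A graded triangular basis of a locally unital graded algebra `A`. The homogeneous sets
`X(i,s)`, `H(s,t)`, `Y(t,j)` are recorded degree by degree. -/
structure TriangularBasis (A : LUGAlgebra k I) (W : Weights I Λ) where
  lower_finite : ∀ lam : Λ, {mu | mu ≤ lam}.Finite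
  fiber_finite : ∀ lam : Λ, {s : W.S | W.dot s = lam}.Finite
  X : ∀ (i : I) (s : W.S) (d : ℤ), Set (A.blk i s d)
  H : ∀ (s t : W.S) (d : ℤ), Set (A.blk s t d)
  Y : ∀ (t : W.S) (j : I) (d : ℤ), Set (A.blk t j d)
  basis_linearIndependent : ∀ (i j : I) (d : ℤ), LinearIndependent k
    (fun p : Σ (s t : W.S) (c : {c : ℤ × ℤ × ℤ // c.1 + c.2.1 + c.2.2 = d}),
        X i s c.1.1 × H s t c.1.2.1 × Y t j c.1.2.2 =>
      A.mul p.2.2.1.2 (A.mul rfl p.2.2.2.1.1 p.2.2.2.2.1.1) p.2.2.2.2.2.1)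
  basis_span : ∀ (i j : I) (d : ℤ), Submodule.span k (Set.range
    (fun p : Σ (s t : W.S) (c : {c : ℤ × ℤ × ℤ // c.1 + c.2.1 + c.2.2 = d}),
        X i s c.1.1 × H s t c.1.2.1 × Y t j c.1.2.2 =>
      A.mul p.2.2.1.2 (A.mul rfl p.2.2.2.1.1 p.2.2.2.2.1.1) p.2.2.2.2.2.1)) = ⊤
  X_self_zero : ∀ s : W.S, X s s 0 = {A.one s}
  X_self_ne_zero : ∀ (s : W.S) (d : ℤ), d ≠ 0 → X s s d = ∅
  Y_self_zero : ∀ s : W.S, Y s s 0 = {A.one s}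
  Y_self_ne_zero : ∀ (s : W.S) (d : ℤ), d ≠ 0 → Y s s d = ∅
  X_triangular : ∀ s t : W.S, s ≠ t → ∀ d, (X s t d).Nonempty → W.dot t < W.dot s
  H_diagonal : ∀ s t : W.S, s ≠ t → ∀ d, (H s t d).Nonempty → W.dot s = W.dot t
  Y_triangular : ∀ s t : W.S, s ≠ t → ∀ d, (Y s t d).Nonempty → W.dot s < W.dot t
  finite_special : ∀ i : I, i ∉ W.S →
    {s : W.S | ∃ d, (X i s d).Nonempty ∨ (Y s i d).Nonempty}.Finite

/-! ### Cartan subalgebras and (co)standardization -/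

namespace LUGAlgebra

variable (A : LUGAlgebra k I) (W : Weights I Λ)

/-- `A_{≥λ}`, the quotient of `A` by the two-sided ideal generated by all
`e_μ = ∑_{s ∈ S_μ} 1_s` with `μ ≱ λ`, equivalently by all `1_s` with `ṡ ≱ λ`. -/
def upper (lam : Λ) : LUGAlgebra k I := A.quot (A.idealGen (W.specialOver {mu | ¬ lam ≤ mu}))

/-- `A_λ = ē_λ A_{≥λ} ē_λ`. -/
def cartan (lam : Λ) : LUGAlgebra k (W.specialOver {lam}) := (A.upper W lam).trunc (W.specialOver {lam})

end LUGAlgebra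

namespace GMod

variable {A : LUGAlgebra k I} (W : Weights I Λ)

/-- The standardization functor `j^λ_! = A_{≥λ} ē_λ ⊗_{A_λ} -` on objects, with values viewed as
`A`-modules. -/
noncomputable def standardize (lam : Λ) (M : GMod (A.cartan W lam)) : GMod A :=
  inflate (jShriek (A := A.upper W lam) (W.specialOver {lam}) M)

/-- The costandardization functor `j^λ_* = ⨁_i Hom_{A_λ}(ē_λ A_{≥λ} 1_i, -)` on objects, with values
viewed as `A`-modules. -/
def costandardize (lam : Λ) (M : GMod (A.cartan W lam)) : GMod A :=
  inflate (jStar (A := A.upper W lam) (W.specialOver {lam}) M)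

/-- The family `b ↦ j^λ_! M(b)`, `b ∈ B_λ`. For `M(b) = L_λ(b)` irreducible it consists of the proper
standard modules `Δ̄(b)`, for `M(b) = P_λ(b)` the projective cover of `L_λ(b)` it consists of the
standard modules `Δ(b)`. -/
noncomputable def standardFamily {B : Λ → Type w} (M : ∀ lam, B lam → GMod (A.cartan W lam)) :
    ∀ lam, B lam → GMod A :=
  fun lam b => standardize W lam (M lam b)

/-- `L_b`, `b ∈ B`, is a full set of irreducible graded `A`-modules up to isomorphism and degree
shift. -/
structure IsFullSetOfIrreducibles {B : Type w} (L : B → GMod A) : Prop where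
  simple : ∀ b, Simple (L b)
  exhaustive : ∀ M : GMod A, Simple M → ∃ b n, Nonempty (M ≅ (L b).shift n)
  irredundant : ∀ b c n, Nonempty (L b ≅ (L c).shift n) → b = c

/-- `π : P ⟶ L` is a projective cover: `P` is projective and `π` is an epimorphism with
superfluous kernel. -/
structure IsProjectiveCover {P L : GMod A} (π : P ⟶ L) : Prop where
  projective : Projective P
  epi : Epi π
  superfluous : ∀ (Q : GMod A) (g : Q ⟶ P), Epi (g ≫ π) → Epi g

/-! ### Flags -/

/-- A `∇`-layer of type `λ`. -/
def IsNablaLayer (lam : Λ) (M : GMod A) : Prop :=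
  ∃ N : GMod (A.cartan W lam), Injective N ∧ N.LocallyFiniteDimensional ∧ N.BoundedAbove ∧
    Nonempty (M ≅ costandardize W lam N)

/-- A `∇̄`-layer of type `λ`. -/
def IsBarNablaLayer (lam : Λ) (M : GMod A) : Prop :=
  ∃ N : GMod (A.cartan W lam), N.LocallyFiniteDimensional ∧ N.BoundedAbove ∧
    Nonempty (M ≅ costandardize W lam N)

/-- There is a finite filtration `M = F_0 ⊃ F_1 ⊃ ⋯ ⊃ F_n = 0` and distinct weights
`λ_1, …, λ_n` such that `F_{r-1} / F_r` is a layer of type `λ_r`. -/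
def HasFlag (IsLayer : Λ → GMod A → Prop) (M : GMod A) : Prop :=
  ∃ (n : ℕ) (F : Fin (n + 1) → GSub M) (lam : Fin n → Λ),
    F 0 = ⊤ ∧ F (Fin.last n) = ⊥ ∧ Function.Injective lam ∧
    ∀ r : Fin n, F r.succ < F r.castSucc ∧ IsLayer (lam r) (GSub.subquot (F r.castSucc) (F r.succ))

/-- `M` has a `∇`-flag. -/
def HasNablaFlag (M : GMod A) : Prop := HasFlag (IsNablaLayer W) M

/-- `M` has a `∇̄`-flag. -/
def HasBarNablaFlag (M : GMod A) : Prop := HasFlag (IsBarNablaLayer W) M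

/-- `M^Γ = {v ∈ M | e_Γ A v = 0}`. -/
def upperSub (Γ : Set Λ) (M : GMod A) : GSub M where
  carrier i d :=
    { carrier := {v | ∀ s ∈ W.specialOver Γ, ∀ (c e : ℤ) (h : c + d = e) (a : A.blk s i c),
        M.act h a v = 0}
      zero_mem' := fun _ _ _ _ _ _ => map_zero _
      add_mem' := fun hv hw s hs c e h a => by
        rw [map_add, hv s hs c e h a, hw s hs c e h a, add_zero]
      smul_mem' := fun r v hv s hs c e h a => by rw [map_smul, hv s hs c e h a, smul_zero] }
  act_mem {i j d e f} h a {v} hv := by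
    intro s hs c x hx b
    have := hv s hs (c + d) x (by omega) (A.mul rfl b a)
    rwa [M.mul_act rfl h _ hx] at this

/-- `M` has a descending `∇`-flag. -/
def HasDescendingNablaFlag (M : GMod A) : Prop :=
  ∀ Γ : Set Λ, Γ.Finite → IsLowerSet Γ → HasNablaFlag W (upperSub W Γ M).quot

/-- `M` has a descending `∇̄`-flag. -/
def HasDescendingBarNablaFlag (M : GMod A) : Prop :=
  ∀ Γ : Set Λ, Γ.Finite → IsLowerSet Γ → HasBarNablaFlag W (upperSub W Γ M).quot

/-! ### Graded `Hom` and `Ext` -/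

/-- `Ext^n_A(D, V) = ⨁_d Ext^n_A(D, q^d V)_0` vanishes. -/
def ExtVanishes (n : ℕ) (D V : GMod A) : Prop :=
  ∀ d : ℤ, Subsingleton (Abelian.Ext D (V.shift d) n)

/-- `{ḃ | Hom_A(D(b), V) ≠ 0}`, where `Hom_A(D, V) = ⨁_d Hom_A(D, q^d V)_0`; this is the
`∇`-support of `V` for `D(b) = Δ̄(b)` and its `∇̄`-support for `D(b) = Δ(b)`. -/
def support {B : Λ → Type w} (D : ∀ lam, B lam → GMod A) (V : GMod A) : Set Λ :=
  {lam | ∃ (b : B lam) (d : ℤ) (f : D lam b ⟶ V.shift d), f ≠ 0}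

/-- `dim_q Hom_A(D, V)` is a formal Laurent series in `q` with coefficients in `ℕ`: every
`Hom_A(D, V)_d` is finite-dimensional, and it is zero for `d ≫ 0`. -/
def HasQDim (D V : GMod A) : Prop :=
  (∀ d : ℤ, Module.Finite k (D ⟶ V.shift d)) ∧ ∃ N : ℤ, ∀ d > N, Subsingleton (D ⟶ V.shift d)

/-- The coefficients of `dim_q Hom_A(D, V) = ∑_d (dim Hom_A(D, V)_{-d}) q^d`. -/
noncomputable def qDimHom (D V : GMod A) : ℤ → ℕ :=
  fun d => Module.finrank k (D ⟶ V.shift (-d))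

end GMod

end Field

end GradedTriangular

open GradedTriangular

/-! Everything is governed by the functor V ↦ V_λ = e_λ{v ∈ V : e_μ A v = 0 for all μ ≱ λ}
(`weightPart`), right adjoint to j^λ_! (`stdHomEquiv`). It turns homomorphisms out of Δ(b) and Δ̄(b)
into A_λ-homomorphisms out of P_λ(b) and L_λ(b). It recovers a layer from its weight parts: (j^λ_*
N)_λ ≅ N, while (j^λ_* N)_μ = 0 for μ ≠ λ.

Two conditions on V are compared. V is acyclic at λ (`IsAcyclic`) if the functor stays exact on
every short exact sequence 0 → V → E → C → 0. V has weight lifts (`HasAllWeightLifts`) if the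
canonical map V^Γ → j^λ_* V_λ is onto for every finite lower set Γ and every λ minimal outside Γ.
The kernel of this map is V^{Γ∪{λ}}, so weight lifts identify V^Γ/V^{Γ∪{λ}} with j^λ_* V_λ; adding
weights one at a time then filters V/V^Γ by layers (`hasFlag_quot_upperSub`).

Acyclicity at all λ is equivalent to having weight lifts. With weight lifts, a preimage in E of an
element of C_λ is corrected by elements of V, one weight at a time, until e_μ A kills it for all μ <
λ (`isAcyclic_of_hasAllWeightLifts`). In the other direction an injective module has weight lifts,
because a homomorphism defined on a left ideal of A extends to A 1_i
(`hasWeightLifts_of_injective`), and acyclicity brings the lifts down from an injective module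
containing V (`hasAllWeightLifts_of_isAcyclic`).

The triangular basis enters through one fact: the ideal generated by the weights in a lower set is
spanned by the basis elements passing through these weights (`idealGen_eq_weightSpan`). Hence
membership in V_λ needs to be tested only against the finitely many weights below λ, the functor
j^λ_* is exact, and V ↦ V_λ preserves injectives.

For the Ext conditions, let V ⊆ E with E injective and C = E/V. Then Ext¹(j^λ_! M, V) = 0 means that
homomorphisms M → C_λ lift to E_λ. For M = P_λ(b) this forces E_λ → C_λ to be onto. For M = L_λ(b),
boundedness provides simple submodules of nonzero modules, and one finds that V_λ is injective and
E_λ → C_λ is onto (`injective_weightPart_of_extVanishes`). Once V is acyclic, C inherits acyclicity,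
and injectivity of the weight parts if V has it, so dimension shifting kills all higher Ext
(`subsingleton_ext_standardize`).

The condition behind all equivalences is therefore `IsGood`: acyclic at every λ, with V_λ injective
(for ∇) or arbitrary (for ∇̄). It is closed under extensions and holds for layers. It is also
visible on truncations, since A_λ and V_λ do not change under passage to A_Γ when λ ∈ Γ. -/

namespace GradedTriangular

/-! ### Pointwise exactness, degree shifts and enough injectives -/

section Basics

variable {k : Type u} [Field k] {I : Type u} {A : LUGAlgebra k I}

namespace GMod

section Pointwise

variable {M N P : GMod A}

lemma mono_of_injective (f : M ⟶ N) (hf : ∀ i d, Function.Injective (f.app i d)) : Mono f :=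
  ⟨fun g h e => by
    ext i d v
    exact hf i d (congrArg (fun φ : _ ⟶ N => φ.app i d v) e)⟩

lemma epi_of_surjective (f : M ⟶ N) (hf : ∀ i d, Function.Surjective (f.app i d)) : Epi f :=
  ⟨fun g h e => by
    ext i d v
    obtain ⟨w, rfl⟩ := hf i d v
    exact congrArg (fun φ : M ⟶ _ => φ.app i d w) e⟩

/-- The isomorphism with bijective components `f`. -/
noncomputable def isoOfBijective (f : M ⟶ N) (hf : ∀ i d, Function.Bijective (f.app i d)) :
    M ≅ N where
  hom := f
  inv := ⟨fun i d => (LinearEquiv.ofBijective (f.app i d) (hf i d)).symm,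
    fun {i j d e f'} h a v => by
    apply (hf i f').1
    have key : ∀ i d w, f.app i d ((LinearEquiv.ofBijective (f.app i d) (hf i d)).symm w) = w :=
      fun i d w => (LinearEquiv.ofBijective (f.app i d) (hf i d)).apply_symm_apply w
    simp only [LinearEquiv.coe_coe]
    rw [key, f.app_act, key]⟩
  hom_inv_id := by
    ext i d v
    exact (LinearEquiv.ofBijective (f.app i d) (hf i d)).symm_apply_apply v
  inv_hom_id := by
    ext i d v
    exact (LinearEquiv.ofBijective (f.app i d) (hf i d)).apply_symm_apply v

lemma iso_hom_bijective (e : M ≅ N) (i : I) (d : ℤ) : Function.Bijective (e.hom.app i d) :=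
  ⟨injective_of_mono e.hom i d, surjective_of_epi e.hom i d⟩

@[simp] lemma iso_inv_hom_apply (e : M ≅ N) (i : I) (d : ℤ) (v : N.pc i d) :
    e.hom.app i d (e.inv.app i d v) = v :=
  congrArg (fun φ : N ⟶ N => φ.app i d v) e.inv_hom_id

lemma comp_apply (f : M ⟶ N) (g : N ⟶ P) (i : I) (d : ℤ) (v : M.pc i d) :
    (f ≫ g).app i d v = g.app i d (f.app i d v) := rfl

lemma congr_app {f g : M ⟶ N} (h : f = g) (i : I) (d : ℤ) (v : M.pc i d) :
    f.app i d v = g.app i d v := by rw [h]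

lemma exists_apply_ne_zero {f : M ⟶ N} (hf : f ≠ 0) : ∃ i d v, f.app i d v ≠ 0 := by
  by_contra! h
  exact hf (by ext i d v; exact h i d v)

/-- A short exact sequence from pointwise data. -/
lemma shortExact_of_pointwise {S : ShortComplex (GMod A)}
    (hf : ∀ i d, Function.Injective (S.f.app i d)) (hg : ∀ i d, Function.Surjective (S.g.app i d))
    (hfg : ∀ i d v, S.g.app i d v = 0 → ∃ w, S.f.app i d w = v) : S.ShortExact := by
  have := mono_of_injective S.f hf
  have := epi_of_surjective S.g hg
  refine { exact := ?_ }
  refine S.exact_of_f_is_kernel (KernelFork.IsLimit.ofι _ _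
    (fun g h => (exists_lift_of_injective S.f hf g fun i d v => hfg i d _ ?_).choose)
    (fun g h => (exists_lift_of_injective S.f hf g fun i d v => hfg i d _ ?_).choose_spec)
    (fun g h m hm => ?_))
  · exact congr_app h i d v
  · exact congr_app h i d v
  · rw [← cancel_mono S.f, hm]
    exact (exists_lift_of_injective S.f hf g fun i d v =>
      hfg i d _ (congr_app h i d v)).choose_spec.symm

end Pointwise

section Recast

variable {M N : GMod A}

/-- Transport along an equality of degrees, expressed through the action of `1_i`. -/
def recast (M : GMod A) {i : I} {d e : ℤ} (h : d = e) : M.pc i d →ₗ[k] M.pc i e :=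
  M.act (by omega : 0 + d = e) (A.one i)

@[simp] lemma recast_rfl {i : I} {d : ℤ} (v : M.pc i d) : M.recast rfl v = v := M.one_act v

lemma app_recast (f : M ⟶ N) {i : I} {d e : ℤ} (h : d = e) (v : M.pc i d) :
    f.app i e (M.recast h v) = N.recast h (f.app i d v) := by subst h; simp

lemma act_recast {i j : I} {d e e' f : ℤ} (h : e = e') (h' : d + e' = f) (a : A.blk i j d)
    (v : M.pc j e) : M.act h' a (M.recast h v) = M.act (by omega) a v := by subst h; simp

lemma recast_act {i j : I} {d e f f' : ℤ} (h : f = f') (h' : d + e = f) (a : A.blk i j d)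
    (v : M.pc j e) : M.recast h (M.act h' a v) = M.act (h'.trans h) a v := by subst h; simp

lemma recast_recast {i : I} {d e f : ℤ} (h : d = e) (h' : e = f) (v : M.pc i d) :
    M.recast h' (M.recast h v) = M.recast (h.trans h') v := by subst h h'; simp

lemma recast_self {i : I} {d : ℤ} (h : d = d) (v : M.pc i d) : M.recast h v = v := M.recast_rfl v

lemma recast_bijective {i : I} {d e : ℤ} (h : d = e) :
    Function.Bijective (M.recast (i := i) h) := by
  subst h
  convert Function.bijective_id using 1
  ext v; simp

end Recast

section Shift

variable {M N : GMod A}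

/-- The shift of a homomorphism. -/
def shiftMap (f : M ⟶ N) (n : ℤ) : M.shift n ⟶ N.shift n :=
  ⟨fun i d => f.app i (d + n), fun _ a v => f.app_act _ a v⟩

/-- A homomorphism `q^n M ⟶ N` as a homomorphism `M ⟶ q^{-n} N`. -/
def shiftRight {n m : ℤ} (h : n + m = 0) (f : M.shift n ⟶ N) : M ⟶ N.shift m :=
  ⟨fun i d => (f.app i (d + m)).comp (M.recast (by omega)), fun {i j d e f'} h' a v => by
    have h1 := f.app_act (i := i) (j := j) (d := d) (e := e + m) (f := f' + m) (by omega) a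
      (M.recast (by omega) v)
    refine Eq.trans ?_ h1
    change f.app i (f' + m) _ = f.app i (f' + m) _
    congr 1
    change M.recast _ (M.act _ a v) = M.act _ a (M.recast _ v)
    rw [recast_act, act_recast]⟩

/-- A homomorphism `M ⟶ q^{-n} N` as a homomorphism `q^n M ⟶ N`. -/
def shiftLeft {n m : ℤ} (h : n + m = 0) (f : M ⟶ N.shift m) : M.shift n ⟶ N :=
  ⟨fun i d => (N.recast (by omega)).comp (f.app i (d + n)), fun {i j d e f'} h' a v => by
    have h1 := f.app_act (i := i) (j := j) (d := d) (e := e + n) (f := f' + n) (by omega) a v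
    refine (congrArg (N.recast _) h1).trans ?_
    exact (recast_act (M := N) _ _ _ _).trans (act_recast (M := N) _ _ _ _).symm⟩

lemma shiftLeft_app {n m : ℤ} (h : n + m = 0) (f : M ⟶ N.shift m) (i : I) (d : ℤ)
    (v : M.pc i (d + n)) :
    (shiftLeft h f).app i d v = N.recast (by omega) (f.app i (d + n) v) := rfl

/-- Shifting is invertible, so an extension problem into q^n M is moved to one into M, solved there
and moved back. -/
lemma injective_shift (hM : Injective M) (n : ℤ) : Injective (M.shift n) := by
  refine ⟨fun {X Y} g f hf => ?_⟩
  have := mono_of_injective (shiftMap f (-n)) fun i d => injective_of_mono f i _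
  refine ⟨shiftRight (n := -n) (by omega)
    (Injective.factorThru (shiftLeft (by omega) g) (shiftMap f (-n))), ?_⟩
  ext i d v
  change (Injective.factorThru (shiftLeft _ g) (shiftMap f (-n))).app i (d + n)
    (Y.recast _ (f.app i d v)) = _
  rw [← app_recast]
  have h1 := congr_app (Injective.comp_factorThru (shiftLeft (by omega) g) (shiftMap f (-n))) i
    (d + n) (X.recast (by omega) v)
  refine h1.trans ?_
  rw [shiftLeft_app, app_recast]
  exact (recast_recast (M := M) (d := d + n) (e := d + n + -n + n) (f := d + n) (by omega)
    (by omega) _).trans (recast_self (M := M) rfl _)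

end Shift

section Coind

/-- The module coinduced from a family of vector spaces. -/
def coind (A : LUGAlgebra k I) (U : I → ℤ → Type u) [∀ i d, AddCommGroup (U i d)]
    [∀ i d, Module k (U i d)] : GMod A where
  pc j d := ∀ p : {p : I × ℤ × ℤ // p.2.1 + d = p.2.2}, A.blk p.1.1 j p.1.2.1 →ₗ[k] U p.1.1 p.1.2.2
  act {j' j x d f} h := LinearMap.mk₂ k
    (fun (a : A.blk j' j x) φ p =>
      (φ ⟨(p.1.1, p.1.2.1 + x, p.1.2.2), by have := p.2; simp only; omega⟩).comp
        ((A.mul rfl).flip a))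
    (fun _ _ _ => by ext; simp) (fun _ _ _ => by ext; simp)
    (fun _ _ _ => by ext; simp) (fun _ _ _ => by ext; simp)
  one_act {i d} φ := by
    funext ⟨⟨t, c, e⟩, he⟩
    ext b
    have key : ∀ (c' : ℤ) (hc : c + 0 = c') (h' : c' + d = e),
        φ ⟨(t, c', e), h'⟩ (A.mul hc b (A.one i)) = φ ⟨(t, c, e), he⟩ b := by
      rintro c' hc h'
      obtain rfl : c' = c := by omega
      rw [A.mul_one]
    exact key _ rfl _
  mul_act {i j l d e f de ef x} h₁ h₂ h₃ h₄ a b φ := by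
    funext ⟨⟨t, c, y⟩, hy⟩
    ext b'
    have key : ∀ (c₁ c₂ : ℤ) (hc₁ : c + de = c₁) (hc₂ : c + d + e = c₂) (h : c₁ + f = y)
        (h' : c₂ + f = y),
        φ ⟨(t, c₁, y), h⟩ (A.mul hc₁ b' (A.mul h₁ a b)) =
          φ ⟨(t, c₂, y), h'⟩ (A.mul hc₂ (A.mul rfl b' a) b) := by
      rintro c₁ c₂ hc₁ hc₂ h h'
      obtain rfl : c₁ = c₂ := by omega
      rw [A.mul_assoc]
    exact key _ _ rfl rfl _ _

variable (U : I → ℤ → Type u) [∀ i d, AddCommGroup (U i d)] [∀ i d, Module k (U i d)]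

lemma coind_act_apply {j' j : I} {x d f : ℤ} (h : x + d = f) (a : A.blk j' j x)
    (φ : (coind A U).pc j d) (i : I) (c e : ℤ) (hp : c + f = e) (b : A.blk i j' c) (c' : ℤ)
    (hc : c + x = c') :
    (coind A U).act h a φ ⟨(i, c, e), hp⟩ b =
      φ ⟨(i, c', e), by simp only; omega⟩ (A.mul hc b a) := by
  subst hc; rfl

variable {U}

/-- The homomorphism to a coinduced module given by a family of linear maps. -/
def coindLift {M : GMod A} (f : ∀ i d, M.pc i d →ₗ[k] U i d) : M ⟶ coind A U :=
  ⟨fun j d => LinearMap.pi fun p => LinearMap.mk₂ k (fun v a => f p.1.1 p.1.2.2 (M.act p.2 a v))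
    (fun _ _ _ => by simp) (fun _ _ _ => by simp)
    (fun _ _ _ => by simp) (fun _ _ _ => by simp), fun {i j d e f'} h a v => by
    funext ⟨⟨t, c, y⟩, hy⟩
    ext b
    change f t y (M.act hy b (M.act h a v)) = f t y (M.act _ (A.mul rfl b a) v)
    rw [M.mul_act rfl h _ hy]⟩

/-- Coinduction is right adjoint to the exact forgetful functor to families of vector spaces, and
over a field every injection of such families has a linear retraction. -/
instance injective_coind : Injective (coind A U) := by
  refine ⟨fun {X Y} g f hf => ?_⟩
  have hinv : ∀ i d, ∃ r : Y.pc i d →ₗ[k] X.pc i d, r.comp (f.app i d) = LinearMap.id := fun i d =>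
    LinearMap.exists_leftInverse_of_injective _ (LinearMap.ker_eq_bot.2 (injective_of_mono f i d))
  choose r hr using hinv
  -- The counit of the adjunction: a functional is evaluated at 1_i.
  let ev : ∀ i d, (coind A U).pc i d →ₗ[k] U i d := fun i d =>
    (LinearMap.applyₗ (A.one i)).comp (LinearMap.proj
      (φ := fun p : {p : I × ℤ × ℤ // p.2.1 + d = p.2.2} =>
      A.blk p.1.1 i p.1.2.1 →ₗ[k] U p.1.1 p.1.2.2) ⟨(i, 0, d), zero_add d⟩)
  refine ⟨coindLift fun i d => (ev i d).comp ((g.app i d).comp (r i d)), ?_⟩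
  ext j d v
  funext ⟨⟨t, c, y⟩, hy⟩
  ext a
  change (ev t y) (g.app t y (r t y (Y.act _ a (f.app j d v)))) = _
  rw [← f.app_act, show r t y (f.app t y (X.act hy a v)) = X.act hy a v from
    LinearMap.congr_fun (hr t y) _, g.app_act]
  change (coind A U).act hy a (g.app j d v) ⟨(t, 0, y), _⟩ (A.one t) = _
  rw [coind_act_apply U hy a _ t 0 y _ (A.one t) c (zero_add c), A.one_mul]

/-- The unit v ↦ (a ↦ a v) is injective because evaluation at 1_i returns v. -/
instance : EnoughInjectives (GMod A) :=
  ⟨fun M => ⟨⟨coind A M.pc, inferInstance, coindLift fun _ _ => LinearMap.id,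
    mono_of_injective _ fun i d => by
      rw [injective_iff_map_eq_zero]
      intro v hv
      have := congrArg (fun φ : (coind A M.pc).pc i d => φ ⟨(i, 0, d), zero_add d⟩ (A.one i)) hv
      rw [← M.one_act v]
      exact this⟩⟩⟩

end Coind

section Free

/-- The module `A 1_i`. -/
def free (A : LUGAlgebra k I) (i : I) : GMod A where
  pc j d := A.blk j i d
  act h := A.mul h
  one_act a := A.one_mul a
  mul_act h₁ h₂ h₃ h₄ a b c := A.mul_assoc h₁ h₂ h₃ h₄ a b c

end Free

end GMod

/-! ### Graded submodules, simple modules and essential quotients -/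

namespace GSub

variable {M N : GMod A}

lemma eq_bot_iff' {U : GSub M} : U = ⊥ ↔ ∀ i d v, v ∈ U.carrier i d → v = 0 := by
  constructor
  · rintro rfl i d v hv
    exact hv
  · intro h
    ext i d v
    exact ⟨fun hv => h i d v hv, fun hv => by
      rw [show v = 0 from hv]; exact Submodule.zero_mem _⟩

lemma eq_top_iff' {U : GSub M} : U = ⊤ ↔ ∀ i d v, v ∈ U.carrier i d := by
  constructor
  · rintro rfl i d v
    trivial
  · intro h
    ext i d v
    exact ⟨fun _ => trivial, fun _ => h i d v⟩

/-- The cyclic submodule generated by a homogeneous element. -/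
def gen {i : I} {d : ℤ} (v : M.pc i d) : GSub M where
  carrier j e := LinearMap.range ((M.act (by omega : (e - d) + d = e)).flip v : A.blk j i _ →ₗ[k] _)
  act_mem {j l c e f} h a w hw := by
    obtain ⟨b, rfl⟩ := hw
    refine ⟨A.mul (by omega) a b, ?_⟩
    exact M.mul_act _ _ _ _ a b v

lemma mem_gen {i j : I} {d e : ℤ} {v : M.pc i d} {w : M.pc j e} :
    w ∈ (gen v).carrier j e ↔ ∃ (c : ℤ) (h : c + d = e) (a : A.blk j i c), M.act h a v = w := by
  constructor
  · rintro ⟨a, rfl⟩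
    exact ⟨_, _, a, rfl⟩
  · rintro ⟨c, h, a, rfl⟩
    obtain rfl : c = e - d := by omega
    exact ⟨a, rfl⟩

lemma self_mem_gen {i : I} {d : ℤ} (v : M.pc i d) : v ∈ (gen v).carrier i d :=
  mem_gen.2 ⟨0, zero_add d, A.one i, M.one_act v⟩

lemma gen_le {i : I} {d : ℤ} {v : M.pc i d} {U : GSub M} (h : v ∈ U.carrier i d) : gen v ≤ U := by
  intro j e w hw
  obtain ⟨c, hc, a, rfl⟩ := mem_gen.1 hw
  exact U.act_mem hc a h

/-- The inclusion between two submodules. -/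
def incl {U W : GSub M} (h : U ≤ W) : U.toGMod ⟶ W.toGMod :=
  ⟨fun i d => Submodule.inclusion (h i d), fun _ _ _ => rfl⟩

/-- The union of a directed nonempty family of submodules. -/
def sSupChain (c : Set (GSub M)) (hc : IsChain (· ≤ ·) c) (hne : c.Nonempty) : GSub M where
  carrier i d :=
    { carrier := {v | ∃ U ∈ c, v ∈ U.carrier i d}
      zero_mem' := ⟨hne.some, hne.some_mem, Submodule.zero_mem _⟩
      add_mem' := by
        rintro v w ⟨U, hU, hv⟩ ⟨U', hU', hw⟩
        rcases hc.total hU hU' with h | h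
        · exact ⟨U', hU', Submodule.add_mem _ (h i d hv) hw⟩
        · exact ⟨U, hU, Submodule.add_mem _ hv (h i d hw)⟩
      smul_mem' := by
        rintro r v ⟨U, hU, hv⟩
        exact ⟨U, hU, Submodule.smul_mem _ r hv⟩ }
  act_mem h a v hv := by
    obtain ⟨U, hU, hv⟩ := hv
    exact ⟨U, hU, U.act_mem h a hv⟩

lemma le_sSupChain {c : Set (GSub M)} {hc : IsChain (· ≤ ·) c} {hne : c.Nonempty} {U : GSub M}
    (h : U ∈ c) : U ≤ sSupChain c hc hne := fun _ _ _ hv => ⟨U, h, hv⟩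

/-- Zorn's lemma for submodules having a property that is stable under unions of chains. -/
lemma exists_maximal (P : GSub M → Prop) (h0 : P ⊥)
    (hP : ∀ (c : Set (GSub M)) (hc : IsChain (· ≤ ·) c) (hne : c.Nonempty), (∀ U ∈ c, P U) →
      P (sSupChain c hc hne)) : ∃ U, P U ∧ ∀ U', P U' → U ≤ U' → U' ≤ U := by
  obtain ⟨U, -, hU⟩ := zorn_le_nonempty₀ {U | P U} (fun c hcP hc U hU =>
    ⟨sSupChain c hc ⟨U, hU⟩, hP c hc ⟨U, hU⟩ hcP, fun z hz => le_sSupChain hz⟩) ⊥ h0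
  exact ⟨U, hU.1, fun U' h h' => hU.2 h h'⟩

lemma mkQ_surjective (U : GSub M) (i : I) (d : ℤ) : Function.Surjective (U.π.app i d) :=
  (U.carrier i d).mkQ_surjective

lemma π_eq_zero {U : GSub M} {i : I} {d : ℤ} {v : M.pc i d} :
    U.π.app i d v = 0 ↔ v ∈ U.carrier i d := Submodule.Quotient.mk_eq_zero _

lemma ι_injective (U : GSub M) (i : I) (d : ℤ) : Function.Injective (U.ι.app i d) :=
  Subtype.val_injective

end GSub

namespace GMod

variable {M N : GMod A}

lemma LocallyFiniteDimensional.of_injective (hN : N.LocallyFiniteDimensional) (f : M ⟶ N)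
    (hf : ∀ i d, Function.Injective (f.app i d)) : M.LocallyFiniteDimensional := fun i d =>
  have := hN i d
  Module.Finite.of_injective (f.app i d) (hf i d)

lemma LocallyFiniteDimensional.of_surjective (hM : M.LocallyFiniteDimensional) (f : M ⟶ N)
    (hf : ∀ i d, Function.Surjective (f.app i d)) : N.LocallyFiniteDimensional := fun i d =>
  have := hM i d
  Module.Finite.of_surjective (f.app i d) (hf i d)

lemma BoundedAbove.of_injective (hN : N.BoundedAbove) (f : M ⟶ N)
    (hf : ∀ i d, Function.Injective (f.app i d)) : M.BoundedAbove := fun i => by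
  obtain ⟨b, hb⟩ := hN i
  exact ⟨b, fun d hd => have := hb d hd; (hf i d).subsingleton⟩

lemma BoundedAbove.of_surjective (hM : M.BoundedAbove) (f : M ⟶ N)
    (hf : ∀ i d, Function.Surjective (f.app i d)) : N.BoundedAbove := fun i => by
  obtain ⟨b, hb⟩ := hM i
  exact ⟨b, fun d hd => have := hb d hd; (hf i d).subsingleton⟩

lemma isIso_of_bijective (f : M ⟶ N) (hf : ∀ i d, Function.Bijective (f.app i d)) : IsIso f :=
  (isoOfBijective f hf).isIso_hom

/-- A nonzero module without proper nonzero submodules is simple. -/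
lemma simple_of_gsub (h0 : ∃ i d, ∃ v : M.pc i d, v ≠ 0) (h : ∀ U : GSub M, U = ⊥ ∨ U = ⊤) :
    Simple M := by
  refine ⟨fun {Y} f hf => ⟨?_, fun hne => ?_⟩⟩
  · rintro h1 rfl
    obtain ⟨i, d, v, hv⟩ := h0
    obtain ⟨w, rfl⟩ := surjective_of_epi (0 : Y ⟶ M) i d v
    exact hv rfl
  · apply isIso_of_bijective
    intro i d
    refine ⟨injective_of_mono f i d, fun v => ?_⟩
    rcases h (GSub.range f) with h | h
    · obtain ⟨j, e, w, hw⟩ := exists_apply_ne_zero hne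
      exact (hw (GSub.eq_bot_iff'.1 h j e _ ⟨w, rfl⟩)).elim
    · exact GSub.eq_top_iff'.1 h i d v

/-- A simple module is generated by each of its nonzero elements. -/
lemma mem_gen_of_simple [Simple M] {i j : I} {d e : ℤ} {v : M.pc i d} (hv : v ≠ 0) (w : M.pc j e) :
    w ∈ (GSub.gen v).carrier j e := by
  have := mono_of_injective (GSub.gen v).ι (GSub.ι_injective _)
  have : IsIso (GSub.gen v).ι := isIso_of_mono_of_nonzero fun h => hv <| by
    exact congr_app h i d ⟨v, GSub.self_mem_gen v⟩
  obtain ⟨u, rfl⟩ := surjective_of_epi (GSub.gen v).ι j e w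
  exact u.2

lemma exists_ne_zero_of_simple (M : GMod A) [Simple M] : ∃ i d, ∃ v : M.pc i d, v ≠ 0 := by
  obtain ⟨i, d, v, hv⟩ := exists_apply_ne_zero (id_nonzero M)
  exact ⟨i, d, v, hv⟩

/-- A nonzero cyclic module has a simple quotient. -/
lemma exists_simple_quotient {i : I} {d : ℤ} {v : M.pc i d} (hv : v ≠ 0)
    (hgen : ∀ j e (w : M.pc j e), w ∈ (GSub.gen v).carrier j e) :
    ∃ U : GSub M, Simple U.quot := by
  -- U is maximal among the submodules avoiding the generator v. A submodule of M/U either contains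
  -- the image of v, hence is everything, or pulls back to a submodule avoiding v, hence is zero.
  obtain ⟨U, hU, hmax⟩ := GSub.exists_maximal (M := M) (fun U => v ∉ U.carrier i d) hv
    (fun c hc hne h ⟨U, hU, hv⟩ => h U hU hv)
  refine ⟨U, simple_of_gsub ⟨i, d, U.π.app i d v, fun h => hU (GSub.π_eq_zero.1 h)⟩ fun U' => ?_⟩
  by_cases h : v ∈ (GSub.comap U.π U').carrier i d
  · right
    rw [GSub.eq_top_iff']
    intro j e w
    obtain ⟨w, rfl⟩ := U.mkQ_surjective j e w
    exact GSub.gen_le h j e (hgen j e w)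
  · left
    rw [GSub.eq_bot_iff']
    intro j e w hw
    obtain ⟨w, rfl⟩ := U.mkQ_surjective j e w
    refine GSub.π_eq_zero.2 (hmax _ h ?_ j e hw)
    intro j e x hx
    change U.π.app j e x ∈ U'.carrier j e
    rw [GSub.π_eq_zero.2 hx]
    exact Submodule.zero_mem _

/-- Any submodule has a maximal complement; the quotient is an essential extension. -/
lemma exists_essential_quotient (f : N ⟶ M) (hf : ∀ i d, Function.Injective (f.app i d)) :
    ∃ G : GSub M, (∀ i d, Function.Injective ((f ≫ G.π).app i d)) ∧
      ∀ U : GSub G.quot, (∀ i d (v : N.pc i d), (f ≫ G.π).app i d v ∈ U.carrier i d → v = 0) →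
        U = ⊥ := by
  -- G is maximal among the submodules meeting the image of N in 0. A submodule of M/G that meets N
  -- in 0 pulls back to another such submodule containing G.
  obtain ⟨G, hG, hmax⟩ := GSub.exists_maximal (M := M)
    (fun U => ∀ i d (v : N.pc i d), f.app i d v ∈ U.carrier i d → v = 0)
    (fun _ _ v hv => hf _ _ (by rw [show f.app _ _ v = 0 from hv, map_zero]))
    (fun c hc hne h i d v ⟨U, hU, hv⟩ => h U hU i d v hv)
  refine ⟨G, fun i d => ?_, fun U hU => ?_⟩
  · rw [injective_iff_map_eq_zero]
    intro v hv
    exact hG i d v (GSub.π_eq_zero.1 hv)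
  · rw [GSub.eq_bot_iff']
    intro j e w hw
    obtain ⟨w, rfl⟩ := G.mkQ_surjective j e w
    refine GSub.π_eq_zero.2 (hmax (GSub.comap G.π U) hU ?_ j e hw)
    intro j e x hx
    change G.π.app j e x ∈ U.carrier j e
    rw [GSub.π_eq_zero.2 hx]
    exact Submodule.zero_mem _

end GMod

end Basics

/-! ### Ideals generated by idempotents, in terms of the triangular basis -/

section Triangular

variable {k : Type u} [Field k] {I : Type u} {A : LUGAlgebra k I}

namespace LUGAlgebra

lemma mul_mul (A : LUGAlgebra k I) {i j l m : I} {d e f de x : ℤ} (h₁ : d + e = de)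
    (h₃ : de + f = x) (a : A.blk i j d) (b : A.blk j l e) (c : A.blk l m f) :
    A.mul h₃ (A.mul h₁ a b) c = A.mul (by omega) a (A.mul rfl b c) :=
  A.mul_assoc _ _ _ _ a b c

lemma mul_mul' (A : LUGAlgebra k I) {i j l m : I} {d e f ef x : ℤ} (h₂ : e + f = ef)
    (h₄ : d + ef = x) (a : A.blk i j d) (b : A.blk j l e) (c : A.blk l m f) :
    A.mul h₄ a (A.mul h₂ b c) = A.mul (by omega) (A.mul rfl a b) c :=
  (A.mul_assoc _ _ _ _ a b c).symm

lemma idealGen_mono {S T : Set I} (h : S ⊆ T) (i j : I) (d : ℤ) :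
    (A.idealGen S).carrier i j d ≤ (A.idealGen T).carrier i j d := by
  refine Submodule.span_mono ?_
  rintro x ⟨t, ht, c, e, h', a, b, rfl⟩
  exact ⟨t, h ht, c, e, h', a, b, rfl⟩

lemma mul_mem_idealGen {S : Set I} {t : I} (ht : t ∈ S) {i j : I} {c e d : ℤ} (h : c + e = d)
    (a : A.blk i t c) (b : A.blk t j e) : A.mul h a b ∈ (A.idealGen S).carrier i j d :=
  Submodule.subset_span ⟨t, ht, c, e, h, a, b, rfl⟩

lemma mem_idealGen_left {S : Set I} {t : I} (ht : t ∈ S) {j : I} {d : ℤ} (a : A.blk t j d) :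
    a ∈ (A.idealGen S).carrier t j d := by
  simpa only [A.one_mul] using mul_mem_idealGen ht (zero_add d) (A.one t) a

lemma mem_idealGen_right {S : Set I} {t : I} (ht : t ∈ S) {i : I} {d : ℤ} (a : A.blk i t d) :
    a ∈ (A.idealGen S).carrier i t d := by
  simpa only [A.mul_one] using mul_mem_idealGen ht (add_zero d) a (A.one t)

lemma idealGen_le {S : Set I} {i j : I} {d : ℤ} {P : Submodule k (A.blk i j d)}
    (h : ∀ t ∈ S, ∀ (c e : ℤ) (h : c + e = d) (a : A.blk i t c) (b : A.blk t j e),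
      A.mul h a b ∈ P) :
    (A.idealGen S).carrier i j d ≤ P := by
  refine Submodule.span_le.2 ?_
  rintro x ⟨t, ht, c, e, h', a, b, rfl⟩
  exact h t ht c e h' a b

end LUGAlgebra

variable {Λ : Type v} {W : Weights I Λ}

lemma Weights.mem_specialOver {Γ : Set Λ} {s : W.S} (h : W.dot s ∈ Γ) : (s : I) ∈ W.specialOver Γ :=
  ⟨s.2, h⟩

lemma Weights.specialOver_mono {Γ Γ' : Set Λ} (h : Γ ⊆ Γ') : W.specialOver Γ ⊆ W.specialOver Γ' :=
  fun _ hi => ⟨hi.1, h hi.2⟩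

variable [PartialOrder Λ]

lemma Weights.mem_specialOver_Iio {s : W.S} {lam : Λ} (h : W.dot s < lam) :
    (s : I) ∈ W.specialOver (Set.Iio lam) := ⟨s.2, h⟩

namespace TriangularBasis

variable (T : TriangularBasis A W)

/-- The index set of the triangular basis of `1_i A_d 1_j`. -/
abbrev Idx (i j : I) (d : ℤ) : Type u :=
  Σ (s t : W.S) (c : {c : ℤ × ℤ × ℤ // c.1 + c.2.1 + c.2.2 = d}),
    T.X i s c.1.1 × T.H s t c.1.2.1 × T.Y t j c.1.2.2

/-- The triangular basis of `1_i A_d 1_j`. -/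
noncomputable def basis (i j : I) (d : ℤ) : Module.Basis (T.Idx i j d) k (A.blk i j d) :=
  Module.Basis.mk (T.basis_linearIndependent i j d) (T.basis_span i j d).ge

/-- The linear map with prescribed values on the products `x h y`. -/
noncomputable def lift {P : Type u} [AddCommGroup P] [Module k P] {i j : I} {d : ℤ}
    (F : ∀ (s t : W.S) (c₁ c₂ c₃ : ℤ), c₁ + c₂ + c₃ = d →
      A.blk i s c₁ → A.blk s t c₂ → A.blk t j c₃ → P) : A.blk i j d →ₗ[k] P :=
  (T.basis i j d).constr k fun p =>
    F p.1 p.2.1 p.2.2.1.1.1 p.2.2.1.1.2.1 p.2.2.1.1.2.2 p.2.2.1.2 p.2.2.2.1.1 p.2.2.2.2.1.1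
      p.2.2.2.2.2.1

lemma lift_apply {P : Type u} [AddCommGroup P] [Module k P] {i j : I} {d : ℤ}
    (F : ∀ (s t : W.S) (c₁ c₂ c₃ : ℤ), c₁ + c₂ + c₃ = d →
      A.blk i s c₁ → A.blk s t c₂ → A.blk t j c₃ → P) {s t : W.S} {c₁ c₂ c₃ c₁₂ : ℤ}
    (h₁ : c₁ + c₂ = c₁₂) (h₂ : c₁₂ + c₃ = d) {x : A.blk i s c₁} {h : A.blk s t c₂}
    {y : A.blk t j c₃} (hx : x ∈ T.X i s c₁) (hh : h ∈ T.H s t c₂) (hy : y ∈ T.Y t j c₃) :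
    T.lift F (A.mul h₂ (A.mul h₁ x h) y) = F s t c₁ c₂ c₃ (by omega) x h y := by
  subst h₁
  have := (T.basis i j d).constr_basis k (fun p : T.Idx i j d =>
    F p.1 p.2.1 p.2.2.1.1.1 p.2.2.1.1.2.1 p.2.2.1.1.2.2 p.2.2.1.2 p.2.2.2.1.1 p.2.2.2.2.1.1
      p.2.2.2.2.2.1) ⟨s, t, ⟨(c₁, c₂, c₃), h₂⟩, ⟨x, hx⟩, ⟨h, hh⟩, ⟨y, hy⟩⟩
  rw [basis, Module.Basis.mk_apply] at this
  exact this

lemma induction {i j : I} {d : ℤ} {P : Submodule k (A.blk i j d)}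
    (H : ∀ (s t : W.S) (c₁ c₂ c₃ c₁₂ : ℤ) (h₁ : c₁ + c₂ = c₁₂) (h₂ : c₁₂ + c₃ = d)
      (x : A.blk i s c₁) (h : A.blk s t c₂) (y : A.blk t j c₃), x ∈ T.X i s c₁ → h ∈ T.H s t c₂ →
      y ∈ T.Y t j c₃ → A.mul h₂ (A.mul h₁ x h) y ∈ P) (a : A.blk i j d) : a ∈ P := by
  have h : (⊤ : Submodule k (A.blk i j d)) ≤ P := by
    rw [← T.basis_span i j d]
    refine Submodule.span_le.2 ?_
    rintro _ ⟨p, rfl⟩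
    exact H _ _ _ _ _ _ _ _ _ _ _ p.2.2.2.1.2 p.2.2.2.2.1.2 p.2.2.2.2.2.2
  exact h trivial

/-- The form in which triangularity is used: a factor x between special indices either disappears or
makes the product pass through a strictly smaller weight. -/
lemma X_cases {s t : W.S} {d : ℤ} {x : A.blk s t d} (hx : x ∈ T.X s t d) :
    (s = t ∧ d = 0 ∧ HEq x (A.one s)) ∨ W.dot t < W.dot s := by
  by_cases e : s = t
  · subst e
    by_cases h : d = 0
    · subst h
      rw [T.X_self_zero] at hx
      exact Or.inl ⟨rfl, rfl, heq_of_eq hx⟩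
    · rw [T.X_self_ne_zero s d h] at hx
      exact hx.elim
  · exact Or.inr (T.X_triangular s t e d ⟨x, hx⟩)

lemma Y_cases {s t : W.S} {d : ℤ} {y : A.blk s t d} (hy : y ∈ T.Y s t d) :
    (s = t ∧ d = 0 ∧ HEq y (A.one t)) ∨ W.dot s < W.dot t := by
  by_cases e : s = t
  · subst e
    by_cases h : d = 0
    · subst h
      rw [T.Y_self_zero] at hy
      exact Or.inl ⟨rfl, rfl, heq_of_eq hy⟩
    · rw [T.Y_self_ne_zero s d h] at hy
      exact hy.elim
  · exact Or.inr (T.Y_triangular s t e d ⟨y, hy⟩)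

lemma dot_eq_of_mem_H {s t : W.S} {d : ℤ} {h : A.blk s t d} (hh : h ∈ T.H s t d) :
    W.dot s = W.dot t := by
  by_cases e : s = t
  · rw [e]
  · exact T.H_diagonal s t e d ⟨h, hh⟩

include T in
lemma wellFounded_lt : WellFounded ((· < ·) : Λ → Λ → Prop) := by
  rw [WellFounded.wellFounded_iff_has_min]
  rintro s ⟨a, ha⟩
  obtain ⟨m, hm⟩ := ((T.lower_finite a).subset (Set.inter_subset_right (s := s))).exists_minimal
    ⟨a, ha, le_rfl⟩
  exact ⟨m, hm.1.1, fun x hx hlt => (hm.not_lt ⟨hx, hlt.le.trans hm.1.2⟩ hlt).elim⟩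

/-- The span of the products `x h y` that factor through an idempotent of weight in `Γ`. -/
def weightSpan (Γ : Set Λ) (i j : I) (d : ℤ) : Submodule k (A.blk i j d) :=
  Submodule.span k {z | ∃ (s t : W.S) (c₁ c₂ c₃ c₁₂ : ℤ) (h₁ : c₁ + c₂ = c₁₂) (h₂ : c₁₂ + c₃ = d)
    (x : A.blk i s c₁) (h : A.blk s t c₂) (y : A.blk t j c₃), x ∈ T.X i s c₁ ∧ h ∈ T.H s t c₂ ∧
      y ∈ T.Y t j c₃ ∧ W.dot s ∈ Γ ∧ z = A.mul h₂ (A.mul h₁ x h) y}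

variable {T} in
lemma mem_weightSpan {Γ : Set Λ} {i j : I} {d : ℤ} {s t : W.S} {c₁ c₂ c₃ c₁₂ : ℤ}
    (h₁ : c₁ + c₂ = c₁₂) (h₂ : c₁₂ + c₃ = d) {x : A.blk i s c₁} {h : A.blk s t c₂}
    {y : A.blk t j c₃} (hx : x ∈ T.X i s c₁) (hh : h ∈ T.H s t c₂) (hy : y ∈ T.Y t j c₃)
    (hs : W.dot s ∈ Γ) : A.mul h₂ (A.mul h₁ x h) y ∈ T.weightSpan Γ i j d :=
  Submodule.subset_span ⟨s, t, c₁, c₂, c₃, c₁₂, h₁, h₂, x, h, y, hx, hh, hy, hs, rfl⟩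

lemma weightSpan_mono {Γ Γ' : Set Λ} (h : Γ ⊆ Γ') (i j : I) (d : ℤ) :
    T.weightSpan Γ i j d ≤ T.weightSpan Γ' i j d := by
  refine Submodule.span_mono ?_
  rintro z ⟨s, t, c₁, c₂, c₃, c₁₂, h₁, h₂, x, h', y, hx, hh, hy, hs, rfl⟩
  exact ⟨s, t, c₁, c₂, c₃, c₁₂, h₁, h₂, x, h', y, hx, hh, hy, h hs, rfl⟩

/-- Well-founded induction on the weight of u. Both factors are expanded in the basis; a term whose
inner factor y of a, or x' of b, is not an idempotent passes through a smaller weight. There remains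
x (g g') y', where g g' is expanded in turn. -/
lemma mul_mem_weightSpan_Iic (u : W.S) {i j : I} {c e d : ℤ} (h : c + e = d) (a : A.blk i u c)
    (b : A.blk u j e) : A.mul h a b ∈ T.weightSpan (Set.Iic (W.dot u)) i j d := by
  generalize hν : W.dot u = ν
  induction ν using T.wellFounded_lt.induction generalizing u i j c e d with
  | _ ν ih =>
  have IH : ∀ (u : W.S) (_ : W.dot u < ν) (i j : I) (c e d : ℤ) (h : c + e = d) (a : A.blk i u c)
      (b : A.blk u j e), A.mul h a b ∈ T.weightSpan (Set.Iic ν) i j d :=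
    fun u hu i j c e d h a b => T.weightSpan_mono (Set.Iic_subset_Iic.2 hu.le) _ _ _
      (ih _ hu u h a b rfl)
  clear ih
  subst hν
  refine T.induction (P := (T.weightSpan (Set.Iic (W.dot u)) i j d).comap ((A.mul h).flip b)) ?_ a
  intro s t c₁ c₂ c₃ c₁₂ h₁ h₂ x g y hx hg hy
  change A.mul h (A.mul h₂ (A.mul h₁ x g) y) b ∈ T.weightSpan (Set.Iic (W.dot u)) i j d
  rcases T.Y_cases hy with ⟨rfl, rfl, hy1⟩ | hlt
  swap
  · rw [A.mul_mul]
    exact IH _ hlt _ _ _ _ _ _ _ _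
  obtain rfl := eq_of_heq hy1
  obtain rfl : c₁₂ = c := by omega
  rw [A.mul_one]
  refine T.induction (P := (T.weightSpan (Set.Iic (W.dot t)) i j d).comap
    (A.mul h (A.mul h₁ x g))) ?_ b
  intro s' t' c₁' c₂' c₃' c₁₂' h₁' h₂' x' g' y' hx' hg' hy'
  change A.mul h _ (A.mul h₂' (A.mul h₁' x' g') y') ∈ T.weightSpan (Set.Iic (W.dot t)) i j d
  rcases T.X_cases hx' with ⟨rfl, rfl, hx1⟩ | hlt
  swap
  · rw [A.mul_mul h₁', A.mul_mul']
    exact IH _ hlt _ _ _ _ _ _ _ _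
  obtain rfl := eq_of_heq hx1
  obtain rfl : c₂' = c₁₂' := by omega
  rw [A.one_mul, A.mul_mul h₁, A.mul_mul' h₂']
  -- The product g g' need not lie in the span of the sets H. It does modulo smaller weights, which
  -- are covered by `IH` since s, t and the source of y' all have the same weight.
  refine T.induction (P := (T.weightSpan (Set.Iic (W.dot t)) i j d).comap
    ((A.mul (show c₁ + (c₂ + e) = d by omega) x).comp
      ((A.mul (show (c₂ + c₂') + c₃' = c₂ + e by omega)).flip y'))) ?_
      (A.mul rfl g g')
  intro s'' t'' c₁'' c₂'' c₃'' c₁₂'' h₁'' h₂'' x'' g'' y'' hx'' hg'' hy''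
  change A.mul _ x (A.mul _ (A.mul h₂'' (A.mul h₁'' x'' g'') y'') y') ∈
    T.weightSpan (Set.Iic (W.dot t)) i j d
  rcases T.X_cases hx'' with ⟨rfl, rfl, hx1⟩ | hlt
  swap
  · rw [A.mul_mul h₁'', A.mul_mul _ _ x'', A.mul_mul']
    exact IH _ (hlt.trans_eq (T.dot_eq_of_mem_H hg)) _ _ _ _ _ _ _ _
  obtain rfl := eq_of_heq hx1
  obtain rfl : c₂'' = c₁₂'' := by omega
  rw [A.one_mul]
  rcases T.Y_cases hy'' with ⟨rfl, rfl, hy1⟩ | hlt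
  swap
  · rw [A.mul_mul, A.mul_mul']
    exact IH _ (hlt.trans_eq (T.dot_eq_of_mem_H hg').symm) _ _ _ _ _ _ _ _
  obtain rfl := eq_of_heq hy1
  obtain rfl : c₂'' = c₂ + c₂' := by omega
  rw [A.mul_one, A.mul_mul']
  exact mem_weightSpan _ _ hx hg'' hy' (T.dot_eq_of_mem_H hg).le

/-- For a lower set `Γ`, the ideal generated by the idempotents of weight in `Γ` is spanned by the
basis elements that factor through them. -/
lemma idealGen_eq_weightSpan {Γ : Set Λ} (hΓ : IsLowerSet Γ) (i j : I) (d : ℤ) :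
    (A.idealGen (W.specialOver Γ)).carrier i j d = T.weightSpan Γ i j d := by
  apply le_antisymm
  · refine LUGAlgebra.idealGen_le fun t ht c e h a b => ?_
    exact T.weightSpan_mono (fun μ hμ => hΓ hμ ht.2) _ _ _
      (T.mul_mem_weightSpan_Iic ⟨t, ht.1⟩ h a b)
  · refine Submodule.span_le.2 ?_
    rintro z ⟨s, t, c₁, c₂, c₃, c₁₂, h₁, h₂, x, h', y, hx, hh, hy, hs, rfl⟩
    rw [A.mul_mul]
    exact LUGAlgebra.mul_mem_idealGen (Weights.mem_specialOver hs) _ _ _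

/-- `1_i A 1_t` is spanned by the `x h` modulo lower weights. -/
lemma induction_right {i : I} {t : W.S} {d : ℤ} {P : Submodule k (A.blk i t d)}
    (hP : (A.idealGen (W.specialOver (Set.Iio (W.dot t)))).carrier i t d ≤ P)
    (H : ∀ (s : W.S) (c₁ c₂ : ℤ) (h₁ : c₁ + c₂ = d) (x : A.blk i s c₁) (h : A.blk s t c₂),
      x ∈ T.X i s c₁ → h ∈ T.H s t c₂ → A.mul h₁ x h ∈ P) (a : A.blk i t d) : a ∈ P := by
  refine T.induction ?_ a
  intro s t' c₁ c₂ c₃ c₁₂ h₁ h₂ x h y hx hh hy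
  rcases T.Y_cases hy with ⟨rfl, rfl, hy1⟩ | hlt
  · obtain rfl := eq_of_heq hy1
    obtain rfl : c₁₂ = d := by omega
    rw [A.mul_one]
    exact H _ _ _ _ _ _ hx hh
  · exact hP (LUGAlgebra.mul_mem_idealGen (Weights.mem_specialOver_Iio hlt) _ _ _)

/-- `1_s A 1_j` is spanned by the `h y` modulo lower weights. -/
lemma induction_left {s : W.S} {j : I} {d : ℤ} {P : Submodule k (A.blk s j d)}
    (hP : (A.idealGen (W.specialOver (Set.Iio (W.dot s)))).carrier s j d ≤ P)
    (H : ∀ (t : W.S) (c₂ c₃ : ℤ) (h₂ : c₂ + c₃ = d) (h : A.blk s t c₂) (y : A.blk t j c₃),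
      h ∈ T.H s t c₂ → y ∈ T.Y t j c₃ → A.mul h₂ h y ∈ P) (a : A.blk s j d) : a ∈ P := by
  refine T.induction ?_ a
  intro s' t c₁ c₂ c₃ c₁₂ h₁ h₂ x h y hx hh hy
  rcases T.X_cases hx with ⟨rfl, rfl, hx1⟩ | hlt
  · obtain rfl := eq_of_heq hx1
    obtain rfl : c₂ = c₁₂ := by omega
    rw [A.one_mul]
    exact H _ _ _ _ _ _ hh hy
  · rw [A.mul_mul]
    exact hP (LUGAlgebra.mul_mem_idealGen (Weights.mem_specialOver_Iio hlt) _ _ _)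

/-- For weights `ṡ = ṫ`, `1_s A 1_t` is spanned by `H(s,t)` modulo lower weights. -/
lemma induction_mid {s t : W.S} (hst : W.dot s = W.dot t) {d : ℤ} {P : Submodule k (A.blk s t d)}
    (hP : (A.idealGen (W.specialOver (Set.Iio (W.dot s)))).carrier s t d ≤ P)
    (H : ∀ h ∈ T.H s t d, h ∈ P) (a : A.blk s t d) : a ∈ P := by
  refine T.induction_left hP ?_ a
  intro t' c₂ c₃ h₂ h y hh hy
  rcases T.Y_cases hy with ⟨rfl, rfl, hy1⟩ | hlt
  · obtain rfl := eq_of_heq hy1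
    obtain rfl : c₂ = d := by omega
    rw [A.mul_one]
    exact H _ hh
  · exact hP (LUGAlgebra.mul_mem_idealGen
      (Weights.mem_specialOver_Iio (hlt.trans_eq hst.symm)) _ _ _)

lemma isLowerSet_not_le (lam : Λ) : IsLowerSet {mu | ¬ lam ≤ mu} :=
  fun _ _ hab ha h => ha (h.trans hab)

lemma not_le_of_mem_specialOver_Iio {lam : Λ} :
    W.specialOver (Set.Iio lam) ⊆ W.specialOver {mu | ¬ lam ≤ mu} :=
  Weights.specialOver_mono fun _ h h' => lt_irrefl _ (h.trans_le h')

include T in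
-- A basis element of 1_i A 1_s ends in some y ∈ Y(t,s). Either t = s and the element passes through
-- the weight of s, which is excluded, or it passes through the strictly smaller weight of t. So the
-- possibly infinite set of weights ≱ λ may be replaced by the finite set of weights < λ.
lemma idealGen_right_le (i : I) (s : W.S) (d : ℤ) :
    (A.idealGen (W.specialOver {mu | ¬ W.dot s ≤ mu})).carrier i s d ≤
      (A.idealGen (W.specialOver (Set.Iio (W.dot s)))).carrier i s d := by
  rw [T.idealGen_eq_weightSpan (isLowerSet_not_le _)]
  refine Submodule.span_le.2 ?_
  rintro z ⟨s', t, c₁, c₂, c₃, c₁₂, h₁, h₂, x, h', y, hx, hh, hy, hs, rfl⟩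
  rcases T.Y_cases hy with ⟨rfl, rfl, hy1⟩ | hlt
  · exact (hs (T.dot_eq_of_mem_H hh).ge).elim
  · exact LUGAlgebra.mul_mem_idealGen (Weights.mem_specialOver_Iio hlt) _ _ _

include T in
lemma idealGen_left_le (s : W.S) (j : I) (d : ℤ) :
    (A.idealGen (W.specialOver {mu | ¬ W.dot s ≤ mu})).carrier s j d ≤
      (A.idealGen (W.specialOver (Set.Iio (W.dot s)))).carrier s j d := by
  rw [T.idealGen_eq_weightSpan (isLowerSet_not_le _)]
  refine Submodule.span_le.2 ?_
  rintro z ⟨s', t, c₁, c₂, c₃, c₁₂, h₁, h₂, x, h', y, hx, hh, hy, hs, rfl⟩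
  rcases T.X_cases hx with ⟨rfl, rfl, hx1⟩ | hlt
  · exact (hs le_rfl).elim
  · rw [A.mul_mul]
    exact LUGAlgebra.mul_mem_idealGen (Weights.mem_specialOver_Iio hlt) _ _ _

end TriangularBasis

end Triangular

/-! ### Standardization, its right adjoint, and costandardization -/

section Functors

variable {k : Type u} [Field k] {I : Type u} {A : LUGAlgebra k I}

namespace GMod

section Deflate

variable {J : A.GIdeal}

/-- An `A`-module killed by `J` as an `A / J`-module. -/
def deflate (J : A.GIdeal) (M : GMod A)
    (hM : ∀ {i j d e f} (h : d + e = f), ∀ a ∈ J.carrier i j d, M.act (e := e) h a = 0) :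
    GMod (A.quot J) where
  pc i d := M.pc i d
  act {i j d e f} h := (J.carrier i j d).liftQ (M.act h) fun a ha => hM h a ha
  one_act v := M.one_act v
  mul_act {i j l d e f de ef x} h₁ h₂ h₃ h₄ a b v := by
    obtain ⟨a, rfl⟩ := (J.carrier _ _ _).mkQ_surjective a
    obtain ⟨b, rfl⟩ := (J.carrier _ _ _).mkQ_surjective b
    exact M.mul_act h₁ h₂ h₃ h₄ a b v

lemma inflate_act_eq_zero (M : GMod (A.quot J)) {i j : I} {d e f : ℤ} (h : d + e = f)
    {a : A.blk i j d} (ha : a ∈ J.carrier i j d) (v : (inflate M).pc j e) :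
    (inflate M).act h a v = 0 := by
  have h0 : Submodule.mkQ (J.carrier i j d) a = 0 := (Submodule.Quotient.mk_eq_zero _).2 ha
  change M.act h (Submodule.mkQ (J.carrier i j d) a) v = 0
  rw [h0]
  exact LinearMap.map_zero₂ (M.act h) v

end Deflate

section Shriek

variable (T : Set I) (M : GMod (A.trunc T)) (N : GMod A)

/-- The class of `a ⊗ v` in `A e ⊗_{eAe} M`. -/
noncomputable def tmul {i : I} {d c e : ℤ} (t : T) (h : c + e = d) :
    A.blk i t c →ₗ[k] M.pc t e →ₗ[k] (jShriek T M).pc i d :=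
  (jTmul T M t h).compr₂ (jRel T M i d).mkQ

lemma act_tmul {i j : I} {d e f c x y : ℤ} (h : d + e = f) (t : T) (hc : c + x = e)
    (a : A.blk i j d) (b : A.blk j t c) (v : M.pc t x) (hy : d + c = y) :
    (jShriek T M).act h a (tmul T M t hc b v) = tmul T M t (by omega) (A.mul hy a b) v := by
  subst hy
  exact congrArg (jRel T M i f).mkQ (jRawAct_tmul T M h t hc a b v (by omega))

lemma tmul_mul {i : I} {d x c y e f : ℤ} (s t : T) (hy : x + c = y) (hf : c + e = f)
    (h : y + e = d) (h' : x + f = d) (a : A.blk i s x) (b : A.blk s t c) (v : M.pc t e) :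
    tmul T M t h (A.mul hy a b) v = tmul T M s h' a (M.act (A := A.trunc T) hf b v) :=
  (Submodule.Quotient.eq _).2 (Submodule.subset_span
    ⟨s, t, x, c, y, e, f, hy, hf, h, h', a, b, v, rfl⟩)

lemma act_tmul_one {i : I} {c d e : ℤ} (h : c + d = e) (t : T) (a : A.blk i t c) (v : M.pc t d) :
    (jShriek T M).act h a (tmul T M t (zero_add d) (A.one t) v) = tmul T M t h a v := by
  rw [act_tmul T M h t (zero_add d) a (A.one t) v (add_zero c), A.mul_one]

lemma tmul_one_act {c d e : ℤ} (h : c + d = e) (s t : T) (a : A.blk s t c) (v : M.pc t d) :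
    tmul T M s (zero_add e) (A.one s) (M.act (A := A.trunc T) h a v) = tmul T M t h a v := by
  rw [← tmul_mul T M s t (zero_add c) h h (zero_add e), A.one_mul]

variable {T M N}

open Classical in
/-- The homomorphism `A e ⊗_{eAe} M ⟶ N` adjoint to `M ⟶ e N`. -/
noncomputable def shriekDesc (f : M ⟶ jTrunc T N) : jShriek T M ⟶ N where
  app i d := (jRel T M i d).liftQ
    (DirectSum.toModule k (jIndex T d) (N.pc i d) fun p =>
      TensorProduct.lift ((N.act p.2).compl₂ (f.app p.1.1 p.1.2.2))) (by
    refine Submodule.span_le.2 ?_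
    rintro _ ⟨s, t, x, c, y, e, g, hy, hf, h, h', a, b, v, rfl⟩
    change DirectSum.toModule _ _ _ _ (_ - _) = 0
    have := f.app_act (A := A.trunc T) hf b v
    simp only [jTmul, LinearMap.compr₂_apply, TensorProduct.mk_apply, map_sub,
      DirectSum.toModule_lof, TensorProduct.lift.tmul]
    exact sub_eq_zero.2 ((N.mul_act hy hf h h' a b _).trans (congrArg (N.act h' a) this.symm)))
  app_act {i j d e f'} h a v := by
    obtain ⟨v, rfl⟩ := (jRel T M _ _).mkQ_surjective v
    change DirectSum.toModule _ _ _ _ (jRawAct T M h a v) = N.act h a (DirectSum.toModule _ _ _ _ v)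
    refine congrFun (congrArg DFunLike.coe (jRaw_ext T M
      (f := (DirectSum.toModule k (jIndex T f') (N.pc i f') fun p =>
        TensorProduct.lift ((N.act p.2).compl₂ (f.app p.1.1 p.1.2.2))).comp (jRawAct T M h a))
      (g := (N.act h a).comp (DirectSum.toModule k (jIndex T e) (N.pc j e) fun p =>
        TensorProduct.lift ((N.act p.2).compl₂ (f.app p.1.1 p.1.2.2)))) ?_)) v
    intro t c x hc b w
    rw [LinearMap.comp_apply, LinearMap.comp_apply, jRawAct_tmul T M h t hc a b w (by omega)]
    simp only [jTmul, LinearMap.compr₂_apply, TensorProduct.mk_apply,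
      DirectSum.toModule_lof, TensorProduct.lift.tmul]
    exact N.mul_act rfl hc _ h a b _

open Classical in
lemma shriekDesc_tmul (f : M ⟶ jTrunc T N) {i : I} {d c e : ℤ} (t : T) (h : c + e = d)
    (a : A.blk i t c) (v : M.pc t e) :
    (shriekDesc f).app i d (tmul T M t h a v) = N.act h a (f.app t e v) := by
  change DirectSum.toModule k (jIndex T d) (N.pc i d) (fun p => TensorProduct.lift
    ((N.act p.2).compl₂ (f.app p.1.1 p.1.2.2))) (jTmul T M t h a v) = _
  simp only [jTmul, LinearMap.compr₂_apply, TensorProduct.mk_apply,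
      DirectSum.toModule_lof, TensorProduct.lift.tmul]
  rfl

end Shriek

variable {Λ : Type v} (W : Weights I Λ)

lemma act_eq_zero_of_mem_upperSub {Γ : Set Λ} {M : GMod A} {i j : I} {d e f : ℤ} (h : d + e = f)
    {a : A.blk i j d} {v : M.pc j e} (ha : a ∈ (A.idealGen (W.specialOver Γ)).carrier i j d)
    (hv : v ∈ (upperSub W Γ M).carrier j e) : M.act h a v = 0 := by
  have : (A.idealGen (W.specialOver Γ)).carrier i j d ≤ LinearMap.ker ((M.act h).flip v) := by
    refine LUGAlgebra.idealGen_le fun t ht c x h' a b => ?_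
    change M.act h (A.mul h' a b) v = 0
    rw [M.mul_act h' rfl h (by omega), hv t ht x _ rfl b, map_zero]
  exact this ha

variable {W} in
lemma upperSub_anti {Γ Γ' : Set Λ} (h : Γ ⊆ Γ') (M : GMod A) :
    upperSub W Γ' M ≤ upperSub W Γ M :=
  fun _ _ _ hv s hs => hv s (Weights.specialOver_mono h hs)

variable {W} in
lemma app_mem_upperSub {Γ : Set Λ} {M N : GMod A} (f : M ⟶ N) {i : I} {d : ℤ} {v : M.pc i d}
    (hv : v ∈ (upperSub W Γ M).carrier i d) : f.app i d v ∈ (upperSub W Γ N).carrier i d :=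
  fun s hs c e h a => by rw [← f.app_act, hv s hs c e h a, map_zero]

variable {W} in
lemma mem_upperSub_of_app {Γ : Set Λ} {M N : GMod A} (f : M ⟶ N)
    (hf : ∀ i d, Function.Injective (f.app i d)) {i : I} {d : ℤ} {v : M.pc i d}
    (hv : f.app i d v ∈ (upperSub W Γ N).carrier i d) : v ∈ (upperSub W Γ M).carrier i d :=
  fun s hs c e h a => hf s e (by rw [f.app_act, hv s hs c e h a, map_zero])

variable {W} in
lemma eq_zero_of_mem_upperSub {Γ : Set Λ} {M : GMod A} {i : I} {d : ℤ} {v : M.pc i d}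
    (hi : i ∈ W.specialOver Γ) (hv : v ∈ (upperSub W Γ M).carrier i d) : v = 0 := by
  rw [← M.one_act v]
  exact hv i hi 0 d _ _

variable [PartialOrder Λ]

/-- The image in `A_λ` of an element of `1_s A 1_t`. -/
def cartanMk (lam : Λ) {s t : W.specialOver {lam}} {d : ℤ} :
    A.blk s t d →ₗ[k] (A.cartan W lam).blk s t d :=
  ((A.idealGen (W.specialOver {mu | ¬ lam ≤ mu})).carrier s t d).mkQ

lemma cartanMk_surjective (lam : Λ) {s t : W.specialOver {lam}} {d : ℤ} :
    Function.Surjective (cartanMk (A := A) W lam (s := s) (t := t) (d := d)) :=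
  Submodule.mkQ_surjective _

/-- The functor right adjoint to standardization: `e_λ {v ∈ M | e_μ A v = 0 for μ ≱ λ}`. -/
def weightPart (lam : Λ) (M : GMod A) : GMod (A.cartan W lam) :=
  jTrunc (A := A.upper W lam) (W.specialOver {lam})
    (deflate _ (upperSub W {mu | ¬ lam ≤ mu} M).toGMod fun h a ha => by
      refine LinearMap.ext fun v => ?_
      exact Subtype.ext (act_eq_zero_of_mem_upperSub (M := M) W h ha v.2))

variable {W} in
/-- The inclusion `e_λ M^{≥λ} ⊆ M`. -/
def weightVal {lam : Λ} {M : GMod A} {s : W.specialOver {lam}} {d : ℤ} :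
    (weightPart W lam M).pc s d →ₗ[k] M.pc s d :=
  ((upperSub W {mu | ¬ lam ≤ mu} M).carrier s d).subtype

variable {W}

lemma weightVal_injective {lam : Λ} {M : GMod A} {s : W.specialOver {lam}} {d : ℤ} :
    Function.Injective (weightVal (lam := lam) (M := M) (s := s) (d := d)) :=
  Subtype.val_injective

lemma weightVal_mem {lam : Λ} {M : GMod A} {s : W.specialOver {lam}} {d : ℤ}
    (v : (weightPart W lam M).pc s d) :
    weightVal v ∈ (upperSub W {mu | ¬ lam ≤ mu} M).carrier s d := v.2

lemma exists_weightVal {lam : Λ} {M : GMod A} {s : W.specialOver {lam}} {d : ℤ} {v : M.pc s d}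
    (hv : v ∈ (upperSub W {mu | ¬ lam ≤ mu} M).carrier s d) :
    ∃ w : (weightPart W lam M).pc s d, weightVal w = v := ⟨⟨v, hv⟩, rfl⟩

lemma weightVal_act {lam : Λ} {M : GMod A} {s t : W.specialOver {lam}} {c d e : ℤ} (h : c + d = e)
    (a : A.blk s t c) (v : (weightPart W lam M).pc t d) :
    weightVal ((weightPart W lam M).act h (cartanMk W lam a) v) = M.act h a (weightVal v) := rfl

variable (W) in
/-- Functoriality of `weightPart`. -/
def weightMap (lam : Λ) {M N : GMod A} (f : M ⟶ N) : weightPart W lam M ⟶ weightPart W lam N where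
  app s d := (f.app s d).restrict fun _ hv => app_mem_upperSub f hv
  app_act {s t c d e} h a v := by
    obtain ⟨a, rfl⟩ := cartanMk_surjective W lam a
    exact Subtype.ext (f.app_act h a v.1)

lemma weightVal_map {lam : Λ} {M N : GMod A} (f : M ⟶ N) {s : W.specialOver {lam}} {d : ℤ}
    (v : (weightPart W lam M).pc s d) :
    weightVal ((weightMap W lam f).app s d v) = f.app s d (weightVal v) := rfl

lemma weightMap_injective {lam : Λ} {M N : GMod A} (f : M ⟶ N)
    (hf : ∀ i d, Function.Injective (f.app i d)) (s d) :
    Function.Injective ((weightMap W lam f).app s d) := fun _ _ h =>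
  weightVal_injective (hf _ _ (congrArg weightVal h))

lemma weightMap_comp {lam : Λ} {M N P : GMod A} (f : M ⟶ N) (g : N ⟶ P) :
    weightMap W lam (f ≫ g) = weightMap W lam f ≫ weightMap W lam g := rfl

lemma weightMap_id {lam : Λ} {M : GMod A} : weightMap W lam (𝟙 M) = 𝟙 _ := rfl

/-- Left exactness: the preimage of an element of the weight part is again killed by e_μ A for μ ≱ λ
because f is injective. -/
lemma weightMap_exact {lam : Λ} {M N P : GMod A} (f : M ⟶ N) (g : N ⟶ P)
    (hf : ∀ i d, Function.Injective (f.app i d))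
    (h : ∀ i d v, g.app i d v = 0 → ∃ w, f.app i d w = v)
    {s : W.specialOver {lam}} {d : ℤ} {v : (weightPart W lam N).pc s d}
    (hv : (weightMap W lam g).app s d v = 0) : ∃ w, (weightMap W lam f).app s d w = v := by
  obtain ⟨w, hw⟩ := h s d (weightVal v) (congrArg weightVal hv)
  obtain ⟨w, rfl⟩ := exists_weightVal (lam := lam)
    (mem_upperSub_of_app f hf (by rw [hw]; exact weightVal_mem v))
  exact ⟨w, weightVal_injective hw⟩

/-- `weightPart` maps isomorphisms to isomorphisms. -/
def weightIso (lam : Λ) {M N : GMod A} (e : M ≅ N) : weightPart W lam M ≅ weightPart W lam N where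
  hom := weightMap W lam e.hom
  inv := weightMap W lam e.inv
  hom_inv_id := by rw [← weightMap_comp, e.hom_inv_id, weightMap_id]
  inv_hom_id := by rw [← weightMap_comp, e.inv_hom_id, weightMap_id]

omit [PartialOrder Λ] in
lemma mem_upperSub_shift {Γ : Set Λ} {M : GMod A} {n : ℤ} {i : I} {d : ℤ} {v : M.pc i (d + n)} :
    v ∈ (upperSub W Γ (M.shift n)).carrier i d ↔ v ∈ (upperSub W Γ M).carrier i (d + n) := by
  constructor
  · intro hv s hs c e h a
    obtain ⟨e', rfl⟩ : ∃ e', e = e' + n := ⟨e - n, by omega⟩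
    exact hv s hs c e' (by omega) a
  · intro hv s hs c e h a
    exact hv s hs c (e + n) (by omega) a

/-- The identification of `weightPart` of a shift with the shift of `weightPart`. -/
def weightShiftHom (lam : Λ) (M : GMod A) (n : ℤ) :
    weightPart W lam (M.shift n) ⟶ (weightPart W lam M).shift n :=
  ⟨fun s d =>
    { toFun := fun v => ⟨v.1, mem_upperSub_shift.1 v.2⟩
      map_add' := fun _ _ => rfl
      map_smul' := fun _ _ => rfl }, fun {s t c d e} h a v => by
    obtain ⟨a, rfl⟩ := cartanMk_surjective W lam a
    rfl⟩

lemma weightShiftHom_bijective (lam : Λ) (M : GMod A) (n : ℤ) (s : W.specialOver {lam}) (d : ℤ) :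
    Function.Bijective ((weightShiftHom lam M n).app s d) := by
  refine ⟨fun v w h => weightVal_injective
    (congrArg (fun z : (weightPart W lam M).pc s (d + n) => weightVal z) h), fun v => ?_⟩
  exact ⟨⟨v.1, mem_upperSub_shift.2 v.2⟩, rfl⟩

section Standardize

variable {lam : Λ} {M : GMod (A.cartan W lam)} {V V' : GMod A}

/-- The unit `v ↦ 1 ⊗ v` of the adjunction. -/
noncomputable def stdUnit {s : W.specialOver {lam}} {d : ℤ} :
    M.pc s d →ₗ[k] (standardize W lam M).pc s d :=
  tmul (A := A.upper W lam) (W.specialOver {lam}) M s (zero_add d) ((A.upper W lam).one s)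

lemma stdUnit_act {s t : W.specialOver {lam}} {c d e : ℤ} (h : c + d = e) (a : A.blk s t c)
    (v : M.pc t d) :
    stdUnit (M.act h (cartanMk W lam a) v) = (standardize W lam M).act h a (stdUnit v) := by
  exact (tmul_one_act (A := A.upper W lam) (W.specialOver {lam}) M h s t (cartanMk W lam a) v).trans
    (act_tmul_one (A := A.upper W lam) (W.specialOver {lam}) M h t (cartanMk W lam a) v).symm

lemma stdUnit_mem {s : W.specialOver {lam}} {d : ℤ} (v : M.pc s d) :
    (stdUnit v : (standardize W lam M).pc s d) ∈
      (upperSub W {mu | ¬ lam ≤ mu} (standardize W lam M)).carrier s d := by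
  intro t ht c e h a
  exact inflate_act_eq_zero _ h (LUGAlgebra.mem_idealGen_left ht a) _

lemma standardize_hom_ext {f g : standardize W lam M ⟶ V}
    (h : ∀ s d (v : M.pc s d), f.app s d (stdUnit v) = g.app s d (stdUnit v)) : f = g := by
  refine Hom.ext (funext fun i => funext fun d => ?_)
  refine Submodule.linearMap_qext _ (jRaw_ext _ M fun t c e hc a v => ?_)
  obtain ⟨a, rfl⟩ := Submodule.mkQ_surjective _ a
  have key : tmul (A := A.upper W lam) (W.specialOver {lam}) M t hc (Submodule.mkQ _ a) v =
      (standardize W lam M).act hc a (stdUnit v) :=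
    (act_tmul_one (A := A.upper W lam) (W.specialOver {lam}) M hc t (Submodule.mkQ _ a) v).symm
  refine (congrArg (f.app i d) key).trans (Eq.trans ?_ (congrArg (g.app i d) key).symm)
  rw [f.app_act, g.app_act, h]

/-- The homomorphism of `A`-modules adjoint to a homomorphism `M ⟶ e_λ V^{≥λ}`. -/
noncomputable def standardizeDesc (f : M ⟶ weightPart W lam V) : standardize W lam M ⟶ V where
  app i d := ((upperSub W {mu | ¬ lam ≤ mu} V).carrier i d).subtype.comp
    ((shriekDesc (A := A.upper W lam) f).app i d)
  app_act h a v := congrArg Subtype.val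
    ((shriekDesc (A := A.upper W lam) f).app_act h (Submodule.mkQ _ a) v)

lemma standardizeDesc_unit (f : M ⟶ weightPart W lam V) {s : W.specialOver {lam}} {d : ℤ}
    (v : M.pc s d) : (standardizeDesc f).app s d (stdUnit v) = weightVal (f.app s d v) := by
  refine (congrArg Subtype.val (shriekDesc_tmul (A := A.upper W lam) f s (zero_add d)
    ((A.upper W lam).one s) v)).trans ?_
  exact V.one_act _

/-- `Hom_A(j^λ_! M, V) ≃ Hom_{A_λ}(M, e_λ V^{≥λ})`. -/
noncomputable def stdHomEquiv : (standardize W lam M ⟶ V) ≃ₗ[k] (M ⟶ weightPart W lam V) where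
  toFun g := ⟨fun s d => ((g.app s d).comp stdUnit).codRestrict _
      fun v => app_mem_upperSub g (stdUnit_mem v), fun {s t c d e} h a v => by
    obtain ⟨a, rfl⟩ := cartanMk_surjective W lam a
    apply Subtype.ext
    change g.app s e (stdUnit (M.act h (cartanMk W lam a) v)) = V.act h a (g.app t d (stdUnit v))
    rw [stdUnit_act, g.app_act]⟩
  map_add' _ _ := rfl
  map_smul' _ _ := rfl
  invFun f := standardizeDesc f
  left_inv g := standardize_hom_ext fun s d v => standardizeDesc_unit _ v
  right_inv f := by
    ext s d v
    exact Subtype.ext (standardizeDesc_unit f v)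

lemma stdHomEquiv_comp (g : standardize W lam M ⟶ V) (f : V ⟶ V') :
    stdHomEquiv (g ≫ f) = stdHomEquiv g ≫ weightMap W lam f := rfl

end Standardize

section Costandardize

variable {lam : Λ} {N : GMod (A.cartan W lam)}

/-- The element of `j^λ_* N` given by a family of maps. -/
def costdMk {i : I} {d : ℤ}
    (ψ : ∀ p : jStarIndex (W.specialOver {lam}) d, A.blk p.1.1 i p.1.2.1 →ₗ[k] N.pc p.1.1 p.1.2.2)
    (h0 : ∀ p : jStarIndex (W.specialOver {lam}) d,
      ∀ a ∈ (A.idealGen (W.specialOver {mu | ¬ lam ≤ mu})).carrier p.1.1 i p.1.2.1,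
      ψ p a = 0)
    (h1 : ∀ (s t : W.specialOver {lam}) (x c y e f : ℤ) (hx : x + c = y) (he : c + d = e)
      (hf : y + d = f) (hxe : x + e = f) (b : A.blk s t x) (a : A.blk t i c),
      ψ ⟨(s, y, f), hf⟩ (A.mul hx b a) = N.act hxe (cartanMk W lam b) (ψ ⟨(t, c, e), he⟩ a)) :
    (costandardize W lam N).pc i d :=
  ⟨fun p => Submodule.liftQ _ (ψ p) (h0 p), fun s t x c y e f hx he hf hxe b a => by
    obtain ⟨b, rfl⟩ := Submodule.mkQ_surjective _ b
    obtain ⟨a, rfl⟩ := Submodule.mkQ_surjective _ a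
    exact h1 s t x c y e f hx he hf hxe b a⟩

/-- The value of an element of `j^λ_* N` at an element of `1_s A 1_i`. -/
def costdEval {i : I} {d : ℤ} (φ : (costandardize W lam N).pc i d) (s : W.specialOver {lam})
    {c e : ℤ} (h : c + d = e) : A.blk s i c →ₗ[k] N.pc s e :=
  (φ.1 ⟨(s, c, e), h⟩).comp (Submodule.mkQ _)

lemma costdEval_mk {i : I} {d : ℤ}
    (ψ : ∀ p : jStarIndex (W.specialOver {lam}) d, A.blk p.1.1 i p.1.2.1 →ₗ[k] N.pc p.1.1 p.1.2.2)
    (h0 h1) (s : W.specialOver {lam}) {c e : ℤ} (h : c + d = e) (a : A.blk s i c) :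
    costdEval (costdMk ψ h0 h1) s h a = ψ ⟨(s, c, e), h⟩ a := rfl

lemma costd_ext {i : I} {d : ℤ} {φ φ' : (costandardize W lam N).pc i d}
    (H : ∀ (s : W.specialOver {lam}) (c e : ℤ) (h : c + d = e) (a : A.blk s i c),
      costdEval φ s h a = costdEval φ' s h a) : φ = φ' := by
  apply Subtype.ext
  funext ⟨⟨s, c, e⟩, h⟩
  refine LinearMap.ext fun a => ?_
  obtain ⟨a, rfl⟩ := Submodule.mkQ_surjective _ a
  exact H s c e h a

lemma costdEval_eq_zero {i : I} {d : ℤ} (φ : (costandardize W lam N).pc i d)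
    (s : W.specialOver {lam}) {c e : ℤ} (h : c + d = e) {a : A.blk s i c}
    (ha : a ∈ (A.idealGen (W.specialOver {mu | ¬ lam ≤ mu})).carrier s i c) :
    costdEval φ s h a = 0 := by
  have h0 : Submodule.mkQ ((A.idealGen (W.specialOver {mu | ¬ lam ≤ mu})).carrier s i c) a = 0 :=
    (Submodule.Quotient.mk_eq_zero _).2 ha
  exact (congrArg (φ.1 ⟨(s, c, e), h⟩) h0).trans (LinearMap.map_zero _)

lemma costdEval_mul {i : I} {d : ℤ} (φ : (costandardize W lam N).pc i d)
    (s t : W.specialOver {lam}) {x c y e f : ℤ} (hx : x + c = y) (he : c + d = e) (hf : y + d = f)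
    (hxe : x + e = f) (b : A.blk s t x) (a : A.blk t i c) :
    costdEval φ s hf (A.mul hx b a) = N.act hxe (cartanMk W lam b) (costdEval φ t he a) :=
  φ.2 s t x c y e f hx he hf hxe (cartanMk W lam b) (Submodule.mkQ _ a)

lemma costdEval_act {i j : I} {x d f : ℤ} (h : x + d = f) (a : A.blk j i x)
    (φ : (costandardize W lam N).pc i d) (s : W.specialOver {lam}) {c c' e : ℤ} (h' : c + f = e)
    (hc : c + x = c') (h'' : c' + d = e) (b : A.blk s j c) :
    costdEval ((costandardize W lam N).act h a φ) s h' b = costdEval φ s h'' (A.mul hc b a) := by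
  subst hc; rfl

lemma costdEval_add {i : I} {d : ℤ} (φ φ' : (costandardize W lam N).pc i d)
    (s : W.specialOver {lam}) {c e : ℤ} (h : c + d = e) (a : A.blk s i c) :
    costdEval (φ + φ') s h a = costdEval φ s h a + costdEval φ' s h a := rfl

lemma costdEval_zero {i : I} {d : ℤ}
    (s : W.specialOver {lam}) {c e : ℤ} (h : c + d = e) (a : A.blk s i c) :
    costdEval (0 : (costandardize W lam N).pc i d) s h a = 0 := rfl

lemma costd_eq_zero_of_not_le {s : W.S} (hs : ¬ lam ≤ W.dot s) {d : ℤ}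
    (φ : (costandardize W lam N).pc s d) : φ = 0 :=
  costd_ext fun t _ _ h a => costdEval_eq_zero φ t h
    (LUGAlgebra.mem_idealGen_right (Weights.mem_specialOver (W := W)
      (Γ := {mu | ¬ lam ≤ mu}) hs) a)

lemma costd_mem_upperSub (Γ : Set Λ) (hΓ : ∀ mu ∈ Γ, ¬ lam ≤ mu) {i : I} {d : ℤ}
    (φ : (costandardize W lam N).pc i d) :
    φ ∈ (upperSub W Γ (costandardize W lam N)).carrier i d := fun s hs _ _ _ _ =>
  costd_eq_zero_of_not_le (s := ⟨s, hs.1⟩) (hΓ _ hs.2) _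

/-- An element of `j^λ_* N` that is killed by `e_λ A` is zero. -/
lemma costd_eq_zero_of_act {i : I} {d : ℤ} {φ : (costandardize W lam N).pc i d}
    (H : ∀ (s : W.specialOver {lam}) (c e : ℤ) (h : c + d = e) (a : A.blk s i c),
      (costandardize W lam N).act h a φ = 0) : φ = 0 :=
  costd_ext fun s c e h a => by
    have := costdEval_act h a φ s (zero_add e) (zero_add c) h (A.one s)
    rw [A.one_mul, H] at this
    exact this.symm

/-- The counit `e_λ (j^λ_* N) ⟶ N`. -/
def costdCounit (N : GMod (A.cartan W lam)) :
    weightPart W lam (costandardize W lam N) ⟶ N where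
  app s d :=
    { toFun := fun v => costdEval (weightVal v) s (zero_add d) (A.one s)
      map_add' := fun _ _ => rfl
      map_smul' := fun _ _ => rfl }
  app_act {s t c d e} h a v := by
    obtain ⟨a, rfl⟩ := cartanMk_surjective W lam a
    have h1 := costdEval_act h a (weightVal v) s (zero_add e) (zero_add c) h (A.one s)
    have h2 := costdEval_mul (weightVal v) s t (add_zero c) (zero_add d) h h a (A.one t)
    rw [A.one_mul] at h1
    rw [A.mul_one] at h2
    exact h1.trans h2

lemma costdCounit_apply {s : W.specialOver {lam}} {d : ℤ}
    (v : (weightPart W lam (costandardize W lam N)).pc s d) :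
    (costdCounit N).app s d v = costdEval (weightVal v) s (zero_add d) (A.one s) := rfl

/-- For s of weight λ the A_λ-module ē_λ A_{≥λ} 1_s = A_λ 1_s is generated by its idempotent, so a
homomorphism out of it is determined by its value there, and this value is arbitrary. -/
lemma costdCounit_bijective (N : GMod (A.cartan W lam)) (s : W.specialOver {lam}) (d : ℤ) :
    Function.Bijective ((costdCounit N).app s d) := by
  constructor
  · rw [injective_iff_map_eq_zero]
    intro v hv
    refine weightVal_injective (costd_ext fun t c e h a => ?_)
    rw [costdCounit_apply] at hv
    rw [← A.mul_one a, costdEval_mul _ t s (add_zero c) (zero_add d) h h, hv, map_zero, map_zero,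
      costdEval_zero]
  · intro n
    let φ : (costandardize W lam N).pc s d := costdMk
      (fun p => ((N.act (i := p.1.1) (j := s) p.2).flip n).comp (cartanMk W lam))
      (fun p a ha => by
        change N.act p.2 (cartanMk W lam a) n = 0
        have h0 : cartanMk W lam a = 0 := (Submodule.Quotient.mk_eq_zero _).2 ha
        rw [h0]
        exact LinearMap.map_zero₂ (N.act p.2) n)
      (fun s' t x c y e f hx he hf hxe b a =>
        N.mul_act hx he hf hxe (cartanMk W lam b) (cartanMk W lam a) n)
    obtain ⟨w, hw⟩ := exists_weightVal (lam := lam) (v := φ)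
      (costd_mem_upperSub _ (fun _ h => h) φ)
    refine ⟨w, ?_⟩
    rw [costdCounit_apply, hw]
    exact N.one_act n

/-- `e_λ (j^λ_* N)^{≥λ} ≅ N`. -/
noncomputable def weightPartCostd (N : GMod (A.cartan W lam)) :
    weightPart W lam (costandardize W lam N) ≅ N :=
  isoOfBijective (costdCounit N) (costdCounit_bijective N)

/-- If λ ≰ μ, the costandard module has nothing at weight μ. If λ < μ, then λ ≱ μ, so elements of
the weight part at μ are killed by e_λ A; but e_λ A detects every element of j^λ_* N. -/
lemma weightPart_costd_eq_zero {mu : Λ} (h : mu ≠ lam) (s : W.specialOver {mu}) (d : ℤ)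
    (v : (weightPart W mu (costandardize W lam N)).pc s d) : v = 0 := by
  apply weightVal_injective
  rw [map_zero]
  have hs : W.dot ⟨s, s.2.1⟩ = mu := s.2.2
  by_cases h1 : lam ≤ mu
  · refine costd_eq_zero_of_act fun t c e hc a => weightVal_mem v t ?_ c e hc a
    refine ⟨t.2.1, ?_⟩
    have ht : W.dot ⟨t, t.2.1⟩ = lam := t.2.2
    rw [ht]
    exact fun h2 => h (le_antisymm h2 h1)
  · exact costd_eq_zero_of_not_le (W := W) (s := ⟨s.1, s.2.1⟩) (by rwa [hs]) _

end Costandardize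

end GMod

end Functors

/-! ### Exactness of costandardization; weight parts of injective modules -/

section Constructions

variable {k : Type u} [Field k] {I : Type u} {A : LUGAlgebra k I}
  {Λ : Type v} {W : Weights I Λ} [PartialOrder Λ]

/-- A special index of weight `λ` as an index of `A_λ`. -/
abbrev Weights.over (W : Weights I Λ) {lam : Λ} (s : W.S) (h : W.dot s = lam) :
    W.specialOver {lam} := ⟨s, s.2, h⟩

omit [PartialOrder Λ] in
lemma Weights.exists_over {lam : Λ} (s : W.specialOver {lam}) :
    ∃ (s' : W.S) (h : W.dot s' = lam), s = W.over s' h := ⟨⟨s, s.2.1⟩, s.2.2, rfl⟩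

namespace GMod

/-- Evaluation of an element of a coinduced module. -/
def coindEval (U : I → ℤ → Type u) [∀ i d, AddCommGroup (U i d)] [∀ i d, Module k (U i d)]
    {j : I} (i : I) {d c e : ℤ} (h : c + d = e) :
    (coind A U).pc j d →ₗ[k] (A.blk i j c →ₗ[k] U i e) :=
  LinearMap.proj (φ := fun p : {p : I × ℤ × ℤ // p.2.1 + d = p.2.2} =>
    A.blk p.1.1 j p.1.2.1 →ₗ[k] U p.1.1 p.1.2.2) ⟨(i, c, e), h⟩

lemma coindEval_act (U : I → ℤ → Type u) [∀ i d, AddCommGroup (U i d)] [∀ i d, Module k (U i d)]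
    {j' j : I} {x d f : ℤ} (h : x + d = f) (a : A.blk j' j x)
    (φ : (coind A U).pc j d) (i : I) {c e : ℤ} (hp : c + f = e) (b : A.blk i j' c) {c' : ℤ}
    (hc : c + x = c') (hp' : c' + d = e) :
    coindEval U i hp ((coind A U).act h a φ) b = coindEval U i hp' φ (A.mul hc b a) :=
  coind_act_apply U h a φ i c e hp b c' hc

lemma coind_ext {U : I → ℤ → Type u} [∀ i d, AddCommGroup (U i d)] [∀ i d, Module k (U i d)]
    {j : I} {d : ℤ} {φ φ' : (coind A U).pc j d}
    (H : ∀ (i : I) (c e : ℤ) (h : c + d = e) (a : A.blk i j c),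
      coindEval U i h φ a = coindEval U i h φ' a) : φ = φ' := by
  funext ⟨⟨i, c, e⟩, h⟩
  exact LinearMap.ext fun a => H i c e h a

lemma cartanMk_eq_zero {lam : Λ} {s t : W.specialOver {lam}} {d : ℤ} {a : A.blk s t d}
    (h : a ∈ (A.idealGen (W.specialOver (Set.Iio lam))).carrier s t d) : cartanMk W lam a = 0 :=
  (Submodule.Quotient.mk_eq_zero _).2
    (LUGAlgebra.idealGen_mono TriangularBasis.not_le_of_mem_specialOver_Iio _ _ _ h)

lemma act_cartanMk_eq_zero {lam : Λ} (N : GMod (A.cartan W lam)) {s t : W.specialOver {lam}}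
    {d e f : ℤ} (h' : d + e = f) {a : A.blk s t d}
    (h : a ∈ (A.idealGen (W.specialOver (Set.Iio lam))).carrier s t d) (v : N.pc t e) :
    N.act h' (cartanMk W lam a) v = 0 := by
  rw [cartanMk_eq_zero h]
  exact LinearMap.map_zero₂ (N.act h') v

lemma act_cartanMk_mul {lam : Λ} (N : GMod (A.cartan W lam)) {s t r : W.specialOver {lam}}
    {d e f de ef x : ℤ} (h₁ : d + e = de) (h₂ : e + f = ef) (h₃ : de + f = x) (h₄ : d + ef = x)
    (a : A.blk s t d) (b : A.blk t r e) (v : N.pc r f) :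
    N.act h₃ (cartanMk W lam (A.mul h₁ a b)) v =
      N.act h₄ (cartanMk W lam a) (N.act h₂ (cartanMk W lam b) v) :=
  N.mul_act h₁ h₂ h₃ h₄ (cartanMk W lam a) (cartanMk W lam b) v

/-- Every `A_λ`-homomorphism `e_λ A_{≥λ} 1_i ⟶ e_λ V^{≥λ}` is given by the action on an element of
`1_i V^Γ`. -/
def HasWeightLifts (W : Weights I Λ) (Γ : Set Λ) (lam : Λ) (V : GMod A) : Prop :=
  ∀ (i : I) (d : ℤ) (φ : (costandardize W lam (weightPart W lam V)).pc i d),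
    ∃ w ∈ (upperSub W Γ V).carrier i d, ∀ (s : W.specialOver {lam}) (c e : ℤ) (h : c + d = e)
      (a : A.blk s i c), V.act h a w = weightVal (costdEval φ s h a)

end GMod

namespace TriangularBasis

open GMod

variable (T : TriangularBasis A W)

lemma idealGen_Iio_le {lam : Λ} (i j : I) (d : ℤ) :
    (A.idealGen (W.specialOver (Set.Iio lam))).carrier i j d ≤
      (A.idealGen (W.specialOver {mu | ¬ lam ≤ mu})).carrier i j d :=
  LUGAlgebra.idealGen_mono not_le_of_mem_specialOver_Iio _ _ _

lemma one_mem_X (s : W.S) : A.one s ∈ T.X s s 0 := by rw [T.X_self_zero]; rfl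

lemma one_mem_Y (s : W.S) : A.one s ∈ T.Y s s 0 := by rw [T.Y_self_zero]; rfl

/-- A linear map on a weight space of `A` vanishes on the ideal generated by the idempotents of
weight in `Γ` if it vanishes on the basis elements that factor through them. -/
lemma eq_zero_on_idealGen {Γ : Set Λ} (hΓ : IsLowerSet Γ) {i j : I} {d : ℤ} {P : Type u}
    [AddCommGroup P] [Module k P] (f : A.blk i j d →ₗ[k] P)
    (H : ∀ (s t : W.S) (c₁ c₂ c₃ c₁₂ : ℤ) (h₁ : c₁ + c₂ = c₁₂) (h₂ : c₁₂ + c₃ = d)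
      (x : A.blk i s c₁) (h : A.blk s t c₂) (y : A.blk t j c₃), x ∈ T.X i s c₁ → h ∈ T.H s t c₂ →
      y ∈ T.Y t j c₃ → W.dot s ∈ Γ → f (A.mul h₂ (A.mul h₁ x h) y) = 0)
    {a : A.blk i j d} (ha : a ∈ (A.idealGen (W.specialOver Γ)).carrier i j d) : f a = 0 := by
  rw [T.idealGen_eq_weightSpan hΓ] at ha
  refine (Submodule.span_le (p := LinearMap.ker f)).2 ?_ ha
  rintro z ⟨s, t, c₁, c₂, c₃, c₁₂, h₁, h₂, x, h', y, hx, hh, hy, hs, rfl⟩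
  exact H _ _ _ _ _ _ _ _ _ _ _ hx hh hy hs

section Costandard

variable {lam : Λ} {N N' : GMod (A.cartan W lam)} {i : I} {d : ℤ}
  (n : ∀ (t : W.specialOver {lam}) (c : ℤ), A.blk t i c → N.pc t (c + d))

open Classical in
/-- The linear map with `h y ↦ h n_y`. -/
noncomputable def costdExtend (s : W.specialOver {lam}) {c e : ℤ} (he : c + d = e) :
    A.blk s i c →ₗ[k] N.pc s e :=
  T.lift fun s' t c₁ c₂ c₃ hc x h y =>
    if ht : W.dot s' = lam ∧ W.dot t = lam then
      N.act (i := s) (j := W.over t ht.2) (show (c₁ + c₂) + (c₃ + d) = e by omega)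
        (cartanMk W lam (A.mul rfl x h)) (n (W.over t ht.2) c₃ y)
    else 0

lemma costdExtend_eq_zero (s : W.specialOver {lam}) {c e : ℤ} (he : c + d = e) {a : A.blk s i c}
    (ha : a ∈ (A.idealGen (W.specialOver {mu | ¬ lam ≤ mu})).carrier s i c) :
    T.costdExtend n s he a = 0 := by
  refine T.eq_zero_on_idealGen (isLowerSet_not_le _) _ ?_ ha
  intro s' t c₁ c₂ c₃ c₁₂ h₁ h₂ x h' y hx hh hy hs
  rw [costdExtend, T.lift_apply _ h₁ h₂ hx hh hy, dif_neg]
  rintro ⟨rfl, -⟩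
  exact hs le_rfl

open Classical in
-- The formula h y ↦ h n_y passes from h ∈ H to every z ∈ 1_s A 1_t: modulo smaller weights H spans
-- this space, and both sides vanish on the smaller weights.
lemma costdExtend_mul_Y {s t : W.S} (hs : W.dot s = lam) (ht : W.dot t = lam) {m c₃ c e f : ℤ}
    (hc : m + c₃ = c) (he : c + d = e) (hf : c₃ + d = f) (hf' : m + f = e) (z : A.blk s t m)
    {y : A.blk t i c₃} (hy : y ∈ T.Y t i c₃) :
    T.costdExtend n (W.over s hs) he (A.mul hc z y) =
      N.act (i := W.over s hs) (j := W.over t ht) hf' (cartanMk W lam z)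
        (N.recast hf (n (W.over t ht) c₃ y)) := by
  subst hf
  rw [recast_rfl]
  refine T.induction_mid (hs.trans ht.symm) (P := LinearMap.eqLocus
    ((T.costdExtend n (W.over s hs) he).comp ((A.mul hc).flip y))
    (((N.act (i := W.over s hs) (j := W.over t ht) hf').flip (n (W.over t ht) c₃ y)).comp
      (cartanMk W lam (s := W.over s hs) (t := W.over t ht)))) ?_ ?_ z
  · intro z hz
    rw [hs] at hz
    have e1 := T.costdExtend_eq_zero n (W.over s hs) he
      (idealGen_Iio_le _ _ _ (LUGAlgebra.GIdeal.mul_mem_right _ hc y hz))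
    exact e1.trans (act_cartanMk_eq_zero N (s := W.over s hs) (t := W.over t ht) hf' hz _).symm
  · intro h hh
    have e1 := T.lift_apply (fun s' t c₁ c₂ c₃ hc x h y =>
      if ht : W.dot s' = lam ∧ W.dot t = lam then
        N.act (i := W.over s hs) (j := W.over t ht.2) (show (c₁ + c₂) + (c₃ + d) = e by omega)
          (cartanMk W lam (s := W.over s hs) (t := W.over t ht.2) (A.mul rfl x h))
          (n (W.over t ht.2) c₃ y)
      else 0) (zero_add m) hc (T.one_mem_X s) hh hy
    rw [A.one_mul, dif_pos ⟨hs, ht⟩] at e1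
    refine e1.trans ?_
    have key : ∀ (c' : ℤ) (hc : 0 + m = c') (h' : c' + (c₃ + d) = e),
        N.act (i := W.over s hs) (j := W.over t ht) h'
          (cartanMk W lam (s := W.over s hs) (t := W.over t ht) (A.mul hc (A.one s) h))
          (n (W.over t ht) c₃ y) =
        N.act (i := W.over s hs) (j := W.over t ht) hf'
          (cartanMk W lam (s := W.over s hs) (t := W.over t ht) h) (n (W.over t ht) c₃ y) := by
      intro c' hc h'
      obtain rfl : m = c' := by omega
      rw [A.one_mul]
    exact key _ rfl _

/-- Linearity over A_λ: b (h y) = (b h) y, and the previous formula applies with b h in place of h.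
-/
lemma costdExtend_mul (s t : W.specialOver {lam}) {x c y e f : ℤ} (hx : x + c = y) (he : c + d = e)
    (hf : y + d = f) (hxe : x + e = f) (b : A.blk s t x) (a : A.blk t i c) :
    T.costdExtend n s hf (A.mul hx b a) =
      N.act hxe (cartanMk W lam b) (T.costdExtend n t he a) := by
  obtain ⟨s, hs, rfl⟩ := Weights.exists_over s
  obtain ⟨t, ht, rfl⟩ := Weights.exists_over t
  refine T.induction_left (s := t) (P := LinearMap.eqLocus
    ((T.costdExtend n (W.over s hs) hf).comp (A.mul hx b))
    ((N.act (i := W.over s hs) (j := W.over t ht) hxe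
      (cartanMk W lam (s := W.over s hs) (t := W.over t ht) b)).comp
      (T.costdExtend n (W.over t ht) he))) ?_ ?_ a
  · intro a ha
    rw [ht] at ha
    have e1 := T.costdExtend_eq_zero n (W.over t ht) he (idealGen_Iio_le _ _ _ ha)
    have e2 := T.costdExtend_eq_zero n (W.over s hs) hf
      (idealGen_Iio_le _ _ _ (LUGAlgebra.GIdeal.mul_mem_left _ hx b ha))
    refine e2.trans (Eq.symm ?_)
    exact (congrArg (N.act (i := W.over s hs) (j := W.over t ht) hxe
      (cartanMk W lam (s := W.over s hs) (t := W.over t ht) b)) e1).trans (LinearMap.map_zero _)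
  · intro r c₂ c₃ h₂ h g hh hg
    have hr : W.dot r = lam := (T.dot_eq_of_mem_H hh).symm.trans ht
    have e1 := T.costdExtend_mul_Y n ht hr h₂ he rfl (by omega) h hg
    have e2 := T.costdExtend_mul_Y n hs hr (m := x + c₂) (by omega) hf rfl (by omega)
      (A.mul rfl b h) hg
    have e3 := act_cartanMk_mul N (s := W.over s hs) (t := W.over t ht) (r := W.over r hr)
      (rfl : x + c₂ = x + c₂) (show c₂ + (c₃ + d) = e by omega) (show _ = f by omega) hxe b h
      (N.recast rfl (n (W.over r hr) c₃ g))
    refine (congrArg (T.costdExtend n (W.over s hs) hf) (A.mul_mul' h₂ hx b h g)).trans ?_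
    refine (e2.trans e3).trans ?_
    exact congrArg (N.act (i := W.over s hs) (j := W.over t ht) hxe
      (cartanMk W lam (s := W.over s hs) (t := W.over t ht) b)) e1.symm

include T in
/-- `j^λ_*` preserves epimorphisms. -/
lemma exists_costd_lift (g : N ⟶ N') (hg : ∀ s d, Function.Surjective (g.app s d))
    (φ' : (costandardize W lam N').pc i d) : ∃ φ : (costandardize W lam N).pc i d,
      ∀ (s : W.specialOver {lam}) (c e : ℤ) (h : c + d = e) (a : A.blk s i c),
        g.app s e (costdEval φ s h a) = costdEval φ' s h a := by
  -- As a left A_λ-module, ē_λ A_{≥λ} 1_i is the direct sum of copies of A_λ 1_t, one for each y ∈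
  -- Y(t,i) with t of weight λ. So preimages of the values at the y may be chosen freely and
  -- extended.
  have hn : ∀ (t : W.specialOver {lam}) (c : ℤ) (y : A.blk t i c), ∃ n : N.pc t (c + d),
      g.app t (c + d) n = costdEval φ' t rfl y := fun t c y => hg t _ _
  choose n hn using hn
  refine ⟨costdMk (fun p => T.costdExtend n p.1.1 p.2)
    (fun p a ha => T.costdExtend_eq_zero n _ _ ha)
    fun s t x c y e f hx he hf hxe b a => T.costdExtend_mul n s t hx he hf hxe b a, ?_⟩
  intro s c e he a
  obtain ⟨s, hs, rfl⟩ := Weights.exists_over s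
  rw [costdEval_mk]
  refine T.induction_left (s := s) (P := LinearMap.eqLocus
      ((g.app (W.over s hs) e).comp (T.costdExtend n (W.over s hs) he))
      (costdEval φ' (W.over s hs) he)) ?_ ?_ a
  · intro a ha
    rw [hs] at ha
    have e1 := T.costdExtend_eq_zero n (W.over s hs) he (idealGen_Iio_le _ _ _ ha)
    have e2 := costdEval_eq_zero φ' (W.over s hs) he (idealGen_Iio_le _ _ _ ha)
    exact ((congrArg (g.app (W.over s hs) e) e1).trans (LinearMap.map_zero _)).trans e2.symm
  · intro r c₂ c₃ h₂ h y hh hy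
    have hr : W.dot r = lam := (T.dot_eq_of_mem_H hh).symm.trans hs
    have e1 := T.costdExtend_mul_Y n hs hr h₂ he rfl (by omega) h hy
    have e2 := costdEval_mul φ' (W.over s hs) (W.over r hr) h₂ rfl he (by omega) h y
    rw [recast_rfl] at e1
    refine (congrArg (g.app (W.over s hs) e) e1).trans (Eq.trans ?_ e2.symm)
    refine (g.app_act _ _ _).trans ?_
    exact congrArg (N'.act (i := W.over s hs) (j := W.over r hr) _
      (cartanMk W lam (s := W.over s hs) (t := W.over r hr) h)) (hn _ _ _)

end Costandard

section InjectiveWeightPart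

variable {U : I → ℤ → Type u} [∀ i d, AddCommGroup (U i d)] [∀ i d, Module k (U i d)]
  {lam : Λ} {Y : GMod (A.cartan W lam)}
  (ρ : ∀ (i : I) (s : W.specialOver {lam}) {c d e : ℤ}, c + d = e →
    (Y.pc s d →ₗ[k] (A.blk i s c →ₗ[k] U i e)))

open Classical in
/-- The linear map `x h ↦ ρ(h v)(x)`. -/
noncomputable def dualExtend (i : I) (u : W.specialOver {lam}) {c d e : ℤ} (he : c + d = e)
    (v : Y.pc u d) : A.blk i u c →ₗ[k] U i e :=
  T.lift fun s t c₁ c₂ c₃ hc x h y =>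
    if hs : W.dot s = lam then
      ρ i (W.over s hs) (c := c₁) (d := c₂ + c₃ + d) (e := e) (by omega)
        (Y.act (i := W.over s hs) rfl (cartanMk W lam (A.mul rfl h y)) v) x
    else 0

lemma dualExtend_eq_zero (i : I) (u : W.specialOver {lam}) {c d e : ℤ} (he : c + d = e)
    (v : Y.pc u d) {a : A.blk i u c}
    (ha : a ∈ (A.idealGen (W.specialOver {mu | ¬ lam ≤ mu})).carrier i u c) :
    T.dualExtend ρ i u he v a = 0 := by
  refine T.eq_zero_on_idealGen (isLowerSet_not_le _) _ ?_ ha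
  intro s' t c₁ c₂ c₃ c₁₂ h₁ h₂ x h' y hx hh hy hs
  rw [dualExtend, T.lift_apply _ h₁ h₂ hx hh hy, dif_neg]
  rintro rfl
  exact hs le_rfl

lemma dualExtend_add (i : I) (u : W.specialOver {lam}) {c d e : ℤ} (he : c + d = e)
    (v w : Y.pc u d) (a : A.blk i u c) : T.dualExtend ρ i u he (v + w) a =
      T.dualExtend ρ i u he v a + T.dualExtend ρ i u he w a := by
  refine T.induction (P := LinearMap.eqLocus (T.dualExtend ρ i u he (v + w))
    (T.dualExtend ρ i u he v + T.dualExtend ρ i u he w)) ?_ a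
  intro s' t c₁ c₂ c₃ c₁₂ h₁ h₂ x h' y hx hh hy
  change T.dualExtend ρ i u he (v + w) _ = T.dualExtend ρ i u he v _ + T.dualExtend ρ i u he w _
  simp only [dualExtend]
  rw [T.lift_apply _ h₁ h₂ hx hh hy, T.lift_apply _ h₁ h₂ hx hh hy, T.lift_apply _ h₁ h₂ hx hh hy]
  split_ifs with hs
  · rw [map_add, map_add]
    rfl
  · rw [add_zero]

lemma dualExtend_smul (i : I) (u : W.specialOver {lam}) {c d e : ℤ} (he : c + d = e)
    (r : k) (v : Y.pc u d) (a : A.blk i u c) : T.dualExtend ρ i u he (r • v) a =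
      r • T.dualExtend ρ i u he v a := by
  refine T.induction (P := LinearMap.eqLocus (T.dualExtend ρ i u he (r • v))
    (r • T.dualExtend ρ i u he v)) ?_ a
  intro s' t c₁ c₂ c₃ c₁₂ h₁ h₂ x h' y hx hh hy
  change T.dualExtend ρ i u he (r • v) _ = r • T.dualExtend ρ i u he v _
  simp only [dualExtend]
  rw [T.lift_apply _ h₁ h₂ hx hh hy, T.lift_apply _ h₁ h₂ hx hh hy]
  split_ifs with hs
  · rw [map_smul, map_smul]
    rfl
  · rw [smul_zero]

open Classical in
-- The mirror image of `costdExtend_mul_Y`, with x on the left in place of y on the right.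
lemma dualExtend_X_mul {i : I} {s u : W.S} (hs : W.dot s = lam) (hu : W.dot u = lam)
    {m c₁ c d e f : ℤ} (hc : c₁ + m = c) (he : c + d = e) (hf : m + d = f) (hf' : c₁ + f = e)
    (v : Y.pc (W.over u hu) d) {x : A.blk i s c₁} (hx : x ∈ T.X i s c₁) (z : A.blk s u m) :
    T.dualExtend ρ i (W.over u hu) he v (A.mul hc x z) =
      ρ i (W.over s hs) hf' (Y.act (i := W.over s hs) (j := W.over u hu) hf
        (cartanMk W lam (s := W.over s hs) (t := W.over u hu) z) v) x := by
  refine T.induction_mid (hs.trans hu.symm) (P := LinearMap.eqLocus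
    ((T.dualExtend ρ i (W.over u hu) he v).comp (A.mul hc x))
    (((ρ i (W.over s hs) hf').flip x).comp
      (((Y.act (i := W.over s hs) (j := W.over u hu) hf).flip v).comp
        (cartanMk W lam (s := W.over s hs) (t := W.over u hu))))) ?_ ?_ z
  · intro z hz
    rw [hs] at hz
    have e1 := T.dualExtend_eq_zero ρ i (W.over u hu) he v
      (idealGen_Iio_le _ _ _ (LUGAlgebra.GIdeal.mul_mem_left _ hc x hz))
    have e2 := act_cartanMk_eq_zero Y (s := W.over s hs) (t := W.over u hu) hf hz v
    refine e1.trans (Eq.symm ?_)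
    exact (congrArg (fun w => ρ i (W.over s hs) hf' w x) e2).trans
      (LinearMap.map_zero₂ (ρ i (W.over s hs) hf') x)
  · intro h hh
    have e1 := T.lift_apply (fun s' t c₁ c₂ c₃ hc x h y =>
      if hs : W.dot s' = lam then
        ρ i (W.over s' hs) (c := c₁) (d := c₂ + c₃ + d) (e := e) (by omega)
          (Y.act (i := W.over s' hs) (j := W.over u hu) rfl
            (cartanMk W lam (s := W.over s' hs) (t := W.over u hu) (A.mul rfl h y)) v) x
      else 0) hc (add_zero c) hx hh (T.one_mem_Y u)
    rw [A.mul_one, dif_pos hs] at e1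
    refine e1.trans ?_
    have key : ∀ (c' f' : ℤ) (hc : m + 0 = c') (h' : c₁ + f' = e) (h'' : c' + d = f'),
        ρ i (W.over s hs) h' (Y.act (i := W.over s hs) (j := W.over u hu) h''
          (cartanMk W lam (s := W.over s hs) (t := W.over u hu) (A.mul hc h (A.one u))) v) x =
        ρ i (W.over s hs) hf' (Y.act (i := W.over s hs) (j := W.over u hu) hf
          (cartanMk W lam (s := W.over s hs) (t := W.over u hu) h) v) x := by
      intro c' f' hc h' h''
      obtain rfl : m = c' := by omega
      obtain rfl : f = f' := by omega
      rw [A.mul_one]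
    exact key _ _ rfl _ _

lemma dualExtend_act (i : I) (s t : W.specialOver {lam}) {c x y d e z : ℤ} (h : c + e = z)
    (hx : x + d = e) (hy : c + x = y) (h' : y + d = z) (v : Y.pc t d) (a : A.blk i s c)
    (b : A.blk s t x) : T.dualExtend ρ i s h (Y.act hx (cartanMk W lam b) v) a =
      T.dualExtend ρ i t h' v (A.mul hy a b) := by
  obtain ⟨s, hs, rfl⟩ := Weights.exists_over s
  obtain ⟨t, ht, rfl⟩ := Weights.exists_over t
  refine T.induction_right (t := s) (P := LinearMap.eqLocus
    (T.dualExtend ρ i (W.over s hs) h (Y.act (i := W.over s hs) (j := W.over t ht) hx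
      (cartanMk W lam (s := W.over s hs) (t := W.over t ht) b) v))
    ((T.dualExtend ρ i (W.over t ht) h' v).comp ((A.mul hy).flip b))) ?_ ?_ a
  · intro a ha
    rw [hs] at ha
    have e1 := T.dualExtend_eq_zero ρ i (W.over s hs) h (Y.act (i := W.over s hs)
      (j := W.over t ht) hx (cartanMk W lam (s := W.over s hs) (t := W.over t ht) b) v)
      (idealGen_Iio_le _ _ _ ha)
    have e2 := T.dualExtend_eq_zero ρ i (W.over t ht) h' v
      (idealGen_Iio_le _ _ _ (LUGAlgebra.GIdeal.mul_mem_right _ hy b ha))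
    exact e1.trans e2.symm
  · intro q c₁ c₂ h₁ x' h'' hx' hh
    have hq : W.dot q = lam := (T.dot_eq_of_mem_H hh).trans hs
    have e1 := T.dualExtend_X_mul ρ hq hs h₁ h rfl (by omega) (Y.act (i := W.over s hs)
      (j := W.over t ht) hx (cartanMk W lam (s := W.over s hs) (t := W.over t ht) b) v) hx' h''
    have e2 := T.dualExtend_X_mul ρ hq ht (m := c₂ + x) (by omega) h' (f := c₂ + e) (by omega)
      (by omega) v hx' (A.mul rfl h'' b)
    have e3 := act_cartanMk_mul Y (s := W.over q hq) (t := W.over s hs) (r := W.over t ht)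
      (rfl : c₂ + x = c₂ + x) hx (show _ = c₂ + e by omega) rfl h'' b v
    refine e1.trans (Eq.symm ?_)
    refine (congrArg (T.dualExtend ρ i (W.over t ht) h' v) (A.mul_mul h₁ hy x' h'' b)).trans ?_
    exact e2.trans (congrArg (fun w => ρ i (W.over q hq) _ w x') e3)

include T in
-- By adjunction, homomorphisms from Y to this weight part are families of linear maps from j^λ_! Y
-- to U. The triangular basis writes 1_i j^λ_! Y as a direct sum of copies of 1_s Y, one for each x
-- ∈ X(i,s) with s of weight λ. Such linear maps are therefore given freely by their values at the
-- x, and extend along X ⊆ Y one x at a time.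
lemma injective_weightPart_coind : Injective (weightPart W lam (coind A U)) := by
  refine ⟨fun {X Y} g f hf => ?_⟩
  have hinv : ∀ i d, ∃ r : Y.pc i d →ₗ[k] X.pc i d, r.comp (f.app i d) = LinearMap.id := fun i d =>
    LinearMap.exists_leftInverse_of_injective _ (LinearMap.ker_eq_bot.2 (injective_of_mono f i d))
  choose r hr using hinv
  have hr' : ∀ i d v, r i d (f.app i d v) = v := fun i d v => LinearMap.congr_fun (hr i d) v
  -- `ρ` extends `g` through the linear retractions `r`, so it is only linear over the field.
  -- `dualExtend` keeps its values at the x and forces compatibility with A_λ.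
  obtain ⟨ρ, hρ⟩ : ∃ ρ : ∀ (i : I) (s : W.specialOver {lam}) {c d e : ℤ}, c + d = e →
      (Y.pc s d →ₗ[k] (A.blk i s c →ₗ[k] U i e)),
      ∀ i (s : W.specialOver {lam}) {c d e : ℤ} (h : c + d = e) (v : X.pc s d) a,
      ρ i s h (f.app s d v) a = coindEval U i h (weightVal (g.app s d v)) a := by
    refine ⟨fun i s c d e h =>
      (coindEval U i h).comp (weightVal.comp ((g.app s d).comp (r s d))), ?_⟩
    intro i s c d e h v a
    exact congrArg (fun w => coindEval U i h (weightVal (g.app s d w)) a) (hr' s d v)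
  let F : ∀ (s : W.specialOver {lam}) (d : ℤ) (v : Y.pc s d), (coind A U).pc s d :=
    fun s d v p => T.dualExtend ρ p.1.1 s p.2 v
  have hF : ∀ (s : W.specialOver {lam}) (d : ℤ) (v : Y.pc s d) (i : I) (c e : ℤ) (h : c + d = e)
      (a : A.blk i s c), coindEval U i h (F s d v) a = T.dualExtend ρ i s h v a :=
    fun _ _ _ _ _ _ _ _ => rfl
  clear_value F
  have hmem : ∀ (s : W.specialOver {lam}) (d : ℤ) (v : Y.pc s d),
      F s d v ∈ (upperSub W {mu | ¬ lam ≤ mu} (coind A U)).carrier s d := by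
    intro s d v t ht c e hc a
    refine coind_ext fun i c' e' he' b => ?_
    refine (coindEval_act U hc a (F s d v) i he' b rfl (show c' + c + d = e' by omega)).trans ?_
    rw [hF]
    exact T.dualExtend_eq_zero ρ i s _ v (LUGAlgebra.GIdeal.mul_mem_left _ rfl b
      (LUGAlgebra.mem_idealGen_left ht a))
  let G : ∀ (s : W.specialOver {lam}) (d : ℤ) (v : Y.pc s d),
      (weightPart W lam (coind A U)).pc s d :=
    fun s d v => ⟨F s d v, hmem s d v⟩
  have hG : ∀ s d v, weightVal (G s d v) = F s d v := fun _ _ _ => rfl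
  clear_value G
  have hG' : ∀ s d v (w : (weightPart W lam (coind A U)).pc s d),
      (∀ (i : I) (c e : ℤ) (h : c + d = e) (a : A.blk i s c),
        T.dualExtend ρ i s h v a = coindEval U i h (weightVal w) a) → G s d v = w := by
    intro s d v w h
    apply weightVal_injective
    rw [hG]
    refine coind_ext fun i c e he a => ?_
    rw [hF]
    exact h i c e he a
  refine ⟨⟨fun s d =>
    { toFun := G s d
      map_add' := fun v w => hG' _ _ _ _ fun i c e h a => ?_
      map_smul' := fun x v => hG' _ _ _ _ fun i c e h a => ?_ }, ?_⟩, ?_⟩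
  · refine (T.dualExtend_add ρ i s h v w a).trans ?_
    rw [← hF, ← hF, ← hG, ← hG, map_add, map_add]
    rfl
  · refine (T.dualExtend_smul ρ i s h x v a).trans ?_
    rw [← hF, ← hG, RingHom.id_apply, map_smul, map_smul]
    rfl
  · intro s t c d e h a v
    obtain ⟨a, rfl⟩ := cartanMk_surjective W lam a
    refine hG' _ _ _ _ fun i c' e' he' b => ?_
    rw [weightVal_act]
    refine Eq.trans ?_ (coindEval_act U h a (weightVal (G t d v)) i he' b rfl
      (show c' + c + d = e' by omega)).symm
    rw [hG, hF]
    exact T.dualExtend_act ρ i s t he' h rfl _ v b a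
  · ext s d v
    refine hG' _ _ _ _ fun i c e he a => ?_
    obtain ⟨s, hs, rfl⟩ := Weights.exists_over s
    refine T.induction_right (t := s) (P := LinearMap.eqLocus
      (T.dualExtend ρ i (W.over s hs) he (f.app (W.over s hs) d v))
      (coindEval U i he (weightVal (g.app (W.over s hs) d v)))) ?_ ?_ a
    · intro a ha
      rw [hs] at ha
      have e1 := T.dualExtend_eq_zero ρ i (W.over s hs) he (f.app (W.over s hs) d v)
        (idealGen_Iio_le _ _ _ ha)
      refine e1.trans (Eq.symm ?_)
      have e2 := act_eq_zero_of_mem_upperSub W he (idealGen_Iio_le _ _ _ ha)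
        (weightVal_mem (g.app (W.over s hs) d v))
      have e3 := coindEval_act U he a (weightVal (g.app (W.over s hs) d v)) i (zero_add e) (A.one i)
        (zero_add c) he
      rw [A.one_mul] at e3
      exact e3.symm.trans (congrArg (fun w => coindEval U i (zero_add e) w (A.one i)) e2)
    · intro q c₁ c₂ h₁ x h hx hh
      have hq : W.dot q = lam := (T.dot_eq_of_mem_H hh).trans hs
      have e1 := T.dualExtend_X_mul ρ hq hs h₁ he rfl (by omega) (f.app (W.over s hs) d v) hx h
      have e2 := f.app_act (i := W.over q hq) (j := W.over s hs) (rfl : c₂ + d = c₂ + d)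
        (cartanMk W lam (s := W.over q hq) (t := W.over s hs) h) v
      have e3 := g.app_act (i := W.over q hq) (j := W.over s hs) (rfl : c₂ + d = c₂ + d)
        (cartanMk W lam (s := W.over q hq) (t := W.over s hs) h) v
      have e4 := hρ i (W.over q hq) (show c₁ + (c₂ + d) = e by omega)
        (X.act (i := W.over q hq) (j := W.over s hs) (rfl : c₂ + d = c₂ + d)
        (cartanMk W lam (s := W.over q hq) (t := W.over s hs) h) v) x
      have e5 := coindEval_act U (rfl : c₂ + d = c₂ + d) h (weightVal (g.app (W.over s hs) d v)) i
        (show c₁ + (c₂ + d) = e by omega) x h₁ he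
      refine e1.trans (Eq.trans ?_ e5)
      refine (congrArg (fun w => ρ i (W.over q hq) _ w x) e2.symm).trans (e4.trans ?_)
      exact congrArg (fun w => coindEval U i (show c₁ + (c₂ + d) = e by omega) (weightVal w) x) e3

include T in
/-- The functor right adjoint to standardization preserves injectives. -/
lemma injective_weightPart (lam : Λ) {V : GMod A} (hV : Injective V) :
    Injective (weightPart W lam V) := by
  -- An injective V is a retract of a coinduced module, and functors preserve retracts.
  let f : V ⟶ coind A V.pc := coindLift fun _ _ => LinearMap.id
  have : Mono f := mono_of_injective _ fun i d => by
    rw [injective_iff_map_eq_zero]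
    intro v hv
    rw [← V.one_act v]
    exact congrArg (fun φ => coindEval V.pc i (zero_add d) φ (A.one i)) hv
  have := T.injective_weightPart_coind (lam := lam) (U := V.pc)
  refine Retract.injective (Y := weightPart W lam (coind A V.pc)) ⟨weightMap W lam f,
    weightMap W lam (Injective.factorThru (𝟙 V) f), ?_⟩
  rw [← weightMap_comp, Injective.comp_factorThru, weightMap_id]

end InjectiveWeightPart

end TriangularBasis

end Constructions

/-! ### Weight lifts for injective modules -/

section Lifting

variable {k : Type u} [Field k] {I : Type u} {A : LUGAlgebra k I}
  {Λ : Type v} {W : Weights I Λ} [PartialOrder Λ]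

namespace TriangularBasis

open GMod

variable (T : TriangularBasis A W)

section Injective

variable {lam : Λ} {V : GMod A} {i : I} {d : ℤ}
  (φ : (costandardize W lam (weightPart W lam V)).pc i d)

open Classical in
/-- The linear map `x h y ↦ x φ(h y)` for `x h y` factoring through weight `λ`, and zero on the other
basis elements. -/
noncomputable def weightExtend (j : I) {c e : ℤ} (he : c + d = e) : A.blk j i c →ₗ[k] V.pc j e :=
  T.lift fun s t c₁ c₂ c₃ hc x h y =>
    if hs : W.dot s = lam then
      V.act (show c₁ + (c₂ + c₃ + d) = e by omega) x
        (weightVal (costdEval φ (W.over s hs) rfl (A.mul rfl h y)))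
    else 0

lemma weightExtend_eq_zero {Γ : Set Λ} (hΓ : IsLowerSet Γ) (hlam : lam ∉ Γ) (j : I) {c e : ℤ}
    (he : c + d = e) {a : A.blk j i c} (ha : a ∈ (A.idealGen (W.specialOver Γ)).carrier j i c) :
    T.weightExtend φ j he a = 0 := by
  refine T.eq_zero_on_idealGen hΓ _ ?_ ha
  intro s' t c₁ c₂ c₃ c₁₂ h₁ h₂ x h' y hx hh hy hs
  rw [weightExtend, T.lift_apply _ h₁ h₂ hx hh hy, dif_neg]
  rintro rfl
  exact hlam hs

open Classical in
lemma weightExtend_X_mul {Γ : Set Λ} (hΓ : IsLowerSet Γ) (hlam : lam ∉ Γ) (hIio : Set.Iio lam ⊆ Γ)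
    {j : I} {s : W.S} (hs : W.dot s = lam) {m c₁ c e f : ℤ} (hc : c₁ + m = c) (he : c + d = e)
    (hf : m + d = f) (hf' : c₁ + f = e) {x : A.blk j s c₁} (hx : x ∈ T.X j s c₁) (z : A.blk s i m) :
    T.weightExtend φ j he (A.mul hc x z) =
      V.act hf' x (weightVal (costdEval φ (W.over s hs) hf z)) := by
  refine T.induction_left (s := s) (P := LinearMap.eqLocus
    ((T.weightExtend φ j he).comp (A.mul hc x))
    ((V.act hf' x).comp (weightVal.comp (costdEval φ (W.over s hs) hf)))) ?_ ?_ z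
  · intro z hz
    rw [hs] at hz
    have e1 := T.weightExtend_eq_zero φ hΓ hlam j he (LUGAlgebra.GIdeal.mul_mem_left _ hc x
      (LUGAlgebra.idealGen_mono (Weights.specialOver_mono hIio) _ _ _ hz))
    have e2 := costdEval_eq_zero φ (W.over s hs) hf (idealGen_Iio_le _ _ _ hz)
    refine e1.trans (Eq.symm ?_)
    exact (congrArg (fun w => V.act hf' x (weightVal w)) e2).trans
      ((congrArg (V.act hf' x) (LinearMap.map_zero _)).trans (LinearMap.map_zero _))
  · intro t c₂ c₃ h₂ h y hh hy
    have e1 := T.lift_apply (i := j) (fun s t c₁ c₂ c₃ hc x h y =>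
      if hs : W.dot s = lam then
        V.act (show c₁ + (c₂ + c₃ + d) = e by omega) x
          (weightVal (costdEval φ (W.over s hs) rfl (A.mul rfl h y)))
      else 0) (rfl : c₁ + c₂ = c₁ + c₂) (show c₁ + c₂ + c₃ = c by omega) hx hh hy
    rw [dif_pos hs] at e1
    refine (congrArg (T.weightExtend φ j he) (A.mul_mul' h₂ hc x h y)).trans (e1.trans ?_)
    have key : ∀ (m' f' : ℤ) (h₂ : c₂ + c₃ = m') (hf : m' + d = f') (hf' : c₁ + f' = e),
        V.act (show c₁ + (c₂ + c₃ + d) = e by omega) x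
          (weightVal (costdEval φ (W.over s hs) rfl (A.mul rfl h y))) =
        V.act hf' x (weightVal (costdEval φ (W.over s hs) hf (A.mul h₂ h y))) := by
      rintro _ _ rfl rfl _
      rfl
    exact key m f h₂ hf hf'

/-- Modulo smaller weights a is a combination of products x h, for which the formula holds by
construction and by A_λ-linearity of φ. Smaller weights contribute zero on both sides: on the left
because they lie in Γ, on the right because the values of φ lie in the weight part. -/
lemma weightExtend_mul {Γ : Set Λ} (hΓ : IsLowerSet Γ) (hlam : lam ∉ Γ) (hIio : Set.Iio lam ⊆ Γ)
    {j : I} (s : W.specialOver {lam}) {m c₁ c e f : ℤ} (hc : c₁ + m = c) (he : c + d = e)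
    (hf : m + d = f) (hf' : c₁ + f = e) (a : A.blk j s c₁) (z : A.blk s i m) :
    T.weightExtend φ j he (A.mul hc a z) = V.act hf' a (weightVal (costdEval φ s hf z)) := by
  obtain ⟨s, hs, rfl⟩ := Weights.exists_over s
  refine T.induction_right (t := s) (P := LinearMap.eqLocus
    ((T.weightExtend φ j he).comp ((A.mul hc).flip z))
    ((V.act hf').flip (weightVal (costdEval φ (W.over s hs) hf z)))) ?_ ?_ a
  · intro a ha
    rw [hs] at ha
    have e1 := T.weightExtend_eq_zero φ hΓ hlam j he (LUGAlgebra.GIdeal.mul_mem_right _ hc z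
      (LUGAlgebra.idealGen_mono (Weights.specialOver_mono hIio) _ _ _ ha))
    exact e1.trans (act_eq_zero_of_mem_upperSub W hf' (idealGen_Iio_le _ _ _ ha)
      (weightVal_mem (costdEval φ (W.over s hs) hf z))).symm
  · intro q c₂ c₃ h₁ x h hx hh
    have hq : W.dot q = lam := (T.dot_eq_of_mem_H hh).trans hs
    have e1 := T.weightExtend_X_mul φ hΓ hlam hIio hq (show c₂ + (c₃ + m) = c by omega) he
      rfl (show c₂ + (c₃ + m + d) = e by omega) hx (A.mul rfl h z)
    have e2 := costdEval_mul φ (W.over q hq) (W.over s hs) (rfl : c₃ + m = c₃ + m) hf rfl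
      (show c₃ + f = c₃ + m + d by omega) h z
    refine (congrArg (T.weightExtend φ j he) (A.mul_mul h₁ hc x h z)).trans (e1.trans ?_)
    refine (congrArg (fun w => V.act _ x (weightVal w)) e2).trans ?_
    exact (V.mul_act h₁ _ hf' _ x h _).symm

include T in
/-- Injective modules have weight lifts. -/
lemma hasWeightLifts_of_injective (hV : Injective V) {Γ : Set Λ} (hΓ : IsLowerSet Γ)
    (hlam : lam ∉ Γ) (hIio : Set.Iio lam ⊆ Γ) : HasWeightLifts W Γ lam V := by
  intro i d φ
  -- U is the left ideal A e_{Γ∪{λ}} A 1_i inside A 1_i. The map `weightExtend` is A-linear on U, so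
  -- injectivity of V extends it to all of A 1_i, and the image of 1_i is the required lift.
  let U : GSub (free A i) :=
    { carrier := fun j c => (A.idealGen (W.specialOver (insert lam Γ))).carrier j i c
      act_mem := fun h a _ hv => LUGAlgebra.GIdeal.mul_mem_left _ h a hv }
  have key : ∀ {j l : I} {x c y e f : ℤ} (hx : x + c = y) (he : c + d = e) (hf : y + d = f)
      (hxe : x + e = f) (b : A.blk j l x) (a : A.blk l i c),
      a ∈ (A.idealGen (W.specialOver (insert lam Γ))).carrier l i c →
      T.weightExtend φ j hf (A.mul hx b a) = V.act hxe b (T.weightExtend φ l he a) := by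
    intro j l x c y e f hx he hf hxe b a ha
    have : (A.idealGen (W.specialOver (insert lam Γ))).carrier l i c ≤ LinearMap.eqLocus
        ((T.weightExtend φ j hf).comp (A.mul hx b))
        ((V.act hxe b).comp (T.weightExtend φ l he)) := by
      refine LUGAlgebra.idealGen_le fun t ht c₁ c₂ hc a b' => ?_
      change T.weightExtend φ j hf (A.mul hx b (A.mul hc a b')) =
        V.act hxe b (T.weightExtend φ l he (A.mul hc a b'))
      obtain ⟨htS, ht | ht⟩ := ht
      · have e1 := T.weightExtend_mul φ hΓ hlam hIio ⟨t, htS, ht⟩ hc he rfl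
          (show c₁ + (c₂ + d) = e by omega) a b'
        have e2 := T.weightExtend_mul φ hΓ hlam hIio ⟨t, htS, ht⟩
          (show x + c₁ + c₂ = y by omega) hf rfl
          (show x + c₁ + (c₂ + d) = f by omega) (A.mul rfl b a) b'
        rw [A.mul_mul' hc hx, e2, e1]
        exact V.mul_act _ _ _ _ _ _ _
      · have e1 := T.weightExtend_eq_zero φ hΓ hlam l he
          (LUGAlgebra.mul_mem_idealGen (S := W.specialOver Γ) ⟨htS, ht⟩ hc a b')
        have e2 := T.weightExtend_eq_zero φ hΓ hlam j hf
          (LUGAlgebra.GIdeal.mul_mem_left _ hx b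
            (LUGAlgebra.mul_mem_idealGen (S := W.specialOver Γ) ⟨htS, ht⟩ hc a b'))
        rw [e1, e2, map_zero]
    exact this ha
  let g : U.toGMod ⟶ V.shift d := ⟨fun j c => (T.weightExtend φ j (rfl : c + d = c + d)).comp
    (U.carrier j c).subtype, fun {j l x c y} h a v => key h rfl rfl (by omega) a v.1 v.2⟩
  have hinj := injective_shift hV d
  have := mono_of_injective U.ι (GSub.ι_injective U)
  let G : free A i ⟶ V.shift d := Injective.factorThru g U.ι
  have hG : ∀ (j : I) (c : ℤ) (a : A.blk j i c)
      (_ : a ∈ (A.idealGen (W.specialOver (insert lam Γ))).carrier j i c),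
      G.app j c a = T.weightExtend φ j rfl a := fun j c a ha =>
    congr_app (Injective.comp_factorThru g U.ι) j c ⟨a, ha⟩
  let w : V.pc i (0 + d) := G.app i 0 (A.one i)
  have hw : ∀ (j : I) (c e : ℤ) (h : c + d = e) (a : A.blk j i c),
      a ∈ (A.idealGen (W.specialOver (insert lam Γ))).carrier j i c →
      V.act h a (V.recast (zero_add d) w) = T.weightExtend φ j h a := by
    intro j c e h a ha
    subst h
    rw [act_recast]
    refine (G.app_act (add_zero c) a (A.one i)).symm.trans ?_
    refine Eq.trans ?_ (hG j c a ha)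
    exact congrArg (G.app j c) (A.mul_one a)
  refine ⟨V.recast (zero_add d) w, fun s hs c e h a => ?_, fun s c e h a => ?_⟩
  · rw [hw s c e h a (LUGAlgebra.mem_idealGen_left
      (Weights.specialOver_mono (Set.subset_insert _ _) hs) a)]
    exact T.weightExtend_eq_zero φ hΓ hlam s h (LUGAlgebra.mem_idealGen_left hs a)
  · rw [hw s c e h a (LUGAlgebra.mem_idealGen_left
      (Weights.specialOver_mono (Set.singleton_subset_iff.2 (Set.mem_insert _ _)) s.2) a)]
    have e1 := T.weightExtend_mul φ hΓ hlam hIio s (zero_add c) h h (zero_add e) (A.one s) a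
    rw [A.one_mul] at e1
    exact e1.trans (V.one_act _)

end Injective

end TriangularBasis

end Lifting

/-! ### Equivalence of acyclicity and weight lifts -/

section Acyclic

/-- Induction over finite lower sets, adding one maximal element at a time. -/
lemma finite_lowerSet_induction {Λ : Type v} [PartialOrder Λ] {P : Set Λ → Prop} (h0 : P ∅)
    (hstep : ∀ (Γ : Set Λ) (lam : Λ), Γ.Finite → IsLowerSet Γ → lam ∉ Γ → Set.Iio lam ⊆ Γ → P Γ →
      P (insert lam Γ)) {Γ : Set Λ} (hfin : Γ.Finite) (hΓ : IsLowerSet Γ) : P Γ := by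
  induction hn : Γ.ncard generalizing Γ with
  | zero => rw [(Set.ncard_eq_zero hfin).1 hn]; exact h0
  | succ n ih =>
    have hne : Γ.Nonempty := by
      rw [← Set.ncard_pos hfin]
      omega
    obtain ⟨lam, hlam⟩ := hfin.exists_maximal hne
    have h1 : IsLowerSet (Γ \ {lam}) := fun a b hab ha =>
      ⟨hΓ hab ha.1, fun hb => ha.2 (le_antisymm (hlam.2 ha.1 (by rw [← show b = lam from hb]; exact hab))
        (by rw [← show b = lam from hb]; exact hab))⟩
    have h2 := hstep (Γ \ {lam}) lam (hfin.subset Set.sdiff_subset) h1 (fun h => h.2 rfl)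
      (fun x hx => ⟨hΓ (le_of_lt hx) hlam.1, fun h => (ne_of_lt hx) h⟩)
      (ih (hfin.subset Set.sdiff_subset) h1 (by
        rw [Set.ncard_sdiff_singleton_of_mem hlam.1]; omega))
    rwa [Set.insert_sdiff_singleton, Set.insert_eq_of_mem hlam.1] at h2

variable {k : Type u} [Field k] {I : Type u} {A : LUGAlgebra k I}
  {Λ : Type v} {W : Weights I Λ} [PartialOrder Λ]

namespace GMod

/-- The functor `weightPart W lam` is exact on short exact sequences starting with `V`, i.e.
`Ext¹(Δ(λ), V) = 0` for the standardization `Δ(λ)` of `A_λ`. -/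
def IsAcyclic (W : Weights I Λ) (lam : Λ) (V : GMod A) : Prop :=
  ∀ (E C : GMod A) (f : V ⟶ E) (g : E ⟶ C), (∀ i d, Function.Injective (f.app i d)) →
    (∀ i d, Function.Surjective (g.app i d)) → (∀ i d v, g.app i d v = 0 ↔ ∃ u, f.app i d u = v) →
    ∀ s d, Function.Surjective ((weightMap W lam g).app s d)

/-- `V` has weight lifts with respect to all finite lower sets. -/
def HasAllWeightLifts (W : Weights I Λ) (V : GMod A) : Prop :=
  ∀ (Γ : Set Λ) (lam : Λ), Γ.Finite → IsLowerSet Γ → lam ∉ Γ → Set.Iio lam ⊆ Γ →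
    HasWeightLifts W Γ lam V

lemma range_eq_ker (V : GMod A) {E : GMod A} (f : V ⟶ E) (i : I) (d : ℤ) (v : E.pc i d) :
    (GSub.range f).π.app i d v = 0 ↔ ∃ u, f.app i d u = v := GSub.π_eq_zero

/-- Acyclicity can be tested on one embedding into an injective module. -/
lemma isAcyclic_of_injective {lam : Λ} {V E C : GMod A} (hE : Injective E) (f : V ⟶ E) (g : E ⟶ C)
    (hf : ∀ i d, Function.Injective (f.app i d))
    (hfg : ∀ i d v, g.app i d v = 0 ↔ ∃ u, f.app i d u = v)
    (h : ∀ s d, Function.Surjective ((weightMap W lam g).app s d)) : IsAcyclic W lam V := by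
  intro E' C' f' g' hf' hg' hfg' s d c
  have := mono_of_injective f' hf'
  -- The given sequence maps to the one with injective middle term. The image of c in C lifts to the
  -- weight part of E, and a preimage of c in E' is then adjusted by an element of V so that its
  -- image in E is this lift.
  let φ := Injective.factorThru f f'
  have hφ : ∀ i d v, φ.app i d (f'.app i d v) = f.app i d v := fun i d v =>
    congr_app (Injective.comp_factorThru f f') i d v
  obtain ⟨ψ, hψ⟩ := exists_desc_of_surjective g' hg' (φ ≫ g) (by
    intro i d v hv
    obtain ⟨u, rfl⟩ := (hfg' i d v).1 hv
    exact (hfg i d _).2 ⟨u, (hφ i d u).symm⟩)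
  obtain ⟨x, hx⟩ := h s d ((weightMap W lam ψ).app s d c)
  obtain ⟨e, he⟩ := hg' s d (weightVal c)
  have hψ' : ∀ i d v, ψ.app i d (g'.app i d v) = g.app i d (φ.app i d v) := fun i d v =>
    congr_app hψ i d v
  obtain ⟨u, hu⟩ := (hfg s d (φ.app s d e - weightVal x)).1 (by
    rw [map_sub, ← hψ', he, ← weightVal_map, ← weightVal_map, hx, sub_self])
  have h1 : φ.app s d (e - f'.app s d u) = weightVal x := by
    rw [map_sub, hφ, hu, sub_sub_cancel]
  have h2 : g'.app s d (e - f'.app s d u) = weightVal c := by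
    rw [map_sub, he, (hfg' s d _).2 ⟨u, rfl⟩, sub_zero]
  -- For μ ≱ λ the element a(e − f'u) comes from V, since its image in C' vanishes. Its image in E
  -- is a applied to the weight part element x, hence zero, and V embeds in E.
  obtain ⟨w, hw⟩ := exists_weightVal (W := W) (lam := lam) (s := s) (v := e - f'.app s d u) (by
    intro t ht c' e' hc a
    obtain ⟨u', hu'⟩ := (hfg' t e' (E'.act hc a (e - f'.app s d u))).1 (by
      rw [g'.app_act, h2]
      exact weightVal_mem c t ht c' e' hc a)
    have h3 : f.app t e' u' = 0 := by
      rw [← hφ, hu', φ.app_act, h1]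
      exact weightVal_mem x t ht c' e' hc a
    have h4 : u' = 0 := hf t e' (h3.trans (map_zero _).symm)
    rw [← hu', h4, map_zero])
  refine ⟨w, weightVal_injective ?_⟩
  rw [weightVal_map, hw, h2]

/-- An extension of acyclic modules is acyclic. -/
lemma IsAcyclic.of_extension {lam : Λ} {V' V V'' : GMod A} (h' : IsAcyclic W lam V')
    (h'' : IsAcyclic W lam V'') (f : V' ⟶ V) (g : V ⟶ V'')
    (hf : ∀ i d, Function.Injective (f.app i d)) (hg : ∀ i d, Function.Surjective (g.app i d))
    (hfg : ∀ i d v, g.app i d v = 0 ↔ ∃ u, f.app i d u = v) : IsAcyclic W lam V := by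
  intro E C p q hp hq hpq s d c
  -- The lift is made in two stages, E → E/V' → C, whose kernels are V' and V''.
  let U := GSub.range (f ≫ p)
  obtain ⟨j, hj⟩ := exists_desc_of_surjective g hg (p ≫ U.π) (by
    intro i d v hv
    obtain ⟨u, rfl⟩ := (hfg i d v).1 hv
    exact GSub.π_eq_zero.2 ⟨u, rfl⟩)
  have hj' : ∀ i d v, j.app i d (g.app i d v) = U.π.app i d (p.app i d v) := fun i d v =>
    congr_app hj i d v
  have hU : ∀ i d v, v ∈ U.carrier i d → q.app i d v = 0 := by
    rintro i d _ ⟨u, rfl⟩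
    exact (hpq i d _).2 ⟨f.app i d u, rfl⟩
  let r : U.quot ⟶ C := quotDesc U q hU
  have hr : ∀ i d v, r.app i d (U.π.app i d v) = q.app i d v := fun _ _ _ => rfl
  obtain ⟨c', rfl⟩ := h'' U.quot C j r (by
      intro i d
      rw [injective_iff_map_eq_zero]
      intro v hv
      obtain ⟨v, rfl⟩ := hg i d v
      rw [hj'] at hv
      obtain ⟨u, hu⟩ := GSub.π_eq_zero.1 hv
      rw [hfg]
      exact ⟨u, hp i d hu⟩) (by
      intro i d x
      obtain ⟨y, rfl⟩ := hq i d x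
      exact ⟨U.π.app i d y, rfl⟩) (by
      intro i d v
      obtain ⟨v, rfl⟩ := U.mkQ_surjective i d v
      rw [hr, hpq]
      constructor
      · rintro ⟨u, rfl⟩
        exact ⟨g.app i d u, hj' i d u⟩
      · rintro ⟨u, hu⟩
        obtain ⟨u, rfl⟩ := hg i d u
        rw [hj'] at hu
        obtain ⟨x, hx⟩ := GSub.π_eq_zero.1 (show U.π.app i d (v - p.app i d u) = 0 by
          rw [map_sub, hu, sub_self])
        refine ⟨u + f.app i d x, ?_⟩
        rw [map_add, show p.app i d (f.app i d x) = v - p.app i d u from hx, add_sub_cancel]) s d c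
  obtain ⟨x, rfl⟩ := h' E U.quot (f ≫ p) U.π (fun i d => (hp i d).comp (hf i d))
    (fun i d => U.mkQ_surjective i d) (range_eq_ker V' (f ≫ p)) s d c'
  exact ⟨x, rfl⟩

lemma IsAcyclic.of_iso {lam : Λ} {V V' : GMod A} (h : IsAcyclic W lam V) (e : V ≅ V') :
    IsAcyclic W lam V' := by
  intro E C f g hf hg hfg
  refine h E C (e.hom ≫ f) g (fun i d => (hf i d).comp (iso_hom_bijective e i d).1) hg ?_
  intro i d v
  rw [hfg]
  constructor
  · rintro ⟨u, rfl⟩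
    exact ⟨e.inv.app i d u, by rw [comp_apply, iso_inv_hom_apply]⟩
  · rintro ⟨u, rfl⟩
    exact ⟨_, rfl⟩

/-- If e lifts an element of the weight part of C, then e_μ A e lies in V for μ < λ, where V is
zero; so every lift already lies in the weight part. The hypothesis `hle` is
`TriangularBasis.mem_upperSub_not_le`. -/
lemma isAcyclic_of_vanishing {lam : Λ} {V : GMod A}
    (hV : ∀ s ∈ W.specialOver (Set.Iio lam), ∀ d (v : V.pc s d), v = 0)
    (hle : ∀ {s : W.S} (_ : W.dot s = lam) {M : GMod A} {d : ℤ} {v : M.pc s d},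
      v ∈ (upperSub W (Set.Iio lam) M).carrier s d →
      v ∈ (upperSub W {mu | ¬ lam ≤ mu} M).carrier s d) : IsAcyclic W lam V := by
  intro E C f g hf hg hfg s d c
  obtain ⟨e, he⟩ := hg s d (weightVal c)
  obtain ⟨s, hs, rfl⟩ := Weights.exists_over s
  obtain ⟨w, rfl⟩ := exists_weightVal (W := W) (lam := lam) (s := W.over s hs) (v := e) (by
    refine hle hs fun t ht c' e' hc a => ?_
    obtain ⟨u, hu⟩ := (hfg t e' (E.act hc a e)).1 (by
      rw [g.app_act, he]
      exact weightVal_mem c t (TriangularBasis.not_le_of_mem_specialOver_Iio ht) c' e' hc a)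
    rw [← hu, hV t ht e' u, map_zero])
  exact ⟨w, weightVal_injective he⟩

end GMod

namespace TriangularBasis

open GMod

variable (T : TriangularBasis A W)

include T

/-- A consequence of `idealGen_right_le`: a vector of weight λ needs to be tested only against
weights < λ. This makes finite inductions over weights possible. -/
lemma mem_upperSub_not_le {lam : Λ} {s : W.S} (hs : W.dot s = lam) {M : GMod A} {d : ℤ}
    {v : M.pc s d} (hv : v ∈ (upperSub W (Set.Iio lam) M).carrier s d) :
    v ∈ (upperSub W {mu | ¬ lam ≤ mu} M).carrier s d := by
  intro t ht c e h a
  subst hs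
  exact act_eq_zero_of_mem_upperSub W h (T.idealGen_right_le t s c
    (LUGAlgebra.mem_idealGen_left ht a)) hv

omit T [PartialOrder Λ] in
lemma _root_.GradedTriangular.GMod.mem_upperSub_insert {lam : Λ} {Γ : Set Λ} {M : GMod A} {i : I}
    {d : ℤ} {v : M.pc i d} (h1 : v ∈ (upperSub W Γ M).carrier i d)
    (h2 : ∀ s ∈ W.specialOver {lam}, ∀ (c e : ℤ) (h : c + d = e) (a : A.blk s i c),
      M.act h a v = 0) : v ∈ (upperSub W (insert lam Γ) M).carrier i d := by
  rintro s ⟨hs, hs' | hs'⟩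
  · exact h2 s ⟨hs, hs'⟩
  · exact h1 s ⟨hs, hs'⟩

/-- A family of elements of `e_λ V` compatible with the action gives an element of
`j^λ_* (e_λ V^{≥λ})`. -/
lemma exists_costd {lam : Λ} {Γ : Set Λ} (hIio : Set.Iio lam ⊆ Γ) {V M : GMod A}
    (f : V ⟶ M) (hf : ∀ i d, Function.Injective (f.app i d)) {i : I} {d : ℤ} {w : M.pc i d}
    (hw : w ∈ (upperSub W Γ M).carrier i d)
    (H : ∀ (s : W.specialOver {lam}) (c e : ℤ) (h : c + d = e) (a : A.blk s i c),
      ∃ v, f.app s e v = M.act h a w) :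
    ∃ φ : (costandardize W lam (weightPart W lam V)).pc i d,
      ∀ (s : W.specialOver {lam}) (c e : ℤ) (h : c + d = e) (a : A.blk s i c),
        f.app s e (weightVal (costdEval φ s h a)) = M.act h a w := by
  have H' : ∀ (s : W.specialOver {lam}) (c e : ℤ) (h : c + d = e) (a : A.blk s i c),
      ∃ v : (weightPart W lam V).pc s e, f.app s e (weightVal v) = M.act h a w := by
    intro s c e h a
    obtain ⟨v, hv⟩ := H s c e h a
    obtain ⟨s, hs, rfl⟩ := Weights.exists_over s
    have hmem : f.app s e v ∈ (upperSub W (Set.Iio lam) M).carrier s e := by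
      rw [show f.app s e v = _ from hv]
      exact GSub.act_mem _ h a (upperSub_anti hIio M i d hw)
    obtain ⟨x, rfl⟩ := exists_weightVal (W := W) (lam := lam) (s := W.over s hs) (v := v)
      (mem_upperSub_of_app f hf (T.mem_upperSub_not_le hs hmem))
    exact ⟨x, hv⟩
  -- Since `f` and `weightVal` are injective, the chosen preimages are unique, and all linearity
  -- conditions can be checked in M.
  choose φ hφ using H'
  have hinj : ∀ (s : W.specialOver {lam}) (e : ℤ) (x y : (weightPart W lam V).pc s e),
      f.app s e (weightVal x) = f.app s e (weightVal y) → x = y := fun s e x y h =>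
    weightVal_injective (hf s e h)
  refine ⟨costdMk (fun p =>
    { toFun := φ p.1.1 p.1.2.1 p.1.2.2 p.2
      map_add' := fun a b => hinj _ _ _ _ ?_
      map_smul' := fun r a => hinj _ _ _ _ ?_ }) (fun p a ha => hinj _ _ _ _ ?_)
      fun s t x c y e z hx he hz hxe b a => hinj _ _ _ _ ?_, fun s c e h a => ?_⟩
  · refine (hφ _ _ _ _ _).trans (Eq.trans ?_ (congrArg₂ (· + ·) (hφ p.1.1 p.1.2.1 p.1.2.2 p.2 a)
      (hφ p.1.1 p.1.2.1 p.1.2.2 p.2 b)).symm |>.trans ?_)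
    · rw [map_add, LinearMap.add_apply]
    · rw [map_add, map_add]
  · refine (hφ _ _ _ _ _).trans (Eq.trans ?_ (congrArg (r • ·)
      (hφ p.1.1 p.1.2.1 p.1.2.2 p.2 a)).symm |>.trans ?_)
    · rw [map_smul, LinearMap.smul_apply]
    · rw [map_smul, map_smul, RingHom.id_apply]
  · refine (hφ _ _ _ _ _).trans ?_
    rw [map_zero, map_zero]
    obtain ⟨⟨⟨s, c, e⟩, h⟩, rfl⟩ : ∃ p', p = p' := ⟨p, rfl⟩
    obtain ⟨s, hs, rfl⟩ := Weights.exists_over s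
    subst hs
    exact act_eq_zero_of_mem_upperSub W h (T.idealGen_left_le s i c ha)
      (upperSub_anti hIio M i d hw)
  · refine (hφ _ _ _ _ _).trans ?_
    rw [weightVal_act, f.app_act]
    refine Eq.trans ?_ (congrArg (M.act hxe b) (hφ t c e he a).symm)
    exact M.mul_act _ _ _ _ _ _ _
  · rw [costdEval_mk]
    exact hφ s c e h a

/-- Modules with weight lifts are acyclic. -/
lemma isAcyclic_of_hasAllWeightLifts {V : GMod A} (hV : HasAllWeightLifts W V) (lam : Λ) :
    IsAcyclic W lam V := by
  intro E C f g hf hg hfg s d c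
  obtain ⟨e, he⟩ := hg s d (weightVal c)
  obtain ⟨s, hs, rfl⟩ := Weights.exists_over s
  -- The lift e is corrected one weight at a time. Once e − f u is killed by e_Γ A, its products
  -- with e_κ A lie in V, because c lies in the weight part and κ < λ. They form an element of j^κ_*
  -- V_κ, and a weight lift in V^Γ realizing it is subtracted.
  have key : ∀ {Γ : Set Λ}, Γ.Finite → IsLowerSet Γ → Γ ⊆ Set.Iio lam →
      ∃ u : V.pc s d, e - f.app s d u ∈ (upperSub W Γ E).carrier s d := by
    intro Γ hfin hΓ
    refine finite_lowerSet_induction (P := fun Γ => Γ ⊆ Set.Iio lam →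
      ∃ u : V.pc s d, e - f.app s d u ∈ (upperSub W Γ E).carrier s d) ?_ ?_ hfin hΓ
    · exact fun _ => ⟨0, fun s hs => hs.2.elim⟩
    · intro Γ κ hfin hΓ hκ hIio ih hle
      obtain ⟨u, hu⟩ := ih ((Set.subset_insert _ _).trans hle)
      obtain ⟨φ, hφ⟩ := T.exists_costd (lam := κ) hIio f hf hu (by
        intro t c' e' h a
        refine (hfg t e' _).1 ?_
        rw [g.app_act, map_sub, (hfg s d _).2 ⟨u, rfl⟩, sub_zero]
        have : g.app s d e = weightVal c := he
        rw [this]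
        exact weightVal_mem c t (not_le_of_mem_specialOver_Iio
          ⟨t.2.1, hle (by rw [t.2.2]; exact Set.mem_insert _ _)⟩) c' e' h a)
      obtain ⟨w, hw, hw'⟩ := hV Γ κ hfin hΓ hκ hIio s d φ
      refine ⟨u + w, ?_⟩
      rw [map_add, ← sub_sub]
      refine mem_upperSub_insert (Submodule.sub_mem _ hu (app_mem_upperSub f hw)) ?_
      intro t ht c' e' h a
      rw [map_sub, ← f.app_act, hw' ⟨t, ht⟩ c' e' h a]
      exact sub_eq_zero.2 (hφ ⟨t, ht⟩ c' e' h a).symm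
  obtain ⟨u, hu⟩ := key ((T.lower_finite lam).subset fun x hx => le_of_lt hx)
    (isLowerSet_Iio lam) le_rfl
  obtain ⟨w, hw⟩ := exists_weightVal (W := W) (lam := lam) (s := W.over s hs)
    (T.mem_upperSub_not_le hs hu)
  refine ⟨w, weightVal_injective ?_⟩
  rw [weightVal_map, hw, map_sub, (hfg s d _).2 ⟨u, rfl⟩, sub_zero]
  exact he

/-- As j^λ_* preserves epimorphisms, φ lifts to the weight part of V, where injectivity realizes it
by an element. -/
lemma hasWeightLifts_of_epi {V C : GMod A} (hV : Injective V) (g : V ⟶ C) {Γ : Set Λ} {lam : Λ}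
    (hΓ : IsLowerSet Γ) (hlam : lam ∉ Γ) (hIio : Set.Iio lam ⊆ Γ)
    (hg : ∀ s d, Function.Surjective ((weightMap W lam g).app s d)) {i : I} {d : ℤ}
    (φ : (costandardize W lam (weightPart W lam C)).pc i d) :
    ∃ w ∈ (upperSub W Γ V).carrier i d, ∀ (s : W.specialOver {lam}) (c e : ℤ) (h : c + d = e)
      (a : A.blk s i c), C.act h a (g.app i d w) = weightVal (costdEval φ s h a) := by
  obtain ⟨φ', hφ'⟩ := T.exists_costd_lift _ hg φ
  obtain ⟨w, hw, hw'⟩ := T.hasWeightLifts_of_injective hV hΓ hlam hIio i d φ'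
  refine ⟨w, hw, fun s c e h a => ?_⟩
  rw [← g.app_act, hw' s c e h a, ← hφ', weightVal_map]

/-- A quotient of an injective module by an acyclic module has weight lifts. -/
lemma hasAllWeightLifts_of_epi {V C : GMod A} (hV : Injective V) (g : V ⟶ C)
    (hg : ∀ lam s d, Function.Surjective ((weightMap W lam g).app s d)) :
    HasAllWeightLifts W C := by
  intro Γ lam _ hΓ hlam hIio i d φ
  obtain ⟨w, hw, hw'⟩ := T.hasWeightLifts_of_epi hV g hΓ hlam hIio (hg lam) φ
  exact ⟨g.app i d w, app_mem_upperSub g hw, hw'⟩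

/-- The idempotent 1_i factors through finitely many weights: the weight of i if i is special, and
otherwise the weights of the finitely many s with X(i,s) or Y(s,i) nonempty. Hence 1_i M^Γ = 0 for
every module M and every large enough finite lower set Γ. -/
lemma exists_one_mem_idealGen (i : I) : ∃ Γ : Set Λ, Γ.Finite ∧ IsLowerSet Γ ∧
    A.one i ∈ (A.idealGen (W.specialOver Γ)).carrier i i 0 := by
  by_cases hi : i ∈ W.S
  · exact ⟨Set.Iic (W.dot ⟨i, hi⟩), T.lower_finite _, isLowerSet_Iic _,
      LUGAlgebra.mem_idealGen_left (Weights.mem_specialOver (s := ⟨i, hi⟩) (Set.mem_Iic.2 le_rfl)) _⟩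
  · refine ⟨⋃ s ∈ {s : W.S | ∃ d, (T.X i s d).Nonempty ∨ (T.Y s i d).Nonempty}, Set.Iic (W.dot s),
      (T.finite_special i hi).biUnion fun s _ => T.lower_finite _,
      isLowerSet_iUnion₂ fun s _ => isLowerSet_Iic _, ?_⟩
    refine T.induction ?_ _
    intro s t c₁ c₂ c₃ c₁₂ h₁ h₂ x h y hx hh hy
    rw [A.mul_mul]
    refine LUGAlgebra.mul_mem_idealGen (Weights.mem_specialOver ?_) _ _ _
    have hs : s ∈ {s : W.S | ∃ d, (T.X i s d).Nonempty ∨ (T.Y s i d).Nonempty} :=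
      ⟨c₁, Or.inl ⟨x, hx⟩⟩
    exact Set.mem_biUnion hs (Set.mem_Iic.2 le_rfl)

/-- Acyclic modules have weight lifts. -/
lemma hasAllWeightLifts_of_isAcyclic {V : GMod A} (hV : ∀ lam, IsAcyclic W lam V) :
    HasAllWeightLifts W V := by
  intro Γ lam hfin hΓ hlam hIio i d φ
  let f := Injective.ι V
  let g := (GSub.range f).π
  have hf : ∀ i d, Function.Injective (f.app i d) := injective_of_mono f
  have hg : ∀ lam s d, Function.Surjective ((weightMap W lam g).app s d) := fun lam =>
    hV lam _ _ f g hf (GSub.mkQ_surjective _) (range_eq_ker V f)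
  -- At the fixed index i and degree d, the map E^Γ → C^Γ is onto, where V ⊆ E with E injective and
  -- C = E/V.
  have Q : ∀ {Γ : Set Λ}, Γ.Finite → IsLowerSet Γ →
      ∀ c ∈ (upperSub W Γ (GSub.range f).quot).carrier i d,
      ∃ w ∈ (upperSub W Γ (Injective.under V)).carrier i d, g.app i d w = c := by
    intro Γ₀ hfin₀ hΓ₀
    obtain ⟨Γ₁, hfin₁, hΓ₁, hone⟩ := T.exists_one_mem_idealGen i
    -- Surjectivity for Γ ∪ Γ₀ implies it for Γ₀. When κ is removed, the e_κ-part of c is realized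
    -- by an element of E, and the remainder of c is killed by e_κ A as well.
    have step : ∀ {Γ : Set Λ}, Γ.Finite → IsLowerSet Γ →
        (∀ c ∈ (upperSub W (Γ ∪ Γ₀) (GSub.range f).quot).carrier i d,
          ∃ w ∈ (upperSub W (Γ ∪ Γ₀) (Injective.under V)).carrier i d, g.app i d w = c) →
        ∀ c ∈ (upperSub W Γ₀ (GSub.range f).quot).carrier i d,
          ∃ w ∈ (upperSub W Γ₀ (Injective.under V)).carrier i d, g.app i d w = c := by
      intro Γ hfin hΓ
      refine finite_lowerSet_induction (P := fun Γ =>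
        (∀ c ∈ (upperSub W (Γ ∪ Γ₀) (GSub.range f).quot).carrier i d,
          ∃ w ∈ (upperSub W (Γ ∪ Γ₀) (Injective.under V)).carrier i d, g.app i d w = c) →
        ∀ c ∈ (upperSub W Γ₀ (GSub.range f).quot).carrier i d,
          ∃ w ∈ (upperSub W Γ₀ (Injective.under V)).carrier i d, g.app i d w = c) ?_ ?_ hfin hΓ
      · rw [Set.empty_union]
        exact id
      · intro Γ κ hfin hΓ hκ hIio ih H
        refine ih ?_
        by_cases hκ₀ : κ ∈ Γ₀
        · rwa [Set.insert_union, Set.insert_eq_of_mem (Set.mem_union_right _ hκ₀)] at H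
        intro c hc
        obtain ⟨φ, hφ⟩ := T.exists_costd (lam := κ) (hIio.trans Set.subset_union_left) (𝟙 _)
          (fun _ _ => Function.injective_id) hc (fun s c e h a => ⟨_, rfl⟩)
        obtain ⟨w, hw, hw'⟩ := T.hasWeightLifts_of_epi inferInstance g (hΓ.union hΓ₀)
          (fun h => h.elim hκ hκ₀) (hIio.trans Set.subset_union_left) (hg κ) φ
        obtain ⟨w₂, hw₂, hw₂'⟩ := H (c - g.app i d w) (by
          rw [Set.insert_union]
          refine mem_upperSub_insert (Submodule.sub_mem _ hc (app_mem_upperSub g hw)) ?_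
          intro t ht c' e' h a
          rw [map_sub, hw' ⟨t, ht⟩ c' e' h a]
          exact sub_eq_zero.2 (hφ ⟨t, ht⟩ c' e' h a).symm)
        refine ⟨w + w₂, Submodule.add_mem _ hw (upperSub_anti ?_ _ i d hw₂), ?_⟩
        · exact Set.union_subset_union_left _ (Set.subset_insert _ _)
        · rw [map_add, hw₂', add_sub_cancel]
    -- The starting point: 1_i passes through the weights in Γ₁, so the component at i of C^{Γ₁∪Γ₀}
    -- is zero.
    refine step hfin₁ hΓ₁ fun c hc => ⟨0, Submodule.zero_mem _, ?_⟩
    rw [map_zero, ← GMod.one_act _ c]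
    exact (act_eq_zero_of_mem_upperSub W (zero_add d)
      (LUGAlgebra.idealGen_mono (Weights.specialOver_mono Set.subset_union_left) _ _ _ hone) hc).symm
  obtain ⟨φ', hφ'⟩ : ∃ φ' : (costandardize W lam (weightPart W lam (Injective.under V))).pc i d,
      ∀ (s : W.specialOver {lam}) (c e : ℤ) (h : c + d = e) (a : A.blk s i c),
        costdEval φ' s h a = (weightMap W lam f).app s e (costdEval φ s h a) :=
    ⟨costdMk (fun p => ((weightMap W lam f).app p.1.1 p.1.2.2).comp (costdEval φ p.1.1 p.2))
      (fun p a ha => by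
        rw [LinearMap.comp_apply, costdEval_eq_zero _ _ _ ha, map_zero])
      (fun s t x c y e z hx he hz hxe b a => by
        rw [LinearMap.comp_apply, LinearMap.comp_apply, costdEval_mul φ s t hx he hz hxe]
        exact (weightMap W lam f).app_act _ _ _), fun _ _ _ _ _ => rfl⟩
  obtain ⟨w, hw, hw'⟩ := T.hasWeightLifts_of_injective inferInstance hΓ hlam hIio i d φ'
  -- The products of w with e_λ A come from V, so the image of w in C lies in C^{Γ∪{λ}} and is also
  -- the image of some w₂ ∈ E^{Γ∪{λ}}. Then w − w₂ comes from V, and e_λ A acts on it as on w.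
  obtain ⟨w₂, hw₂, hw₂'⟩ := Q (hfin.insert lam) (fun a b hab ha => by
      rcases ha with rfl | ha
      · rcases hab.lt_or_eq with h | h
        · exact Or.inr (hIio h)
        · exact Or.inl h
      · exact Or.inr (hΓ hab ha)) (g.app i d w) (by
    refine mem_upperSub_insert (app_mem_upperSub g hw) fun t ht c e h a => ?_
    rw [← g.app_act, hw' ⟨t, ht⟩ c e h a, hφ', weightVal_map]
    exact (range_eq_ker V f t e _).2 ⟨_, rfl⟩)
  obtain ⟨x, hx⟩ := (range_eq_ker V f i d (w - w₂)).1 (by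
    change g.app i d (w - w₂) = 0
    rw [map_sub, hw₂', sub_self])
  refine ⟨x, mem_upperSub_of_app f hf ?_, fun s c e h a => hf s e ?_⟩
  · rw [hx]
    exact Submodule.sub_mem _ hw (upperSub_anti (Set.subset_insert _ _) _ i d hw₂)
  · rw [f.app_act, hx, map_sub, hw' s c e h a, hφ', weightVal_map,
      hw₂ s (Weights.specialOver_mono (Set.singleton_subset_iff.2 (Set.mem_insert _ _)) s.2) c e h a,
      sub_zero]

end TriangularBasis

end Acyclic

/-! ### Ext and lifting, irreducible modules, simple submodules -/

section Modules

variable {k : Type u} [Field k] {I : Type u} {A : LUGAlgebra k I}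

namespace GMod

section Ext

variable {S : ShortComplex (GMod A)} (hS : S.ShortExact) (X : GMod A)

include hS

lemma exists_lift_of_subsingleton_ext [Subsingleton (Abelian.Ext X S.X₁ 1)] (f : X ⟶ S.X₃) :
    ∃ g : X ⟶ S.X₂, g ≫ S.g = f := by
  obtain ⟨x, hx⟩ := Abelian.Ext.covariant_sequence_exact₃ X hS (Abelian.Ext.mk₀ f) (zero_add 1)
    (Subsingleton.elim _ _)
  refine ⟨Abelian.Ext.homEquiv₀ x, (Abelian.Ext.mk₀_bijective X S.X₃).1 ?_⟩
  rw [← Abelian.Ext.mk₀_comp_mk₀, Abelian.Ext.mk₀_homEquiv₀_apply, hx]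

/-- As Ext¹(X, S.X₂) = 0, every class is the connecting image of some X → S.X₃, and this image
vanishes when the map lifts to S.X₂. -/
lemma subsingleton_ext_one [Injective S.X₂] (h : ∀ f : X ⟶ S.X₃, ∃ g : X ⟶ S.X₂, g ≫ S.g = f) :
    Subsingleton (Abelian.Ext X S.X₁ 1) := by
  refine subsingleton_of_forall_eq 0 fun x => ?_
  obtain ⟨y, rfl⟩ := Abelian.Ext.covariant_sequence_exact₁ X hS x
    (Abelian.Ext.eq_zero_of_injective _) (zero_add 1)
  obtain ⟨g, hg⟩ := h (Abelian.Ext.homEquiv₀ y)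
  rw [← Abelian.Ext.mk₀_homEquiv₀_apply y, ← hg, ← Abelian.Ext.mk₀_comp_mk₀,
    Abelian.Ext.comp_assoc_of_second_deg_zero, hS.comp_extClass, Abelian.Ext.comp_zero]

/-- Dimension shifting: the connecting map from Ext^n(X, S.X₃) is onto because Ext^{n+1}(X, S.X₂) =
0. -/
lemma subsingleton_ext_succ [Injective S.X₂] (n : ℕ) [Subsingleton (Abelian.Ext X S.X₃ n)] :
    Subsingleton (Abelian.Ext X S.X₁ (n + 1)) := by
  refine subsingleton_of_forall_eq 0 fun x => ?_
  obtain ⟨y, rfl⟩ := Abelian.Ext.covariant_sequence_exact₁ X hS x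
    (Abelian.Ext.eq_zero_of_injective _) rfl
  rw [Subsingleton.elim y 0, Abelian.Ext.zero_comp]

end Ext

variable {M N E C : GMod A}

/-- A short exact sequence that starts with an injective module splits. -/
lemma exists_section_of_injective (hN : Injective N) (f : N ⟶ E) (g : E ⟶ C)
    (hf : ∀ i d, Function.Injective (f.app i d)) (hg : ∀ i d, Function.Surjective (g.app i d))
    (hfg : ∀ i d v, g.app i d v = 0 ↔ ∃ u, f.app i d u = v) : ∃ σ : C ⟶ E, σ ≫ g = 𝟙 C := by
  have := mono_of_injective f hf
  let r := Injective.factorThru (𝟙 N) f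
  have hr : ∀ i d v, r.app i d (f.app i d v) = v := fun i d v =>
    congr_app (Injective.comp_factorThru (𝟙 N) f) i d v
  obtain ⟨σ, hσ⟩ := exists_desc_of_surjective g hg (𝟙 E - r ≫ f) (by
    intro i d v hv
    obtain ⟨u, rfl⟩ := (hfg i d v).1 hv
    change f.app i d u - f.app i d (r.app i d (f.app i d u)) = 0
    rw [hr, sub_self])
  refine ⟨σ, ?_⟩
  ext i d c
  obtain ⟨e, rfl⟩ := hg i d c
  have h1 : σ.app i d (g.app i d e) = e - f.app i d (r.app i d e) := congr_app hσ i d e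
  rw [comp_apply, h1, map_sub, (hfg i d _).2 ⟨_, rfl⟩, sub_zero]
  rfl

/-- A quotient of an injective module by an injective submodule is injective. -/
lemma injective_of_section [Injective E] {g : E ⟶ C} {σ : C ⟶ E} (h : σ ≫ g = 𝟙 C) : Injective C :=
  Retract.injective ⟨σ, g, h⟩

lemma shiftRight_surjective {n m : ℤ} (h : n + m = 0) (f : M.shift n ⟶ N) (i : I) (d : ℤ)
    (hf : Function.Surjective (f.app i (d + m))) :
    Function.Surjective ((shiftRight h f).app i d) :=
  hf.comp (M.recast_bijective (i := i) (show d = d + m + n by omega)).2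

lemma shiftLeft_shiftRight_comp {n m : ℤ} (h : n + m = 0) (f : M.shift n ⟶ C) (l : M ⟶ E.shift m)
    (g : E ⟶ C) (hl : l ≫ shiftMap g m = shiftRight h f) : shiftLeft h l ≫ g = f := by
  ext i d v
  have h1 : g.app i (d + n + m) (l.app i (d + n) v) =
      f.app i (d + n + m) (M.recast (by omega) v) := congr_app hl i (d + n) v
  refine (app_recast g (show d + n + m = d by omega) (l.app i (d + n) v)).trans ?_
  refine (congrArg (C.recast _) h1).trans ?_
  refine (app_recast f (show d + n + m = d by omega) _).symm.trans (congrArg (f.app i d) ?_)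
  exact (recast_recast (M := M) (d := d + n) (e := d + n + m + n) (f := d + n) (by omega) (by omega)
    v).trans (recast_self (M := M) rfl v)

lemma eq_zero_of_shiftRight_eq_zero {n m : ℤ} (h : n + m = 0) {f : M.shift n ⟶ C}
    (hf : shiftRight h f = 0) : f = 0 := by
  rw [← shiftLeft_shiftRight_comp h f (0 : M ⟶ C.shift m) (𝟙 C) (by
    rw [hf]
    exact zero_comp)]
  ext i d v
  exact map_zero (C.recast _)

section Irreducibles

variable {B : Type w} {L : B → GMod A} (hL : IsFullSetOfIrreducibles L)

include hL

/-- A lifting property for the irreducible modules in a full set and their shifts holds for all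
simple modules. -/
lemma IsFullSetOfIrreducibles.exists_lift (g : E ⟶ C)
    (h : ∀ b n (f : L b ⟶ C.shift n), ∃ l : L b ⟶ E.shift n, l ≫ shiftMap g n = f)
    {X : GMod A} (hX : Simple X) (f : X ⟶ C) : ∃ l : X ⟶ E, l ≫ g = f := by
  obtain ⟨b, n, ⟨e⟩⟩ := hL.exhaustive X hX
  obtain ⟨l, hl⟩ := h b (-n) (shiftRight (by omega) (e.inv ≫ f))
  refine ⟨e.hom ≫ shiftLeft (by omega) l, ?_⟩
  rw [Category.assoc, shiftLeft_shiftRight_comp _ _ l g hl, e.hom_inv_id_assoc]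

/-- A module with a simple submodule has a nonzero homomorphism from a shift of some `L(b)`. -/
lemma IsFullSetOfIrreducibles.exists_hom_ne_zero (U : GSub M) (hU : Simple U.toGMod) :
    ∃ b n, ∃ f : L b ⟶ M.shift n, f ≠ 0 := by
  obtain ⟨b, n, ⟨e⟩⟩ := hL.exhaustive _ hU
  refine ⟨b, -n, shiftRight (by omega) (e.inv ≫ U.ι), fun h => ?_⟩
  have h1 := eq_zero_of_shiftRight_eq_zero _ h
  rw [Iso.inv_comp_eq, comp_zero] at h1
  obtain ⟨i, d, v, hv⟩ := exists_ne_zero_of_simple U.toGMod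
  exact hv (U.ι_injective i d ((congr_app h1 i d v).trans (map_zero _).symm))

/-- Every nonzero module has a nonzero homomorphism from a shift of some `P(b)`. -/
lemma IsFullSetOfIrreducibles.exists_projective_hom_ne_zero {P : B → GMod A}
    {p : ∀ b, P b ⟶ L b} (hp : ∀ b, IsProjectiveCover (p b)) {i : I} {d : ℤ} {v : M.pc i d}
    (hv : v ≠ 0) : ∃ b n, ∃ f : P b ⟶ M.shift n, f ≠ 0 := by
  -- The cyclic module A v has a simple quotient, a shift of some L(b). The projective P(b) maps
  -- onto it, and this map lifts to A v ⊆ M.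
  obtain ⟨U, hU⟩ := exists_simple_quotient (M := (GSub.gen v).toGMod)
    (v := ⟨v, GSub.self_mem_gen v⟩) (fun h => hv (congrArg Subtype.val h)) (by
      rintro j e ⟨w, hw⟩
      obtain ⟨c, h, a, rfl⟩ := GSub.mem_gen.1 hw
      exact GSub.mem_gen.2 ⟨c, h, a, rfl⟩)
  obtain ⟨b, n, ⟨e⟩⟩ := hL.exhaustive _ hU
  have := (hp b).projective
  have := (hp b).epi
  have hepi : Epi (shiftMap U.π (-n)) := epi_of_surjective _ fun i d => U.mkQ_surjective i _
  let q : P b ⟶ U.quot.shift (-n) := p b ≫ shiftRight (by omega) e.inv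
  have hq : ∀ i d, Function.Surjective (q.app i d) := fun i d =>
    (shiftRight_surjective (by omega) e.inv i d (iso_hom_bijective e.symm i _).2).comp
      (surjective_of_epi (p b) i d)
  let l := Projective.factorThru q (shiftMap U.π (-n))
  refine ⟨b, -n, l ≫ shiftMap (GSub.gen v).ι (-n), fun h => ?_⟩
  obtain ⟨j, x, y, hy⟩ := exists_ne_zero_of_simple U.quot
  obtain ⟨x, rfl⟩ : ∃ x', x = x' + -n := ⟨x + n, by omega⟩
  obtain ⟨z, rfl⟩ := hq j x y
  apply hy
  have h1 : q.app j x z = U.π.app j (x + -n) (l.app j x z) :=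
    (congr_app (Projective.factorThru_comp q (shiftMap U.π (-n))) j x z).symm
  have h2 : l.app j x z = 0 := (GSub.gen v).ι_injective _ _
    ((congr_app h j x z).trans (map_zero _).symm)
  exact h1.trans ((congrArg (U.π.app j (x + -n)) h2).trans (LinearMap.map_zero _))

/-- A homomorphism through which all homomorphisms from the `P(b)` factor is surjective. -/
lemma IsFullSetOfIrreducibles.surjective_of_lifts {P : B → GMod A} {p : ∀ b, P b ⟶ L b}
    (hp : ∀ b, IsProjectiveCover (p b)) (g : E ⟶ C)
    (h : ∀ b n (f : P b ⟶ C.shift n), ∃ l : P b ⟶ E.shift n, l ≫ shiftMap g n = f) (i : I) (d : ℤ) :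
    Function.Surjective (g.app i d) := by
  intro c
  by_contra hc
  -- A nonzero cokernel receives a nonzero map from some P(b). By projectivity this map lifts to C,
  -- then by hypothesis to E, and so it is zero in the cokernel.
  have hc' : (GSub.range g).π.app i d c ≠ 0 := fun h => hc (GSub.π_eq_zero.1 h)
  obtain ⟨b, n, f, hf⟩ := hL.exists_projective_hom_ne_zero hp hc'
  have := (hp b).projective
  have : Epi (shiftMap (GSub.range g).π n) :=
    epi_of_surjective _ fun i d => (GSub.range g).mkQ_surjective i _
  obtain ⟨l, hl⟩ := h b n (Projective.factorThru f (shiftMap (GSub.range g).π n))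
  have hz : shiftMap g n ≫ shiftMap (GSub.range g).π n = 0 := by
    ext i d v
    exact congr_app (range_condition g) i (d + n) v
  apply hf
  rw [← Projective.factorThru_comp f (shiftMap (GSub.range g).π n), ← hl, Category.assoc, hz,
    comp_zero]

end Irreducibles

/-- If x maps to a nonzero element of the simple module L, then A x → P → L is onto, and superfluity
of the kernel gives A x = P. -/
lemma IsProjectiveCover.exists_generator {P L : GMod A} {p : P ⟶ L} (hp : IsProjectiveCover p)
    [Simple L] : ∃ (i : I) (d : ℤ) (x : P.pc i d), GSub.gen x = ⊤ := by
  have := hp.epi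
  obtain ⟨i, d, y, hy⟩ := exists_ne_zero_of_simple L
  obtain ⟨x, rfl⟩ := surjective_of_epi p i d y
  refine ⟨i, d, x, ?_⟩
  have h1 : Epi ((GSub.gen x).ι ≫ p) := epi_of_surjective _ fun j e z => by
    obtain ⟨c, h, a, rfl⟩ := GSub.mem_gen.1 (mem_gen_of_simple hy z)
    exact ⟨⟨P.act h a x, GSub.mem_gen.2 ⟨c, h, a, rfl⟩⟩, p.app_act h a x⟩
  have := hp.superfluous _ _ h1
  rw [GSub.eq_top_iff']
  intro j e z
  obtain ⟨u, rfl⟩ := surjective_of_epi (GSub.gen x).ι j e z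
  exact u.2

lemma exists_generator_of_simple [Simple M] : ∃ (i : I) (d : ℤ) (x : M.pc i d), GSub.gen x = ⊤ := by
  obtain ⟨i, d, y, hy⟩ := exists_ne_zero_of_simple M
  exact ⟨i, d, y, GSub.eq_top_iff'.2 fun j e z => mem_gen_of_simple hy z⟩

lemma eval_injective_of_gen_eq_top {i : I} {d : ℤ} {x : M.pc i d} (hx : GSub.gen x = ⊤)
    (N : GMod A) : Function.Injective (fun f : M ⟶ N => f.app i d x) := by
  intro f g h
  ext j e v
  obtain ⟨c, hc, a, rfl⟩ := GSub.mem_gen.1 (GSub.eq_top_iff'.1 hx j e v)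
  rw [f.app_act, g.app_act]
  exact congrArg _ h

section SimpleSubmodules

lemma _root_.GradedTriangular.LUGAlgebra.BoundedBelow.exists_uniform [Finite I]
    (hA : A.BoundedBelow) : ∃ K : ℤ, ∀ i j d, d < K → Subsingleton (A.blk i j d) := by
  choose K hK using hA
  have : Nonempty I ∨ IsEmpty I := (isEmpty_or_nonempty I).symm
  rcases this with h | h
  · obtain ⟨m, hm⟩ := Finite.exists_min (fun p : I × I => K p.1 p.2)
    exact ⟨K m.1 m.2, fun i j d hd => hK i j d (hd.trans_le (hm (i, j)))⟩
  · exact ⟨0, fun i => (h.false i).elim⟩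

lemma BoundedAbove.exists_uniform [Finite I] (hM : M.BoundedAbove) :
    ∃ K : ℤ, ∀ i d, d > K → Subsingleton (M.pc i d) := by
  choose K hK using hM
  have : Nonempty I ∨ IsEmpty I := (isEmpty_or_nonempty I).symm
  rcases this with h | h
  · obtain ⟨m, hm⟩ := Finite.exists_max K
    exact ⟨K m, fun i d hd => hK i d ((hm i).trans_lt hd)⟩
  · exact ⟨0, fun i => (h.false i).elim⟩

/-- The image in `M` of a submodule of a submodule. -/
def _root_.GradedTriangular.GSub.mapι {U : GSub M} (U' : GSub U.toGMod) : GSub M where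
  carrier i d := (U'.carrier i d).map (U.carrier i d).subtype
  act_mem := by
    rintro i j d e f h a _ ⟨v, hv, rfl⟩
    exact ⟨U.toGMod.act h a v, U'.act_mem h a hv, rfl⟩

/-- A nonzero bounded above module over a locally finite-dimensional, bounded below algebra with
finitely many distinguished idempotents has a simple submodule. -/
lemma exists_simple_submodule [Finite I] (hA : A.LocallyFiniteDimensional) (hA' : A.BoundedBelow)
    (hM : M.BoundedAbove) {i : I} {d : ℤ} {v : M.pc i d} (hv : v ≠ 0) :
    ∃ U : GSub M, Simple U.toGMod := by
  have := Fintype.ofFinite I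
  obtain ⟨K, hK⟩ := hA'.exists_uniform
  obtain ⟨K', hK'⟩ := hM.exists_uniform
  have hfd : ∀ j e, Module.Finite k ((GSub.gen v).carrier j e) := fun j e =>
    have := hA j i (e - d)
    Module.Finite.range _
  have hzero : ∀ j e, e ∉ Finset.Icc (K + d) K' → ∀ x ∈ (GSub.gen v).carrier j e, x = 0 := by
    intro j e he x hx
    by_cases h1 : e > K'
    · have := hK' j e h1
      exact Subsingleton.elim _ _
    · obtain ⟨c, h, a, rfl⟩ := GSub.mem_gen.1 hx
      have := hK j i c (by rw [Finset.mem_Icc] at he; omega)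
      rw [Subsingleton.elim a 0]
      exact LinearMap.map_zero₂ (M.act h) v
  -- The cyclic module A v lives in degrees between K + d and K', so its total dimension is finite.
  -- A nonzero submodule of A v of least dimension is simple.
  let dim : GSub M → ℕ := fun U => ∑ j : I, ∑ e ∈ Finset.Icc (K + d) K',
    Module.finrank k (U.carrier j e)
  obtain ⟨U, ⟨hU, hne⟩, hmin⟩ := (measure dim).wf.has_min
    {U : GSub M | U ≤ GSub.gen v ∧ U ≠ ⊥} ⟨GSub.gen v, le_rfl, fun h => hv
      (GSub.eq_bot_iff'.1 h i d v (GSub.self_mem_gen v))⟩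
  refine ⟨U, simple_of_gsub ?_ fun U' => ?_⟩
  · by_contra! h
    refine hne (GSub.eq_bot_iff'.2 fun j e x hx => ?_)
    exact congrArg Subtype.val (h j e ⟨x, hx⟩)
  · by_cases h : GSub.mapι U' = ⊥
    · left
      refine GSub.eq_bot_iff'.2 fun j e x hx => Subtype.ext ?_
      exact GSub.eq_bot_iff'.1 h j e _ ⟨x, hx, rfl⟩
    · right
      have hle : GSub.mapι U' ≤ U := by
        rintro j e _ ⟨x, -, rfl⟩
        exact x.2
      have hmin' : dim U ≤ dim (GSub.mapι U') := not_lt.1 (hmin _ ⟨hle.trans hU, h⟩)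
      have hfd' : ∀ j e, Module.Finite k (U.carrier j e) := fun j e =>
        have := hfd j e
        Submodule.finiteDimensional_of_le (hU j e)
      have hle' : ∀ j e, Module.finrank k ((GSub.mapι U').carrier j e) ≤
          Module.finrank k (U.carrier j e) := fun j e =>
        have := hfd' j e
        Submodule.finrank_mono (hle j e)
      have heq : ∀ j, ∀ e ∈ Finset.Icc (K + d) K', Module.finrank k ((GSub.mapι U').carrier j e) =
          Module.finrank k (U.carrier j e) := by
        have h1 := (Finset.sum_eq_sum_iff_of_le fun j _ => Finset.sum_le_sum fun e _ => hle' j e).1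
          (le_antisymm (Finset.sum_le_sum fun j _ => Finset.sum_le_sum fun e _ => hle' j e) hmin')
        intro j e he
        exact (Finset.sum_eq_sum_iff_of_le fun e _ => hle' j e).1 (h1 j (Finset.mem_univ j)) e he
      rw [GSub.eq_top_iff']
      rintro j e ⟨x, hx⟩
      by_cases he : e ∈ Finset.Icc (K + d) K'
      · have := hfd' j e
        have h2 := Submodule.eq_of_le_of_finrank_eq (hle j e) (heq j e he)
        rw [← h2] at hx
        obtain ⟨y, hy, rfl⟩ := hx
        exact hy
      · have h0 : (⟨x, hx⟩ : U.toGMod.pc j e) = 0 := Subtype.ext (hzero j e he x (hU j e hx))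
        rw [h0]
        exact Submodule.zero_mem _

/-- A bounded above module `N` is injective if `Ext¹(X, N) = 0` for all simple modules `X`. -/
lemma injective_of_simple_lifts [Finite I] (hA : A.LocallyFiniteDimensional) (hA' : A.BoundedBelow)
    (hN : N.BoundedAbove) (hE : Injective E) (f : N ⟶ E)
    (hf : ∀ i d, Function.Injective (f.app i d))
    (h : ∀ X : GMod A, Simple X → ∀ g : X ⟶ (GSub.range f).quot, ∃ l, l ≫ (GSub.range f).π = g) :
    Injective N := by
  -- E/G is an essential extension of N. The aim is N = E/G, which makes N a retract of E.
  obtain ⟨G, hG, hess⟩ := exists_essential_quotient f hf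
  obtain ⟨K, hK⟩ := hA'.exists_uniform
  obtain ⟨K', hK'⟩ := hN.exists_uniform
  let j := f ≫ G.π
  -- If v has degree > K' − K, then A v lives in degrees > K', where N is zero. So A v meets N in 0,
  -- and v = 0 by essentiality.
  have hbdd : G.quot.BoundedAbove := fun i => by
    refine ⟨K' - K, fun d hd => subsingleton_of_forall_eq 0 fun v => ?_⟩
    have h1 := hess (GSub.gen v) (by
      intro i' e w hw
      obtain ⟨c, h, a, ha⟩ := GSub.mem_gen.1 hw
      by_cases hc : c < K
      · have := hK i' i c hc
        rw [Subsingleton.elim a 0] at ha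
        exact hG i' e (ha.symm.trans ((LinearMap.map_zero₂ (G.quot.act h) v).trans
          (map_zero _).symm))
      · have := hK' i' e (by omega)
        exact Subsingleton.elim _ _)
    exact GSub.eq_bot_iff'.1 h1 i d v (GSub.self_mem_gen v)
  -- Otherwise the cokernel of N → E/G, being bounded above, contains a simple U. The inclusion of U
  -- lifts to E/G, with image meeting N in 0, against essentiality.
  have hsurj : ∀ i d, Function.Surjective (j.app i d) := by
    intro i d v
    by_contra hv
    have hv' : (GSub.range j).π.app i d v ≠ 0 := fun h => hv (GSub.π_eq_zero.1 h)
    obtain ⟨U, hU⟩ := exists_simple_submodule hA hA' (hbdd.of_surjective (GSub.range j).π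
      (GSub.mkQ_surjective _)) hv'
    have hS : (ShortComplex.mk f (GSub.range f).π (by
        ext i d v; exact GSub.π_eq_zero.2 ⟨v, rfl⟩)).ShortExact :=
      shortExact_of_pointwise hf (GSub.mkQ_surjective _) fun i d v => GSub.π_eq_zero.1
    have hS' : (ShortComplex.mk j (GSub.range j).π (by
        ext i d v; exact GSub.π_eq_zero.2 ⟨v, rfl⟩)).ShortExact :=
      shortExact_of_pointwise hG (GSub.mkQ_surjective _) fun i d v => GSub.π_eq_zero.1
    -- The lifting hypothesis concerns the sequence through E; passing through Ext¹(U, N) = 0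
    -- transfers it to the sequence through E/G.
    have := subsingleton_ext_one hS U.toGMod (h _ hU)
    obtain ⟨l, hl⟩ := exists_lift_of_subsingleton_ext hS' U.toGMod U.ι
    have hl' : ∀ i d v, (GSub.range j).π.app i d (l.app i d v) = U.ι.app i d v := fun i d v =>
      congr_app hl i d v
    have h1 := hess (GSub.range l) (by
      rintro i' e w ⟨x, hx⟩
      have h2 : U.ι.app i' e x = 0 := by
        rw [← hl', hx]
        exact GSub.π_eq_zero.2 ⟨w, rfl⟩
      have h3 : x = 0 := U.ι_injective i' e (h2.trans (map_zero _).symm)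
      rw [h3, map_zero] at hx
      exact hG i' e (hx.symm.trans (map_zero _).symm))
    obtain ⟨i', e, x, hx⟩ := exists_ne_zero_of_simple U.toGMod
    apply hx
    apply U.ι_injective i' e
    rw [← hl', GSub.eq_bot_iff'.1 h1 i' e _ ⟨x, rfl⟩, map_zero, map_zero]
  have hiso := isIso_of_bijective j fun i d => ⟨hG i d, hsurj i d⟩
  exact injective_of_section (g := G.π ≫ inv j) (σ := f) (by
    rw [← Category.assoc]; exact IsIso.hom_inv_id j)

end SimpleSubmodules

end GMod

end Modules

/-! ### From vanishing of Ext¹ to acyclicity and on to higher Ext -/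

section ExtVanishing

variable {k : Type u} [Field k] {I : Type u} {A : LUGAlgebra k I}
  {Λ : Type v} {W : Weights I Λ} [PartialOrder Λ]

namespace GMod

/-- The short exact sequence given by an embedding into an injective module. -/
noncomputable abbrev injSeq (V : GMod A) : ShortComplex (GMod A) :=
  ShortComplex.mk (Injective.ι V) (GSub.range (Injective.ι V)).π (range_condition _)

lemma injSeq_injective (V : GMod A) (i : I) (d : ℤ) : Function.Injective ((injSeq V).f.app i d) :=
  injective_of_mono (Injective.ι V) i d

lemma injSeq_surjective (V : GMod A) (i : I) (d : ℤ) :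
    Function.Surjective ((injSeq V).g.app i d) := GSub.mkQ_surjective _ i d

lemma injSeq_exact (V : GMod A) (i : I) (d : ℤ) (v : (injSeq V).X₂.pc i d) :
    (injSeq V).g.app i d v = 0 ↔ ∃ u, (injSeq V).f.app i d u = v := range_eq_ker V _ i d v

lemma injSeq_shortExact (V : GMod A) : (injSeq V).ShortExact :=
  shortExact_of_pointwise (injSeq_injective V) (injSeq_surjective V)
    fun i d v => (injSeq_exact V i d v).1

lemma weightMap_injSeq_exact (lam : Λ) (V : GMod A) (s : W.specialOver {lam}) (d : ℤ)
    (v : (weightPart W lam (injSeq V).X₂).pc s d) :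
    (weightMap W lam (injSeq V).g).app s d v = 0 ↔
      ∃ u, (weightMap W lam (injSeq V).f).app s d u = v := by
  refine ⟨weightMap_exact _ _ (injSeq_injective V) fun i d v => (injSeq_exact V i d v).1, ?_⟩
  rintro ⟨u, rfl⟩
  exact weightVal_injective ((injSeq_exact V s d _).2 ⟨weightVal u, rfl⟩)

lemma IsAcyclic.surjective {lam : Λ} {V : GMod A} (hV : IsAcyclic W lam V)
    (s : W.specialOver {lam}) (d : ℤ) :
    Function.Surjective ((weightMap W lam (injSeq V).g).app s d) :=
  hV _ _ _ _ (injSeq_injective V) (injSeq_surjective V) (injSeq_exact V) s d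

lemma IsAcyclic.exists_section {lam : Λ} {V : GMod A} (hV : IsAcyclic W lam V)
    (hinj : Injective (weightPart W lam V)) :
    ∃ σ, σ ≫ weightMap W lam (injSeq V).g = 𝟙 _ :=
  exists_section_of_injective hinj _ _ (weightMap_injective _ (injSeq_injective V)) hV.surjective
    (weightMap_injSeq_exact lam V)

lemma isAcyclic_of_surjective {lam : Λ} {V : GMod A}
    (h : ∀ s d, Function.Surjective ((weightMap W lam (injSeq V).g).app s d)) :
    IsAcyclic W lam V :=
  isAcyclic_of_injective inferInstance _ _ (injSeq_injective V) (injSeq_exact V) h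

lemma weightShiftHom_natural {lam : Λ} {M N : GMod A} (f : M ⟶ N) (n : ℤ) :
    weightShiftHom lam M n ≫ shiftMap (weightMap W lam f) n =
      weightMap W lam (shiftMap f n) ≫ weightShiftHom lam N n := rfl

/-- The identification of `weightPart` of a shift with the shift of `weightPart`. -/
noncomputable def weightShiftIso (lam : Λ) (M : GMod A) (n : ℤ) :
    weightPart W lam (M.shift n) ≅ (weightPart W lam M).shift n :=
  isoOfBijective (weightShiftHom lam M n) (weightShiftHom_bijective lam M n)

lemma IsAcyclic.shift {lam : Λ} {V : GMod A} (hV : IsAcyclic W lam V) (n : ℤ) :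
    IsAcyclic W lam (V.shift n) := by
  refine isAcyclic_of_injective (injective_shift (inferInstance : Injective (injSeq V).X₂) n)
    (shiftMap (injSeq V).f n) (shiftMap (injSeq V).g n) (fun i d => injSeq_injective V i _)
    (fun i d => injSeq_exact V i _) ?_
  intro s d c
  obtain ⟨x, hx⟩ := hV.surjective s (d + n) ((weightShiftHom lam _ n).app s d c)
  obtain ⟨y, rfl⟩ := (weightShiftHom_bijective lam (injSeq V).X₂ n s d).2 x
  exact ⟨y, (weightShiftHom_bijective lam (injSeq V).X₃ n s d).1 hx⟩

lemma injective_weightPart_shift {lam : Λ} {V : GMod A} (hV : Injective (weightPart W lam V))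
    (n : ℤ) : Injective (weightPart W lam (V.shift n)) :=
  Injective.of_iso (weightShiftIso lam V n).symm (injective_shift hV n)

/-- Under the adjunction, f becomes a homomorphism from j^λ_! M to the shifted cokernel of V in its
injective hull sequence `injSeq`; it lifts to the injective term because Ext¹ vanishes. -/
lemma exists_weight_lift {lam : Λ} {M : GMod (A.cartan W lam)} {V : GMod A} {n : ℤ}
    [Subsingleton (Abelian.Ext (standardize W lam M) (V.shift n) 1)]
    (f : M ⟶ (weightPart W lam (injSeq V).X₃).shift n) :
    ∃ l : M ⟶ (weightPart W lam (injSeq V).X₂).shift n,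
      l ≫ shiftMap (weightMap W lam (injSeq V).g) n = f := by
  have hS : (ShortComplex.mk (shiftMap (injSeq V).f n) (shiftMap (injSeq V).g n) (by
      ext i d v
      exact (injSeq_exact V i (d + n) _).2 ⟨v, rfl⟩)).ShortExact :=
    shortExact_of_pointwise (fun i d => injSeq_injective V i _) (fun i d => injSeq_surjective V i _)
      fun i d v => (injSeq_exact V i _ v).1
  obtain ⟨l, hl⟩ := exists_lift_of_subsingleton_ext hS (standardize W lam M)
    (stdHomEquiv.symm (f ≫ (weightShiftIso lam _ n).inv))
  refine ⟨stdHomEquiv l ≫ weightShiftHom lam _ n, ?_⟩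
  have h1 : stdHomEquiv l ≫ weightMap W lam (shiftMap (injSeq V).g n) =
      f ≫ (weightShiftIso lam _ n).inv := by
    rw [← stdHomEquiv_comp]
    exact (congrArg stdHomEquiv hl).trans (LinearEquiv.apply_symm_apply _ _)
  rw [Category.assoc, weightShiftHom_natural, ← Category.assoc, h1, Category.assoc]
  exact (congrArg (f ≫ ·) (weightShiftIso lam _ n).inv_hom_id).trans (Category.comp_id f)

section Projectives

variable {lam : Λ} {B : Type w} {L P : B → GMod (A.cartan W lam)} {p : ∀ b, P b ⟶ L b}
  (hL : IsFullSetOfIrreducibles L) {V : GMod A}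

include hL

/-- The modules P(b) detect surjectivity, and lifts from them are what `exists_weight_lift`
provides. -/
lemma isAcyclic_of_extVanishes_projective (hp : ∀ b, IsProjectiveCover (p b))
    (h : ∀ b, ExtVanishes 1 (standardize W lam (P b)) V) : IsAcyclic W lam V := by
  refine isAcyclic_of_surjective (hL.surjective_of_lifts hp _ fun b n f => ?_)
  have := h b n
  exact exists_weight_lift f

omit hL in
lemma finite_specialOver (T : TriangularBasis A W) (lam : Λ) : Finite (W.specialOver {lam}) := by
  have h := T.fiber_finite lam
  have : Finite {s : W.S | W.dot s = lam} := h
  exact Finite.of_injective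
    (fun s : W.specialOver {lam} => (⟨⟨s, s.2.1⟩, s.2.2⟩ : {s : W.S | W.dot s = lam}))
    fun s t h => Subtype.ext (congrArg (fun z => ((z.1 : W.S) : I)) h)

omit hL in
lemma cartan_locallyFiniteDimensional (hA : A.LocallyFiniteDimensional) :
    (A.cartan W lam).LocallyFiniteDimensional := fun s t d =>
  have := hA s t d
  Module.Finite.of_surjective (cartanMk W lam (s := s) (t := t) (d := d)) (cartanMk_surjective W lam)

omit hL in
lemma cartan_boundedBelow (hA : A.BoundedBelow) : (A.cartan W lam).BoundedBelow := fun s t => by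
  obtain ⟨N, hN⟩ := hA s t
  exact ⟨N, fun d hd => have := hN d hd
    (cartanMk_surjective W lam (s := s) (t := t) (d := d)).subsingleton⟩

omit hL in
lemma LocallyFiniteDimensional.weightPart (hV : V.LocallyFiniteDimensional) :
    (weightPart W lam V).LocallyFiniteDimensional := fun s d =>
  have := hV s d
  Module.Finite.of_injective (weightVal (W := W) (lam := lam)) weightVal_injective

omit hL in
lemma BoundedAbove.weightPart (hV : V.BoundedAbove) : (weightPart W lam V).BoundedAbove :=
  fun s => by
    obtain ⟨N, hN⟩ := hV s
    exact ⟨N, fun d hd => have := hN d hd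
      (weightVal_injective (W := W) (lam := lam) (M := V) (s := s) (d := d)).subsingleton⟩

omit hL in
-- Let e lift a weight part element of large degree. For the finitely many t of weight < λ, the
-- vectors a e with a ∈ 1_t A 1_s come from V and either a = 0 or their degree is so large that 1_t
-- V is zero. So e lies in the weight part, and the cokernel on weight parts is bounded above.
lemma exists_bound_of_mem_range (T : TriangularBasis A W) (hA' : A.BoundedBelow)
    (hV' : V.BoundedAbove) (s : W.specialOver {lam}) :
    ∃ N : ℤ, ∀ d > N, Function.Surjective ((weightMap W lam (injSeq V).g).app s d) := by
  obtain ⟨s, hs, rfl⟩ := Weights.exists_over s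
  have hfin : {t : W.S | W.dot t ∈ Set.Iio lam}.Finite :=
    ((T.lower_finite lam).subset fun x hx => le_of_lt hx).preimage' fun b _ => T.fiber_finite b
  choose K hK using fun t : W.S => hA' t s
  choose K' hK' using fun t : W.S => hV' t
  obtain ⟨N, hN⟩ := (hfin.image fun t => K' t - K t).bddAbove
  refine ⟨N, fun d hd c => ?_⟩
  obtain ⟨e, he⟩ := injSeq_surjective V s d (weightVal c)
  obtain ⟨w, rfl⟩ := exists_weightVal (W := W) (lam := lam) (s := W.over s hs) (v := e) (by
    refine T.mem_upperSub_not_le hs fun t ht c' e' hc a => ?_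
    obtain ⟨u, hu⟩ := (injSeq_exact V t e' (GMod.act _ hc a e)).1 (by
      rw [(injSeq V).g.app_act, he]
      exact weightVal_mem c t (TriangularBasis.not_le_of_mem_specialOver_Iio ht) c' e' hc a)
    have h1 : K' ⟨t, ht.1⟩ - K ⟨t, ht.1⟩ ≤ N := hN ⟨⟨t, ht.1⟩, ht.2, rfl⟩
    by_cases h2 : c' < K ⟨t, ht.1⟩
    · have := hK ⟨t, ht.1⟩ c' h2
      rw [Subsingleton.elim a 0]
      exact LinearMap.map_zero₂ (GMod.act _ hc) e
    · have := hK' ⟨t, ht.1⟩ e' (by omega)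
      rw [← hu, Subsingleton.elim u 0, map_zero])
  exact ⟨w, weightVal_injective he⟩

/-- The hypothesis only gives lifts from simple modules. It suffices because a nonzero bounded above
A_λ-module has a simple submodule. For injectivity this is applied to the cokernel of V_λ in an
essential extension, and for acyclicity to the cokernel of E_λ → C_λ. -/
lemma injective_weightPart_of_extVanishes (T : TriangularBasis A W)
    (hA : A.LocallyFiniteDimensional) (hA' : A.BoundedBelow) (hV' : V.BoundedAbove)
    (h : ∀ b, ExtVanishes 1 (standardize W lam (L b)) V) :
    Injective (weightPart W lam V) ∧ IsAcyclic W lam V := by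
  have := finite_specialOver T lam
  let ι := weightMap W lam (injSeq V).f
  let g := weightMap W lam (injSeq V).g
  have hι : ∀ s d, Function.Injective (ι.app s d) := weightMap_injective _ (injSeq_injective V)
  have hιg : ∀ s d v, g.app s d v = 0 ↔ ∃ u, ι.app s d u = v := weightMap_injSeq_exact lam V
  have hlift : ∀ X : GMod (A.cartan W lam), Simple X → ∀ f : X ⟶ weightPart W lam (injSeq V).X₃,
      ∃ l, l ≫ g = f := fun X hX f =>
    hL.exists_lift g (fun b n f => have := h b n; exists_weight_lift f) hX f
  have hE : Injective (weightPart W lam (injSeq V).X₂) := T.injective_weightPart lam inferInstance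
  have hinj : Injective (weightPart W lam V) := by
    refine injective_of_simple_lifts (cartan_locallyFiniteDimensional hA) (cartan_boundedBelow hA')
      hV'.weightPart hE ι hι fun X hX f => ?_
    -- By left exactness E_λ/V_λ embeds into C_λ, so a lift of a map to C_λ also lifts the given map
    -- to E_λ/V_λ.
    let κ : (GSub.range ι).quot ⟶ weightPart W lam (injSeq V).X₃ :=
      quotDesc _ g fun s d v hv => (hιg s d v).2 hv
    obtain ⟨l, hl⟩ := hlift X hX (f ≫ κ)
    refine ⟨l, ?_⟩
    have : Mono κ := mono_of_injective κ fun s d => by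
      rw [injective_iff_map_eq_zero]
      intro v hv
      obtain ⟨v, rfl⟩ := GSub.mkQ_surjective _ s d v
      exact GSub.π_eq_zero.2 ((hιg s d v).1 hv)
    rw [← cancel_mono κ, ← hl]
    rfl
  refine ⟨hinj, isAcyclic_of_surjective fun s d c => ?_⟩
  -- The range of g will be seen to be injective, so its cokernel embeds into C_λ by a section σ. A
  -- simple submodule U of the cokernel then maps to C_λ, this map lifts through g, and so U is zero
  -- in the cokernel.
  by_contra hc
  have hc' : (GSub.range g).π.app s d c ≠ 0 := fun h => hc (GSub.π_eq_zero.1 h)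
  have hbdd : (GSub.range g).quot.BoundedAbove := fun s => by
    obtain ⟨N, hN⟩ := exists_bound_of_mem_range (lam := lam) T hA' hV' s
    refine ⟨N, fun d hd => subsingleton_of_forall_eq 0 fun v => ?_⟩
    obtain ⟨v, rfl⟩ := GSub.mkQ_surjective _ s d v
    exact GSub.π_eq_zero.2 (hN d hd v)
  obtain ⟨U, hU⟩ := exists_simple_submodule (cartan_locallyFiniteDimensional hA)
    (cartan_boundedBelow hA') hbdd hc'
  -- The range is the quotient of the injective module E_λ by the injective module V_λ.
  have hrange : Injective (GSub.range g).toGMod := by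
    let g' : weightPart W lam (injSeq V).X₂ ⟶ (GSub.range g).toGMod :=
      ⟨fun s d => (g.app s d).rangeRestrict, fun h a v => Subtype.ext (g.app_act h a v)⟩
    obtain ⟨σ, hσ⟩ := exists_section_of_injective hinj ι g' hι
      (fun s d => LinearMap.surjective_rangeRestrict _) (fun s d v => by
        rw [← hιg]
        exact ⟨fun h => congrArg Subtype.val h, fun h => Subtype.ext h⟩)
    exact injective_of_section hσ
  obtain ⟨σ, hσ⟩ := exists_section_of_injective hrange (GSub.range g).ι (GSub.range g).π
    (GSub.ι_injective _) (GSub.mkQ_surjective _) (fun s d v => by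
      rw [GSub.π_eq_zero]
      exact ⟨fun h => ⟨⟨v, h⟩, rfl⟩, by rintro ⟨u, rfl⟩; exact u.2⟩)
  obtain ⟨l, hl⟩ := hlift _ hU (U.ι ≫ σ)
  obtain ⟨t, e, x, hx⟩ := exists_ne_zero_of_simple U.toGMod
  apply hx
  apply U.ι_injective t e
  have h1 : U.ι = (l ≫ g) ≫ (GSub.range g).π := by
    rw [hl, Category.assoc, hσ, Category.comp_id]
  rw [h1, map_zero]
  exact GSub.π_eq_zero.2 ⟨_, rfl⟩

end Projectives

end GMod

namespace TriangularBasis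

open GMod

variable (T : TriangularBasis A W)

include T

/-- Higher extensions from standardized modules to acyclic modules vanish. -/
lemma subsingleton_ext_standardize {lam : Λ} (M : GMod (A.cartan W lam)) (n : ℕ) {V : GMod A}
    (hV : ∀ lam, IsAcyclic W lam V) (h : Projective M ∨ Injective (weightPart W lam V)) :
    Subsingleton (Abelian.Ext (standardize W lam M) V (n + 1)) := by
  induction n generalizing V with
  | zero =>
    refine subsingleton_ext_one (injSeq_shortExact V) _ fun f => ?_
    obtain ⟨l, hl⟩ : ∃ l, l ≫ weightMap W lam (injSeq V).g = stdHomEquiv f := by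
      rcases h with h | h
      · have : Epi (weightMap W lam (injSeq V).g) := epi_of_surjective _ (hV lam).surjective
        exact ⟨Projective.factorThru (stdHomEquiv f) _, Projective.factorThru_comp _ _⟩
      · obtain ⟨σ, hσ⟩ := (hV lam).exists_section h
        exact ⟨stdHomEquiv f ≫ σ, by rw [Category.assoc, hσ, Category.comp_id]⟩
    refine ⟨stdHomEquiv.symm l, stdHomEquiv.injective ?_⟩
    rw [stdHomEquiv_comp, LinearEquiv.apply_symm_apply]
    exact hl
  | succ n ih =>
    -- The cokernel C inherits the assumptions: weight lifts in E descend to C since E_λ → C_λ is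
    -- onto, and if V_λ is injective then C_λ is a retract of E_λ.
    have hC := T.hasAllWeightLifts_of_epi (inferInstance : Injective (injSeq V).X₂) (injSeq V).g
      fun lam => (hV lam).surjective
    have := ih (V := (injSeq V).X₃) (T.isAcyclic_of_hasAllWeightLifts hC) (h.imp_right fun hinj => by
      have : Injective (weightPart W lam (injSeq V).X₂) := T.injective_weightPart lam inferInstance
      obtain ⟨σ, hσ⟩ := (hV lam).exists_section hinj
      exact injective_of_section hσ)
    exact subsingleton_ext_succ (injSeq_shortExact V) _ _

lemma extVanishes_standardize {lam : Λ} (M : GMod (A.cartan W lam)) {V : GMod A}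
    (hV : ∀ lam, IsAcyclic W lam V) (h : Projective M ∨ Injective (weightPart W lam V)) {n : ℕ}
    (hn : 1 ≤ n) : ExtVanishes n (standardize W lam M) V := by
  intro d
  obtain ⟨n, rfl⟩ := Nat.exists_eq_add_of_le' hn
  exact T.subsingleton_ext_standardize M n (fun lam => (hV lam).shift d)
    (h.imp_right fun h => injective_weightPart_shift h d)

end TriangularBasis

end ExtVanishing

/-! ### Extension-closed classes and flags -/

section Flags

variable {k : Type u} [Field k] {I : Type u} {A : LUGAlgebra k I}

namespace GMod

/-- A class of modules containing the zero modules and closed under extensions. -/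
structure IsExtensionClosed (Q : GMod A → Prop) : Prop where
  zero : ∀ M : GMod A, (∀ i d (v : M.pc i d), v = 0) → Q M
  ext : ∀ (M' M M'' : GMod A) (f : M' ⟶ M) (g : M ⟶ M''), (∀ i d, Function.Injective (f.app i d)) →
    (∀ i d, Function.Surjective (g.app i d)) → (∀ i d v, g.app i d v = 0 ↔ ∃ u, f.app i d u = v) →
    Q M' → Q M'' → Q M

/-- An isomorphism is an extension with quotient zero. -/
lemma IsExtensionClosed.of_iso {Q : GMod A → Prop} (hQ : IsExtensionClosed Q) {M N : GMod A}
    (e : M ≅ N) (hM : Q M) : Q N :=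
  hQ.ext M N (zeroMod A) e.hom 0 (fun i d => (iso_hom_bijective e i d).1)
    (fun _ _ _ => ⟨0, Subsingleton.elim (α := PUnit) _ _⟩)
    (fun i d v => ⟨fun _ => (iso_hom_bijective e i d).2 v, fun _ => rfl⟩) hM
    (hQ.zero _ fun _ _ _ => Subsingleton.elim (α := PUnit) _ _)

lemma isExtensionClosed_true : IsExtensionClosed fun _ : GMod A => True :=
  ⟨fun _ _ => trivial, fun _ _ _ _ _ _ _ _ _ _ => trivial⟩

/-- The sequence splits because M' is injective. A map into M is extended first after projection to
M'', and the discrepancy takes values in M', where it is extended as well. -/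
lemma isExtensionClosed_injective : IsExtensionClosed fun M : GMod A => Injective M := by
  refine ⟨fun M hM => ⟨fun {X Y} h j hj => ⟨0, ?_⟩⟩, fun M' M M'' f g hf hg hfg h' h'' => ?_⟩
  · ext i d v
    exact (hM i d _).trans (hM i d _).symm
  · obtain ⟨σ, hσ⟩ := exists_section_of_injective h' f g hf hg hfg
    refine ⟨fun {X Y} h j hj => ?_⟩
    let t := Injective.factorThru (h ≫ g) j
    have ht : j ≫ t = h ≫ g := Injective.comp_factorThru _ _
    obtain ⟨l, hl⟩ := exists_lift_of_injective f hf (h - j ≫ t ≫ σ) (by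
      intro i d v
      refine (hfg i d _).1 ?_
      have : (h - j ≫ t ≫ σ) ≫ g = 0 := by
        rw [Preadditive.sub_comp, Category.assoc, Category.assoc, hσ, Category.comp_id, ht, sub_self]
      exact congr_app this i d v)
    refine ⟨t ≫ σ + Injective.factorThru l j ≫ f, ?_⟩
    rw [Preadditive.comp_add, ← Category.assoc j (Injective.factorThru l j) f,
      Injective.comp_factorThru, hl, add_sub_cancel]

/-- Two quotients of a module with the same kernel are isomorphic. -/
lemma nonempty_iso_of_surjective {X Y Z : GMod A} (f : X ⟶ Y) (g : X ⟶ Z)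
    (hf : ∀ i d, Function.Surjective (f.app i d)) (hg : ∀ i d, Function.Surjective (g.app i d))
    (h : ∀ i d v, f.app i d v = 0 ↔ g.app i d v = 0) : Nonempty (Y ≅ Z) := by
  obtain ⟨l, hl⟩ := exists_desc_of_surjective f hf g fun i d v => (h i d v).1
  have hl' : ∀ i d v, l.app i d (f.app i d v) = g.app i d v := fun i d v => congr_app hl i d v
  refine ⟨isoOfBijective l fun i d => ⟨?_, fun z => ?_⟩⟩
  · rw [injective_iff_map_eq_zero]
    intro v hv
    obtain ⟨v, rfl⟩ := hf i d v
    rw [hl'] at hv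
    exact (h i d v).2 hv
  · obtain ⟨x, rfl⟩ := hg i d z
    exact ⟨f.app i d x, hl' i d x⟩

lemma subquot_π_eq_zero {M : GMod A} {U U' : GSub M} {i : I} {d : ℤ} (x : U.toGMod.pc i d) :
    (GSub.comap U.ι U').π.app i d x = 0 ↔ U.ι.app i d x ∈ U'.carrier i d := GSub.π_eq_zero

lemma subquot_comap_iso {M N : GMod A} (g : M ⟶ N) (hg : ∀ i d, Function.Surjective (g.app i d))
    (U U' : GSub N) :
    Nonempty (GSub.subquot U U' ≅ GSub.subquot (GSub.comap g U) (GSub.comap g U')) := by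
  let r : (GSub.comap g U).toGMod ⟶ U.toGMod :=
    ⟨fun i d => (g.app i d).restrict fun _ h => h, fun h a v => Subtype.ext (g.app_act h a v.1)⟩
  have hr : ∀ i d, Function.Surjective (r.app i d) := fun i d v => by
    obtain ⟨x, hx⟩ := hg i d v.1
    exact ⟨⟨x, show g.app i d x ∈ U.carrier i d by rw [hx]; exact v.2⟩, Subtype.ext hx⟩
  exact nonempty_iso_of_surjective (r ≫ (GSub.comap U.ι U').π)
    (GSub.comap (GSub.comap g U).ι (GSub.comap g U')).π
    (fun i d => ((GSub.comap U.ι U').mkQ_surjective i d).comp (hr i d))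
    (fun i d => (GSub.comap (GSub.comap g U).ι (GSub.comap g U')).mkQ_surjective i d)
    fun i d v => (subquot_π_eq_zero (U := U) (U' := U') (r.app i d v)).trans
      (subquot_π_eq_zero (U := GSub.comap g U) (U' := GSub.comap g U') v).symm

lemma comap_lt {M N : GMod A} (g : M ⟶ N) (hg : ∀ i d, Function.Surjective (g.app i d))
    {U U' : GSub N} (h : U < U') : GSub.comap g U < GSub.comap g U' := by
  refine lt_of_le_of_ne (fun i d v hv => h.le i d hv) fun heq => h.not_ge fun i d v hv => ?_
  obtain ⟨x, rfl⟩ := hg i d v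
  have hx : x ∈ (GSub.comap g U').carrier i d := hv
  rw [← heq] at hx
  exact hx

variable {Λ : Type v} {IsLayer IsLayer' : Λ → GMod A → Prop} {M N : GMod A}

lemma HasFlag.mono (h : ∀ lam X, IsLayer lam X → IsLayer' lam X) (hM : HasFlag IsLayer M) :
    HasFlag IsLayer' M := by
  obtain ⟨n, F, lam, h0, h1, hinj, hF⟩ := hM
  exact ⟨n, F, lam, h0, h1, hinj, fun r => ⟨(hF r).1, h _ _ (hF r).2⟩⟩

lemma hasFlag_of_eq_zero (h : ∀ i d (v : M.pc i d), v = 0) : HasFlag IsLayer M :=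
  ⟨0, fun _ => ⊤, Fin.elim0, rfl, GSub.eq_bot_iff'.2 fun i d v _ => h i d v,
    fun x => x.elim0, fun r => r.elim0⟩

lemma HasFlag.of_iso (hL : ∀ lam X Y, Nonempty (X ≅ Y) → IsLayer lam X → IsLayer lam Y) (e : N ≅ M)
    (h : HasFlag IsLayer M) : HasFlag IsLayer N := by
  obtain ⟨n, F, lam, h0, h1, hinj, hF⟩ := h
  have hs := fun i d => (iso_hom_bijective e i d).2
  refine ⟨n, fun r => GSub.comap e.hom (F r), lam, ?_, ?_, hinj, fun r =>
    ⟨comap_lt e.hom hs (hF r).1, hL _ _ _ (subquot_comap_iso e.hom hs _ _) (hF r).2⟩⟩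
  · simp only [h0]
    exact GSub.eq_top_iff'.2 fun _ _ _ => trivial
  · simp only [h1]
    exact GSub.eq_bot_iff'.2 fun i d v hv => (iso_hom_bijective e i d).1
      ((show e.hom.app i d v = 0 from hv).trans (map_zero _).symm)

/-- A flag of a quotient extends by a layer. -/
lemma HasFlag.extend (hL : ∀ lam X Y, Nonempty (X ≅ Y) → IsLayer lam X → IsLayer lam Y)
    (g : M ⟶ N) (hg : ∀ i d, Function.Surjective (g.app i d)) {lam : Λ}
    (hker : IsLayer lam (ker g).toGMod) (hne : ker g ≠ ⊥)
    (h : HasFlag (fun mu X => mu ≠ lam ∧ IsLayer mu X) N) : HasFlag IsLayer M := by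
  obtain ⟨n, F, mu, h0, h1, hinj, hF⟩ := h
  have hlast : GSub.comap g (F (Fin.last n)) = ker g := by rw [h1]; rfl
  -- The flag of N pulls back to a chain ending in ker g, and 0 is appended. The types stay distinct
  -- because those of N all differ from λ.
  refine ⟨n + 1, Fin.snoc (α := fun _ => GSub M) (fun r => GSub.comap g (F r)) ⊥,
    Fin.snoc (α := fun _ => Λ) mu lam, ?_, Fin.snoc_last _ _, ?_, ?_⟩
  · rw [show (0 : Fin (n + 2)) = Fin.castSucc 0 from rfl, Fin.snoc_castSucc, h0]
    rfl
  · intro r s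
    refine Fin.lastCases ?_ (fun r => ?_) r <;> refine Fin.lastCases ?_ (fun s => ?_) s
    · simp
    · rw [Fin.snoc_last, Fin.snoc_castSucc]
      exact fun h => ((hF s).2.1 h.symm).elim
    · rw [Fin.snoc_last, Fin.snoc_castSucc]
      exact fun h => ((hF r).2.1 h).elim
    · rw [Fin.snoc_castSucc, Fin.snoc_castSucc]
      exact fun h => congrArg _ (hinj h)
  · intro r
    refine Fin.lastCases ?_ (fun r => ?_) r
    · rw [Fin.succ_last, Fin.snoc_last, Fin.snoc_castSucc, Fin.snoc_last, hlast]
      refine ⟨lt_of_le_of_ne (fun i d v hv => ?_) hne.symm, hL _ _ _ ?_ hker⟩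
      · rw [show v = 0 from hv]
        exact Submodule.zero_mem _
      · exact nonempty_iso_of_surjective (𝟙 _) (GSub.comap (ker g).ι ⊥).π
          (fun i d => Function.surjective_id) (GSub.comap (ker g).ι ⊥).mkQ_surjective
          fun i d v => ⟨fun h => (subquot_π_eq_zero _).2 (by
            rw [show v = 0 from h, map_zero]
            exact Submodule.zero_mem _), fun h => Subtype.ext ((subquot_π_eq_zero _).1 h)⟩
    · rw [Fin.succ_castSucc, Fin.snoc_castSucc, Fin.snoc_castSucc, Fin.snoc_castSucc]
      exact ⟨comap_lt g hg (hF r).1, hL _ _ _ (subquot_comap_iso g hg _ _) (hF r).2.2⟩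

/-- Properties of modules that hold for layers and are closed under extensions hold for modules
with a flag. -/
lemma HasFlag.induction {Q : GMod A → Prop} (hQ : IsExtensionClosed Q)
    (hL : ∀ lam X, IsLayer lam X → Q X) (h : HasFlag IsLayer M) : Q M := by
  obtain ⟨n, F, mu, h0, h1, -, hF⟩ := h
  -- Each term of the filtration is an extension of a layer by the next smaller term, so the
  -- induction starts at the zero end.
  have key : ∀ r, Q (F r).toGMod := by
    intro r
    induction r using Fin.reverseInduction with
    | last =>
      rw [h1]
      exact hQ.zero _ fun i d v => Subtype.ext v.2
    | cast r ih =>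
      refine hQ.ext _ _ _ (GSub.incl (hF r).1.le) (GSub.comap (F r.castSucc).ι (F r.succ)).π
        (fun i d x y h => Subtype.ext
          (congrArg (fun z : (F r.castSucc).toGMod.pc i d => z.1) h))
        (GSub.comap (F r.castSucc).ι (F r.succ)).mkQ_surjective (fun i d v => ?_) ih
        (hL _ _ (hF r).2)
      rw [subquot_π_eq_zero]
      exact ⟨fun h => ⟨⟨_, h⟩, Subtype.ext rfl⟩, by rintro ⟨u, rfl⟩; exact u.2⟩
  have h2 := key 0
  rw [h0] at h2
  refine hQ.of_iso (isoOfBijective (⊤ : GSub M).ι fun i d => ⟨GSub.ι_injective _ i d, fun v =>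
    ⟨⟨v, trivial⟩, rfl⟩⟩) h2

end GMod

end Flags

/-! ### Modules with a flag and modules with good weight parts -/

section Good

variable {k : Type u} [Field k] {I : Type u} {A : LUGAlgebra k I}
  {Λ : Type v} {W : Weights I Λ} [PartialOrder Λ]

namespace GMod

/-- A layer of type `λ` for a class `Q` of modules over the algebras `A_λ`. -/
def IsLayerOf (W : Weights I Λ) (Q : ∀ lam, GMod (A.cartan W lam) → Prop) (lam : Λ) (M : GMod A) :
    Prop :=
  ∃ N : GMod (A.cartan W lam), Q lam N ∧ N.LocallyFiniteDimensional ∧ N.BoundedAbove ∧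
    Nonempty (M ≅ costandardize W lam N)

/-- The weights `λ` with `e_λ V^{≥λ} ≠ 0`. -/
def weightSupport (W : Weights I Λ) (V : GMod A) : Set Λ :=
  {lam | ∃ s d, ∃ v : (weightPart W lam V).pc s d, v ≠ 0}

lemma eq_zero_of_not_mem_weightSupport {V : GMod A} {lam : Λ} (h : lam ∉ weightSupport W V)
    (s : W.specialOver {lam}) (d : ℤ) (v : (weightPart W lam V).pc s d) : v = 0 := by
  by_contra hv
  exact h ⟨s, d, v, hv⟩

/-- All weight parts are acyclic and lie in the class `Q`. -/
structure IsGood (W : Weights I Λ) (Q : ∀ lam, GMod (A.cartan W lam) → Prop) (V : GMod A) :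
    Prop where
  isAcyclic : ∀ lam, IsAcyclic W lam V
  mem : ∀ lam, Q lam (weightPart W lam V)

lemma IsLayerOf.of_iso {Q : ∀ lam, GMod (A.cartan W lam) → Prop} (lam : Λ) (X Y : GMod A)
    (e : Nonempty (X ≅ Y)) (h : IsLayerOf W Q lam X) : IsLayerOf W Q lam Y := by
  obtain ⟨e⟩ := e
  obtain ⟨N, h1, h2, h3, ⟨e'⟩⟩ := h
  exact ⟨N, h1, h2, h3, ⟨e.symm ≪≫ e'⟩⟩

section Exact

variable {V' V V'' : GMod A} (f : V' ⟶ V) (g : V ⟶ V'')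
  (hf : ∀ i d, Function.Injective (f.app i d)) (hg : ∀ i d, Function.Surjective (g.app i d))
  (hfg : ∀ i d v, g.app i d v = 0 ↔ ∃ u, f.app i d u = v)

include hf hfg

lemma weightMap_exact_iff {lam : Λ} (s : W.specialOver {lam}) (d : ℤ)
    (v : (weightPart W lam V).pc s d) :
    (weightMap W lam g).app s d v = 0 ↔ ∃ u, (weightMap W lam f).app s d u = v := by
  refine ⟨weightMap_exact _ _ hf fun i d v => (hfg i d v).1, ?_⟩
  rintro ⟨u, rfl⟩
  exact weightVal_injective ((hfg s d _).2 ⟨weightVal u, rfl⟩)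

include hg

/-- With V inside an injective E, the kernel of E/V' → E/V is V''. An element of the weight part of
E/V' and the image of a lift to E of its image in E/V differ by an element of the weight part of V''
at λ, which is zero. -/
lemma IsAcyclic.of_subobject {lam : Λ} (h : IsAcyclic W lam V) (h'' : lam ∉ weightSupport W V'') :
    IsAcyclic W lam V' := by
  let p := (GSub.range (f ≫ Injective.ι V)).π
  refine isAcyclic_of_injective (inferInstance : Injective (Injective.under V)) (f ≫ Injective.ι V)
    p (fun i d => (injSeq_injective V i d).comp (hf i d)) (range_eq_ker V' _) ?_
  have hp : ∀ i d x, p.app i d x = 0 ↔ ∃ u, (f ≫ Injective.ι V).app i d u = x := range_eq_ker V' _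
  obtain ⟨q, hq⟩ := exists_desc_of_surjective p (GSub.mkQ_surjective _) (injSeq V).g (by
    intro i d x hx
    obtain ⟨u, rfl⟩ := (hp i d x).1 hx
    exact (injSeq_exact V i d _).2 ⟨_, rfl⟩)
  obtain ⟨j, hj⟩ := exists_desc_of_surjective g hg (Injective.ι V ≫ p) (by
    intro i d v hv
    obtain ⟨u, rfl⟩ := (hfg i d v).1 hv
    exact (hp i d _).2 ⟨u, rfl⟩)
  intro s d x
  obtain ⟨y, hy⟩ := h.surjective s d ((weightMap W lam q).app s d x)
  refine ⟨y, ?_⟩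
  have hx : (weightMap W lam q).app s d (x - (weightMap W lam p).app s d y) = 0 := by
    rw [map_sub, ← hy]
    refine sub_eq_zero.2 (weightVal_injective ?_)
    exact (congr_app hq s d (weightVal y)).symm
  obtain ⟨z, hz⟩ := weightMap_exact j q (fun i d => by
      rw [injective_iff_map_eq_zero]
      intro z hz
      obtain ⟨v, rfl⟩ := hg i d z
      obtain ⟨u, hu⟩ := (hp i d _).1 ((congr_app hj i d v).symm.trans hz)
      exact (hfg i d v).2 ⟨u, injSeq_injective V i d hu⟩)
    (fun i d c hc => by
      obtain ⟨x, rfl⟩ := GSub.mkQ_surjective (GSub.range (f ≫ Injective.ι V)) i d c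
      obtain ⟨v, rfl⟩ := (injSeq_exact V i d x).1 ((congr_app hq i d x).symm.trans hc)
      exact ⟨g.app i d v, congr_app hj i d v⟩) hx
  rw [eq_zero_of_not_mem_weightSupport h'' s d z, map_zero] at hz
  exact (sub_eq_zero.1 hz.symm).symm

end Exact

/-- Acyclicity of M' makes the sequence of weight parts exact, so it is an extension within Q, and
the support of M lies in the union of the two others. -/
lemma isExtensionClosed_isGood {Q : ∀ lam, GMod (A.cartan W lam) → Prop}
    (hQ : ∀ lam, IsExtensionClosed (Q lam)) (T : TriangularBasis A W) :
    IsExtensionClosed fun V => IsGood W Q V ∧ (weightSupport W V).Finite := by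
  refine ⟨fun M hM => ⟨⟨fun lam => isAcyclic_of_vanishing (fun s _ d v => hM s d v)
      T.mem_upperSub_not_le, fun lam => (hQ lam).zero _ fun s d v => weightVal_injective
        ((hM s d _).trans (map_zero _).symm)⟩, ?_⟩, ?_⟩
  · convert Set.finite_empty
    refine Set.eq_empty_of_forall_notMem fun lam ⟨s, d, v, hv⟩ => hv ?_
    exact weightVal_injective ((hM s d _).trans (map_zero _).symm)
  · intro M' M M'' f g hf hg hfg ⟨h', hs'⟩ ⟨h'', hs''⟩
    refine ⟨⟨fun lam => (h'.isAcyclic lam).of_extension (h''.isAcyclic lam) f g hf hg hfg,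
      fun lam => (hQ lam).ext _ _ _ (weightMap W lam f) (weightMap W lam g)
        (weightMap_injective f hf) (h'.isAcyclic lam _ _ f g hf hg hfg)
        (weightMap_exact_iff f g hf hfg) (h'.mem lam) (h''.mem lam)⟩,
      (hs'.union hs'').subset ?_⟩
    rintro lam ⟨s, d, v, hv⟩
    by_contra h
    rw [Set.mem_union, not_or] at h
    obtain ⟨u, rfl⟩ := (weightMap_exact_iff f g hf hfg s d v).1
      (eq_zero_of_not_mem_weightSupport h.2 s d _)
    rw [eq_zero_of_not_mem_weightSupport h.1 s d u, map_zero] at hv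
    exact hv rfl

/-- Only the weight part at λ is nonzero, and there the canonical map is inverse to the map induced
by the isomorphism (j^λ_* N)_λ ≅ N. -/
lemma hasAllWeightLifts_costandardize {lam : Λ} (N : GMod (A.cartan W lam)) :
    HasAllWeightLifts W (costandardize W lam N) := by
  intro Γ κ _ hΓ hκ _ i d φ
  by_cases hne : κ = lam
  · subst hne
    refine ⟨costdMk (fun p => ((costdCounit N).app p.1.1 p.1.2.2).comp (costdEval φ p.1.1 p.2))
      (fun p a ha => by
        rw [LinearMap.comp_apply, costdEval_eq_zero _ _ _ ha, map_zero])
      (fun s t x c y e z hx he hz hxe b a => by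
        rw [LinearMap.comp_apply, LinearMap.comp_apply, costdEval_mul φ s t hx he hz hxe]
        exact (costdCounit N).app_act _ _ _),
      costd_mem_upperSub Γ (fun mu hmu hle => hκ (hΓ hle hmu)) _, fun s c e h a => costd_ext ?_⟩
    intro t c' e' h' b
    rw [costdEval_act h a _ t h' rfl (by omega), costdEval_mk, LinearMap.comp_apply,
      costdEval_mul φ t s rfl h (by omega) h', costdCounit_apply, weightVal_act,
      costdEval_act h' b _ t (zero_add e') (zero_add c') h', A.one_mul]
  · refine ⟨0, Submodule.zero_mem _, fun s c e h a => ?_⟩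
    exact (map_zero _).trans
      ((congrArg weightVal (weightPart_costd_eq_zero hne s e _)).trans (map_zero _)).symm

lemma IsLayerOf.isGood {Q : ∀ lam, GMod (A.cartan W lam) → Prop}
    (hQ : ∀ lam, IsExtensionClosed (Q lam)) (T : TriangularBasis A W) {lam : Λ} {X : GMod A}
    (h : IsLayerOf W Q lam X) : IsGood W Q X ∧ (weightSupport W X).Finite := by
  obtain ⟨N, hN, -, -, ⟨e⟩⟩ := h
  have h0 : ∀ mu, mu ≠ lam → ∀ s d (v : (weightPart W mu X).pc s d), v = 0 := fun mu hmu s d v =>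
    weightMap_injective e.hom (fun i d => (iso_hom_bijective e i d).1) s d
      ((weightPart_costd_eq_zero hmu s d _).trans (map_zero _).symm)
  refine ⟨⟨fun mu => (T.isAcyclic_of_hasAllWeightLifts (hasAllWeightLifts_costandardize N)
    mu).of_iso e.symm, fun mu => ?_⟩, (Set.finite_singleton lam).subset ?_⟩
  · by_cases hmu : mu = lam
    · subst hmu
      exact (hQ mu).of_iso (weightIso mu e ≪≫ weightPartCostd N).symm hN
    · exact (hQ mu).zero _ (h0 mu hmu)
  · rintro mu ⟨s, d, v, hv⟩
    by_contra hmu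
    exact hv (h0 mu hmu s d v)

lemma isGood_of_hasFlag {Q : ∀ lam, GMod (A.cartan W lam) → Prop}
    (hQ : ∀ lam, IsExtensionClosed (Q lam)) (T : TriangularBasis A W) {V : GMod A}
    (h : HasFlag (IsLayerOf W Q) V) : IsGood W Q V ∧ (weightSupport W V).Finite :=
  h.induction (isExtensionClosed_isGood hQ T) fun _ _ hX => hX.isGood hQ T

lemma weightPart_upperSub_eq_zero {Γ : Set Λ} {lam : Λ} (hlam : lam ∈ Γ) (V : GMod A) :
    lam ∉ weightSupport W (upperSub W Γ V).toGMod := by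
  rintro ⟨s, d, v, hv⟩
  refine hv (weightVal_injective (Subtype.ext ?_))
  exact eq_zero_of_mem_upperSub (Weights.specialOver_mono (Set.singleton_subset_iff.2 hlam) s.2)
    (weightVal v).2

/-- As Γ is a lower set without λ, all its weights are ≱ λ; so the weight part at λ is contained in
V^Γ. -/
lemma weightMap_upperSub_ι_bijective {Γ : Set Λ} (hΓ : IsLowerSet Γ) {lam : Λ} (hlam : lam ∉ Γ)
    (V : GMod A) (s : W.specialOver {lam}) (d : ℤ) :
    Function.Bijective ((weightMap W lam (upperSub W Γ V).ι).app s d) := by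
  refine ⟨weightMap_injective _ (GSub.ι_injective _) s d, fun v => ?_⟩
  have hv := weightVal_mem v
  have hv' : weightVal v ∈ (upperSub W Γ V).carrier s d :=
    upperSub_anti (fun mu hmu hle => hlam (hΓ hle hmu)) V s d hv
  obtain ⟨w, hw⟩ := exists_weightVal (lam := lam) (M := (upperSub W Γ V).toGMod)
    (v := ⟨weightVal v, hv'⟩) (mem_upperSub_of_app (upperSub W Γ V).ι (GSub.ι_injective _) hv)
  exact ⟨w, weightVal_injective
    (congrArg (fun z : (upperSub W Γ V).toGMod.pc s d => z.1) hw)⟩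

/-- Let v represent an element of the weight part of V/V^Γ. For a ∈ e_Γ A the vector a v lies in
V^Γ, and also at a weight in Γ, where V^Γ is zero. So v ∈ V^Γ. -/
lemma weightPart_quot_eq_zero {Γ : Set Λ} (hΓ : IsLowerSet Γ) {lam : Λ} (hlam : lam ∉ Γ)
    (V : GMod A) : lam ∉ weightSupport W (upperSub W Γ V).quot := by
  rintro ⟨s, d, x, hx⟩
  obtain ⟨v, hv⟩ := (upperSub W Γ V).mkQ_surjective s d (weightVal x)
  refine hx (weightVal_injective ?_)
  rw [map_zero, ← hv]
  refine GSub.π_eq_zero.2 fun t ht c e h a => ?_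
  have h1 := weightVal_mem x t
    (Weights.specialOver_mono (fun mu hmu hle => hlam (hΓ hle hmu)) ht) c e h a
  rw [← hv, ← (upperSub W Γ V).π.app_act] at h1
  exact eq_zero_of_mem_upperSub ht (GSub.π_eq_zero.1 h1)

end GMod

namespace TriangularBasis

open GMod

variable (T : TriangularBasis A W)

include T

/-- V^Γ vanishes at all weights in Γ, in particular at λ and below, which are the only weights
involved in the weight part at λ. -/
lemma weightMap_upperSub_π_bijective {Γ : Set Λ} (hΓ : IsLowerSet Γ) {lam : Λ} (hlam : lam ∈ Γ)
    (V : GMod A) (s : W.specialOver {lam}) (d : ℤ) :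
    Function.Bijective ((weightMap W lam (upperSub W Γ V).π).app s d) := by
  have hsΓ := Weights.specialOver_mono (Set.singleton_subset_iff.2 hlam) s.2
  constructor
  · rw [injective_iff_map_eq_zero]
    intro v hv
    refine weightVal_injective ((eq_zero_of_mem_upperSub hsΓ
      (GSub.π_eq_zero.1 (congrArg weightVal hv))).trans (map_zero _).symm)
  · intro x
    obtain ⟨v, hv⟩ := (upperSub W Γ V).mkQ_surjective s d (weightVal x)
    obtain ⟨s, hs, rfl⟩ := Weights.exists_over s
    obtain ⟨w, rfl⟩ := exists_weightVal (W := W) (lam := lam) (s := W.over s hs) (v := v) (by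
      refine T.mem_upperSub_not_le hs fun t ht c e h a => ?_
      have h1 := weightVal_mem x t (not_le_of_mem_specialOver_Iio ht) c e h a
      rw [← hv] at h1
      exact eq_zero_of_mem_upperSub (Weights.specialOver_mono
        (fun mu hmu => hΓ (le_of_lt hmu) hlam) ht) (GSub.π_eq_zero.1 (((upperSub W Γ V).π.app_act h a v).trans h1)))
    exact ⟨w, weightVal_injective hv⟩

/-- A module without weight parts is zero. -/
lemma eq_zero_of_weightSupport_eq_empty {V : GMod A} (h : weightSupport W V = ∅) (i : I) (d : ℤ)
    (v : V.pc i d) : v = 0 := by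
  have h0 : ∀ lam s d (v : (weightPart W lam V).pc s d), v = 0 := fun lam =>
    eq_zero_of_not_mem_weightSupport (h ▸ Set.notMem_empty lam)
  -- If V vanishes at all weights below λ, then every vector of weight λ belongs to the weight part.
  have hS : ∀ lam (s : W.S) (_ : W.dot s = lam) d (v : V.pc s d), v = 0 := by
    intro lam
    induction lam using T.wellFounded_lt.induction with
    | _ lam ih =>
    intro s hs d v
    obtain ⟨w, rfl⟩ := exists_weightVal (W := W) (lam := lam) (s := W.over s hs) (v := v)
      (T.mem_upperSub_not_le hs fun t ht c e h a => ih _ ht.2 ⟨t, ht.1⟩ rfl e _)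
    rw [h0 lam _ d w, map_zero]
  obtain ⟨Γ, -, -, hone⟩ := T.exists_one_mem_idealGen i
  rw [← V.one_act v]
  exact act_eq_zero_of_mem_upperSub W (zero_add d) hone
    fun t ht c e h a => hS _ ⟨t, ht.1⟩ rfl e _

/-- The submodule V^Γ has no weight parts inside Γ, and outside Γ it has those of V, which are zero.
-/
lemma upperSub_eq_bot {V : GMod A} {Γ : Set Λ} (hΓ : IsLowerSet Γ) (h : weightSupport W V ⊆ Γ) :
    upperSub W Γ V = ⊥ := by
  refine GSub.eq_bot_iff'.2 fun i d v hv => ?_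
  refine congrArg Subtype.val (T.eq_zero_of_weightSupport_eq_empty
    (V := (upperSub W Γ V).toGMod) (Set.eq_empty_of_forall_notMem ?_) i d ⟨v, hv⟩)
  intro lam hlam
  by_cases hl : lam ∈ Γ
  · exact weightPart_upperSub_eq_zero hl V hlam
  · obtain ⟨s, d, v, hv⟩ := hlam
    exact hl (h ⟨s, d, _, fun h0 => hv ((weightMap_upperSub_ι_bijective hΓ hl V s d).1
      (h0.trans (map_zero _).symm))⟩)

/-- The canonical map `V^Γ ⟶ j^λ_* (e_λ V^{≥λ})`. -/
lemma exists_hom_costd {lam : Λ} {Γ : Set Λ} (hIio : Set.Iio lam ⊆ Γ) (V : GMod A) :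
    ∃ θ : (upperSub W Γ V).toGMod ⟶ costandardize W lam (weightPart W lam V),
      ∀ (i : I) (d : ℤ) (v : (upperSub W Γ V).toGMod.pc i d) (s : W.specialOver {lam}) (c e : ℤ)
        (h : c + d = e) (a : A.blk s i c),
        weightVal (costdEval (θ.app i d v) s h a) = V.act h a v.1 := by
  have H := fun (i : I) (d : ℤ) (v : (upperSub W Γ V).toGMod.pc i d) =>
    T.exists_costd (lam := lam) hIio (𝟙 V) (fun _ _ => Function.injective_id) v.2
      fun s c e h a => ⟨_, rfl⟩
  choose θ hθ using H
  have hθ' : ∀ (i : I) (d : ℤ) (v : (upperSub W Γ V).toGMod.pc i d) (s : W.specialOver {lam})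
      (c e : ℤ) (h : c + d = e) (a : A.blk s i c),
      weightVal (costdEval (θ i d v) s h a) = V.act h a v.1 := hθ
  refine ⟨⟨fun i d => ⟨⟨θ i d, fun v w => ?_⟩, fun r v => ?_⟩, fun {i j d e f} h a v => ?_⟩, hθ'⟩
  · refine costd_ext fun s c e h a => weightVal_injective ((hθ' ..).trans ?_)
    rw [costdEval_add, map_add, hθ', hθ']
    exact map_add _ _ _
  · refine costd_ext fun s c e h a => weightVal_injective ((hθ' ..).trans ?_)
    refine Eq.trans ?_ (congrArg (r • ·) (hθ' i d v s c e h a)).symm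
    exact map_smul _ _ _
  · refine costd_ext fun s c e' h' b => weightVal_injective ((hθ' ..).trans ?_)
    refine Eq.trans ?_ (congrArg weightVal (costdEval_act h a _ s h' rfl (by omega) b)).symm
    refine Eq.trans ?_ (hθ' ..).symm
    exact (V.mul_act rfl h _ h' b a v.1).symm

section Flag

variable {Q : ∀ lam, GMod (A.cartan W lam) → Prop} (hQ : ∀ lam, IsExtensionClosed (Q lam))
  {V : GMod A} (hV : V.LocallyFiniteDimensional) (hV' : V.BoundedAbove)

include hV hV'

/-- Adding κ to Γ enlarges V/V^Γ by V^Γ/V^{Γ∪{κ}}. The canonical map θ embeds this quotient into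
j^κ_* V_κ, and weight lifts say exactly that it is onto. -/
lemma hasFlag_quot_upperSub (h : IsGood W Q V) {Γ : Set Λ} (hfin : Γ.Finite) (hΓ : IsLowerSet Γ) :
    HasFlag (fun mu X => mu ∈ Γ ∧ IsLayerOf W Q mu X) (upperSub W Γ V).quot := by
  have hlift := T.hasAllWeightLifts_of_isAcyclic h.isAcyclic
  refine finite_lowerSet_induction (P := fun Γ =>
    HasFlag (fun mu X => mu ∈ Γ ∧ IsLayerOf W Q mu X) (upperSub W Γ V).quot) ?_ ?_ hfin hΓ
  · refine hasFlag_of_eq_zero fun i d v => ?_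
    obtain ⟨v, rfl⟩ := (upperSub W ∅ V).mkQ_surjective i d v
    exact GSub.π_eq_zero.2 fun s hs => hs.2.elim
  intro Γ κ hfin hΓ hκ hIio ih
  let g : (upperSub W (insert κ Γ) V).quot ⟶ (upperSub W Γ V).quot :=
    quotDesc _ (upperSub W Γ V).π fun i d v hv =>
      GSub.π_eq_zero.2 (upperSub_anti (Set.subset_insert _ _) V i d hv)
  have hg : ∀ i d, Function.Surjective (g.app i d) := fun i d x => by
    obtain ⟨v, rfl⟩ := (upperSub W Γ V).mkQ_surjective i d x
    exact ⟨(upperSub W (insert κ Γ) V).π.app i d v, rfl⟩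
  have hL : ∀ lam X Y, Nonempty (X ≅ Y) → lam ∈ insert κ Γ ∧ IsLayerOf W Q lam X →
      lam ∈ insert κ Γ ∧ IsLayerOf W Q lam Y := fun lam X Y e h => ⟨h.1, h.2.of_iso lam X Y e⟩
  -- Filtrations are strict, so a weight that contributes nothing has to be skipped.
  by_cases hker : ker g = ⊥
  · refine (ih.mono fun lam X h => ⟨Set.mem_insert_of_mem _ h.1, h.2⟩).of_iso hL
      (isoOfBijective g fun i d => ⟨?_, hg i d⟩)
    rw [injective_iff_map_eq_zero]
    exact GSub.eq_bot_iff'.1 hker i d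
  · refine HasFlag.extend hL g hg ⟨Set.mem_insert _ _, weightPart W κ V, h.mem κ, hV.weightPart,
      hV'.weightPart, ?_⟩ hker (ih.mono fun lam X h =>
        ⟨fun e => hκ (e ▸ h.1), Set.mem_insert_of_mem _ h.1, h.2⟩)
    obtain ⟨θ, hθ⟩ := T.exists_hom_costd hIio V
    -- Both ker g and j^κ_* V_κ are quotients of V^Γ, with the same kernel V^{Γ∪{κ}}.
    refine nonempty_iso_of_surjective (X := (upperSub W Γ V).toGMod)
      (kerLift ((upperSub W Γ V).ι ≫ (upperSub W (insert κ Γ) V).π) ?_) θ ?_ ?_ ?_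
    · ext i d v
      exact GSub.π_eq_zero.2 v.2
    · rintro i d ⟨x, hx⟩
      obtain ⟨v, rfl⟩ := (upperSub W (insert κ Γ) V).mkQ_surjective i d x
      exact ⟨⟨v, GSub.π_eq_zero.1 hx⟩, rfl⟩
    · intro i d φ
      obtain ⟨w, hw, hw'⟩ := hlift Γ κ hfin hΓ hκ hIio i d φ
      exact ⟨⟨w, hw⟩, costd_ext fun s c e h a => weightVal_injective
        ((hθ i d ⟨w, hw⟩ s c e h a).trans (hw' s c e h a))⟩
    · intro i d v
      constructor
      · intro hv
        have hv' : v.1 ∈ (upperSub W (insert κ Γ) V).carrier i d :=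
          GSub.π_eq_zero.1 (congrArg Subtype.val hv)
        refine costd_ext fun s c e h a => weightVal_injective ((hθ i d v s c e h a).trans ?_)
        rw [hv' s (Weights.specialOver_mono (by simp) s.2) c e h a, costdEval_zero, map_zero]
      · intro hv
        refine Subtype.ext (GSub.π_eq_zero.2 (mem_upperSub_insert v.2 fun s hs c e h a => ?_))
        refine (hθ i d v ⟨s, hs⟩ c e h a).symm.trans ?_
        rw [hv, costdEval_zero, map_zero]

/-- For Γ the lower set generated by the finite weight support, which is finite, V^Γ = 0 and V =
V/V^Γ. -/
lemma hasFlag_of_isGood (h : IsGood W Q V) (hfin : (weightSupport W V).Finite) :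
    HasFlag (IsLayerOf W Q) V := by
  let Γ : Set Λ := ⋃ lam ∈ weightSupport W V, Set.Iic lam
  have hΓ : IsLowerSet Γ := isLowerSet_iUnion₂ fun _ _ => isLowerSet_Iic _
  have h1 := (T.hasFlag_quot_upperSub hV hV' h (hfin.biUnion fun lam _ => T.lower_finite lam)
    hΓ).mono fun lam X h => h.2
  have hbot : upperSub W Γ V = ⊥ := T.upperSub_eq_bot hΓ fun lam hlam =>
    Set.mem_biUnion hlam (Set.mem_Iic.2 le_rfl)
  refine h1.of_iso IsLayerOf.of_iso (isoOfBijective (upperSub W Γ V).π fun i d =>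
    ⟨?_, (upperSub W Γ V).mkQ_surjective i d⟩)
  rw [injective_iff_map_eq_zero]
  intro v hv
  exact GSub.eq_bot_iff'.1 hbot i d v (GSub.π_eq_zero.1 hv)

omit hV hV' in
include hQ in
-- At λ one uses Γ = {μ ≤ λ}: the quotient V/V^Γ is good and has the same weight part at λ as V,
-- while V^Γ vanishes below λ and so is acyclic at λ.
lemma isGood_of_hasFlag_quot (h : ∀ Γ : Set Λ, Γ.Finite → IsLowerSet Γ →
    HasFlag (IsLayerOf W Q) (upperSub W Γ V).quot) : IsGood W Q V := by
  have H := fun lam : Λ => (isGood_of_hasFlag hQ T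
    (h (Set.Iic lam) (T.lower_finite lam) (isLowerSet_Iic lam))).1
  refine ⟨fun lam => ?_, fun lam => ?_⟩
  · refine (isAcyclic_of_vanishing (V := (upperSub W (Set.Iic lam) V).toGMod) (lam := lam)
      (fun s hs d v => ?_) T.mem_upperSub_not_le).of_extension ((H lam).isAcyclic lam)
      (upperSub W (Set.Iic lam) V).ι (upperSub W (Set.Iic lam) V).π (GSub.ι_injective _)
      (GSub.mkQ_surjective _) fun i d v => GSub.π_eq_zero.trans
        ⟨fun h => ⟨⟨v, h⟩, rfl⟩, by rintro ⟨u, rfl⟩; exact u.2⟩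
    exact Subtype.ext (eq_zero_of_mem_upperSub
      (Weights.specialOver_mono Set.Iio_subset_Iic_self hs) v.2)
  · exact (hQ lam).of_iso (isoOfBijective _ (T.weightMap_upperSub_π_bijective (isLowerSet_Iic lam)
      (Set.mem_Iic.2 le_rfl) V)).symm ((H lam).mem lam)

include hQ in
-- For λ ∈ Γ the submodule V^Γ vanishes at λ and below. For λ ∉ Γ the quotient has no weight part at
-- λ, so V^Γ inherits acyclicity and the weight part from V.
lemma isGood_upperSub (h : IsGood W Q V) {Γ : Set Λ} (hfin : Γ.Finite) (hΓ : IsLowerSet Γ) :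
    IsGood W Q (upperSub W Γ V).quot ∧ IsGood W Q (upperSub W Γ V).toGMod := by
  have hquot := (isGood_of_hasFlag hQ T
    ((T.hasFlag_quot_upperSub hV hV' h hfin hΓ).mono fun lam X h => h.2)).1
  refine ⟨hquot, fun lam => ?_, fun lam => ?_⟩
  · by_cases hlam : lam ∈ Γ
    · refine isAcyclic_of_vanishing (fun s hs d v => Subtype.ext (eq_zero_of_mem_upperSub
        (Weights.specialOver_mono (fun mu hmu => hΓ (le_of_lt hmu) hlam) hs) v.2))
        T.mem_upperSub_not_le
    · exact IsAcyclic.of_subobject (upperSub W Γ V).ι (upperSub W Γ V).π (GSub.ι_injective _)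
        (GSub.mkQ_surjective _) (fun i d v => GSub.π_eq_zero.trans
          ⟨fun h => ⟨⟨v, h⟩, rfl⟩, by rintro ⟨u, rfl⟩; exact u.2⟩)
        (h.isAcyclic lam) (weightPart_quot_eq_zero hΓ hlam V)
  · by_cases hlam : lam ∈ Γ
    · exact (hQ lam).zero _ (eq_zero_of_not_mem_weightSupport (weightPart_upperSub_eq_zero hlam V))
    · exact (hQ lam).of_iso (isoOfBijective _ (weightMap_upperSub_ι_bijective hΓ hlam V)).symm
        (h.mem lam)

end Flag

end TriangularBasis

end Good

/-! ### Test families: irreducible and projective A_λ-modules -/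

section Families

variable {k : Type u} [Field k] {I : Type u} {A : LUGAlgebra k I}
  {Λ : Type v} {W : Weights I Λ} [PartialOrder Λ]

namespace GMod

section Hom

variable {lam : Λ} {M : GMod (A.cartan W lam)} {V V' : GMod A}

lemma exists_standardize_hom_ne_zero {n : ℤ} {f : M ⟶ (weightPart W lam V).shift n} (hf : f ≠ 0) :
    ∃ g : standardize W lam M ⟶ V.shift n, g ≠ 0 := by
  refine ⟨stdHomEquiv.symm (f ≫ (weightShiftIso lam V n).inv), fun h => hf ?_⟩
  rw [LinearEquiv.map_eq_zero_iff] at h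
  rw [← cancel_mono (weightShiftIso lam V n).inv, h, zero_comp]

lemma standardize_hom_eq_zero (h : lam ∉ weightSupport W V) {n : ℤ}
    (f : standardize W lam M ⟶ V.shift n) : f = 0 := by
  rw [← stdHomEquiv.map_eq_zero_iff, ← cancel_mono (weightShiftIso lam V n).hom, zero_comp]
  ext s d v
  exact eq_zero_of_not_mem_weightSupport h s _ _

lemma qDimHom_standardize_eq_zero (h : lam ∉ weightSupport W V) :
    qDimHom (standardize W lam M) V = 0 := by
  funext d
  have : Subsingleton (standardize W lam M ⟶ V.shift (-d)) :=
    subsingleton_of_forall_eq 0 (standardize_hom_eq_zero h)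
  exact Module.finrank_zero_of_subsingleton

/-- By adjunction the homomorphisms from j^λ_! M depend only on the weight part at λ. -/
lemma qDimHom_standardize_eq (φ : V ⟶ V')
    (hφ : ∀ s d, Function.Bijective ((weightMap W lam φ).app s d)) :
    qDimHom (standardize W lam M) V = qDimHom (standardize W lam M) V' := by
  funext d
  have hb : ∀ s e, Function.Bijective ((weightMap W lam (shiftMap φ (-d))).app s e) := by
    intro s e
    refine (Function.Bijective.of_comp_iff' (weightShiftHom_bijective lam V' (-d) s e) _).1 ?_
    exact (hφ s (e + -d)).comp (weightShiftHom_bijective lam V (-d) s e)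
  let e := isoOfBijective _ hb
  refine LinearEquiv.finrank_eq (LinearEquiv.ofBijective
    (Linear.rightComp k (standardize W lam M) (shiftMap φ (-d))) ⟨fun f g h => ?_, fun g => ?_⟩)
  · have h1 : stdHomEquiv f ≫ e.hom = stdHomEquiv g ≫ e.hom := congrArg stdHomEquiv h
    rw [cancel_mono] at h1
    exact stdHomEquiv.injective h1
  · refine ⟨stdHomEquiv.symm (stdHomEquiv g ≫ e.inv), stdHomEquiv.injective ?_⟩
    refine (congrArg (· ≫ e.hom)
      (stdHomEquiv.apply_symm_apply (stdHomEquiv g ≫ e.inv))).trans ?_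
    rw [Category.assoc, e.inv_hom_id, Category.comp_id]

/-- A homomorphism j^λ_! M → q^d V is determined by the image of 1 ⊗ x, so the homomorphisms embed
into 1_s V_{e+d}. -/
lemma hasQDim_standardize {s : W.specialOver {lam}} {e : ℤ} {x : M.pc s e} (hx : GSub.gen x = ⊤)
    (hV : V.LocallyFiniteDimensional) (hV' : V.BoundedAbove) :
    HasQDim (standardize W lam M) V := by
  let ev : ∀ d, (standardize W lam M ⟶ V.shift d) →ₗ[k] V.pc s (e + d) := fun d =>
    { toFun := fun f => weightVal (M := V.shift d) (d := e) ((stdHomEquiv f).app s e x)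
      map_add' := fun _ _ => rfl
      map_smul' := fun _ _ => rfl }
  have hev : ∀ d, Function.Injective (ev d) := fun d f g h => stdHomEquiv.injective
    (eval_injective_of_gen_eq_top hx _ (weightVal_injective h))
  obtain ⟨N, hN⟩ := hV' s
  refine ⟨fun d => ?_, N - e, fun d hd => ?_⟩
  · have := hV s (e + d)
    exact Module.Finite.of_injective (ev d) (hev d)
  · have := hN (e + d) (by omega)
    exact (hev d).subsingleton

end Hom

/-- The family of standardizations of `M` characterizes the modules that are acyclic with weight
parts in `Q`. -/
structure IsTestFamily (W : Weights I Λ) (Q : ∀ lam, GMod (A.cartan W lam) → Prop)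
    {B : Λ → Type w} (M : ∀ lam, B lam → GMod (A.cartan W lam)) : Prop where
  isGood : ∀ V : GMod A, V.BoundedAbove →
    (∀ lam b, ExtVanishes 1 (standardFamily W M lam b) V) → IsGood W Q V
  extVanishes : ∀ V : GMod A, IsGood W Q V → ∀ lam b, ∀ n ≥ 1,
    ExtVanishes n (standardFamily W M lam b) V
  weightSupport_subset : ∀ V : GMod A, V.BoundedAbove →
    weightSupport W V ⊆ support (standardFamily W M) V
  exists_generator : ∀ lam b, ∃ s d, ∃ x : (M lam b).pc s d, GSub.gen x = ⊤

lemma support_subset {B : Λ → Type w} (M : ∀ lam, B lam → GMod (A.cartan W lam)) (V : GMod A) :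
    support (standardFamily W M) V ⊆ weightSupport W V := by
  rintro lam ⟨b, d, f, hf⟩
  by_contra h
  exact hf (standardize_hom_eq_zero h f)

end GMod

namespace TriangularBasis

open GMod

variable (T : TriangularBasis A W) {B : Λ → Type w} {L P : ∀ lam, B lam → GMod (A.cartan W lam)}
  (hL : ∀ lam, IsFullSetOfIrreducibles (L lam)) {p : ∀ lam b, P lam b ⟶ L lam b}
  (hp : ∀ lam b, IsProjectiveCover (p lam b))

include T hL

/-- The support is the full weight support because a nonzero bounded above weight part has a simple
submodule. -/
lemma isTestFamily_irreducible (hA : A.LocallyFiniteDimensional) (hA' : A.BoundedBelow) :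
    IsTestFamily W (fun _ N => Injective N) L where
  isGood V hV h := ⟨fun lam => (injective_weightPart_of_extVanishes (hL lam) T hA hA' hV (h lam)).2,
    fun lam => (injective_weightPart_of_extVanishes (hL lam) T hA hA' hV (h lam)).1⟩
  extVanishes V hV lam b n hn := T.extVanishes_standardize _ hV.isAcyclic (Or.inr (hV.mem lam)) hn
  weightSupport_subset V hV := by
    rintro lam ⟨s, d, v, hv⟩
    have := finite_specialOver T lam
    obtain ⟨U, hU⟩ := exists_simple_submodule (cartan_locallyFiniteDimensional hA)
      (cartan_boundedBelow hA') hV.weightPart hv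
    obtain ⟨b, n, f, hf⟩ := (hL lam).exists_hom_ne_zero U hU
    obtain ⟨g, hg⟩ := exists_standardize_hom_ne_zero hf
    exact ⟨b, n, g, hg⟩
  exists_generator lam b := by
    have := (hL lam).simple b
    exact exists_generator_of_simple

include hp in
-- Here the support is controlled without bounds, since every nonzero module receives a nonzero map
-- from a shifted P(b).
lemma isTestFamily_projective : IsTestFamily W (fun _ _ => True) P where
  isGood V _ h := ⟨fun lam => isAcyclic_of_extVanishes_projective (hL lam) (hp lam) (h lam),
    fun _ => trivial⟩
  extVanishes V hV lam b n hn :=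
    T.extVanishes_standardize _ hV.isAcyclic (Or.inl (hp lam b).projective) hn
  weightSupport_subset V _ := by
    rintro lam ⟨s, d, v, hv⟩
    obtain ⟨b, n, f, hf⟩ := (hL lam).exists_projective_hom_ne_zero (hp lam) hv
    obtain ⟨g, hg⟩ := exists_standardize_hom_ne_zero hf
    exact ⟨b, n, g, hg⟩
  exists_generator lam b := by
    have := (hL lam).simple b
    exact (hp lam b).exists_generator

end TriangularBasis

namespace GMod.IsTestFamily

open GMod

variable {Q : ∀ lam, GMod (A.cartan W lam) → Prop} {B : Λ → Type w}
  {M : ∀ lam, B lam → GMod (A.cartan W lam)} (hM : IsTestFamily W Q M) (T : TriangularBasis A W)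
  (hQ : ∀ lam, IsExtensionClosed (Q lam)) {V : GMod A} (hV : V.LocallyFiniteDimensional)
  (hV' : V.BoundedAbove)

include hM T hQ hV hV'

lemma tfae_hasFlag : List.TFAE [
    HasFlag (IsLayerOf W Q) V,
    (support (standardFamily W M) V).Finite ∧ ∀ lam b, ExtVanishes 1 (standardFamily W M lam b) V,
    (support (standardFamily W M) V).Finite ∧
      ∀ lam b, ∀ n ≥ 1, ExtVanishes n (standardFamily W M lam b) V] := by
  tfae_have 1 → 3 := fun h => ⟨(isGood_of_hasFlag hQ T h).2.subset (support_subset M V),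
    hM.extVanishes V (isGood_of_hasFlag hQ T h).1⟩
  tfae_have 3 → 2 := fun h => ⟨h.1, fun lam b => h.2 lam b 1 le_rfl⟩
  tfae_have 2 → 1 := fun h => T.hasFlag_of_isGood hV hV' (hM.isGood V hV' h.2)
    (h.1.subset (hM.weightSupport_subset V hV'))
  tfae_finish

omit hM in
lemma isGood_iff_hasFlag_quot : IsGood W Q V ↔ ∀ Γ : Set Λ, Γ.Finite → IsLowerSet Γ →
    HasFlag (IsLayerOf W Q) (upperSub W Γ V).quot :=
  ⟨fun h _ hfin hΓ => (T.hasFlag_quot_upperSub hV hV' h hfin hΓ).mono fun _ _ h => h.2,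
    T.isGood_of_hasFlag_quot hQ⟩

lemma tfae_hasFlag_quot : List.TFAE [
    ∀ Γ : Set Λ, Γ.Finite → IsLowerSet Γ → HasFlag (IsLayerOf W Q) (upperSub W Γ V).quot,
    IsGood W Q V,
    ∀ lam b, ExtVanishes 1 (standardFamily W M lam b) V,
    ∀ lam b, ∀ n ≥ 1, ExtVanishes n (standardFamily W M lam b) V] := by
  tfae_have 1 ↔ 2 := (isGood_iff_hasFlag_quot T hQ hV hV').symm
  tfae_have 2 → 4 := hM.extVanishes V
  tfae_have 4 → 3 := fun h lam b => h lam b 1 le_rfl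
  tfae_have 3 → 2 := hM.isGood V hV'
  tfae_finish

lemma upperSub_properties (h : IsGood W Q V) {Γ : Set Λ} (hfin : Γ.Finite) (hΓ : IsLowerSet Γ) :
    (∀ Γ' : Set Λ, Γ'.Finite → IsLowerSet Γ' →
      HasFlag (IsLayerOf W Q) (upperSub W Γ' (upperSub W Γ V).quot).quot) ∧
    (∀ Γ' : Set Λ, Γ'.Finite → IsLowerSet Γ' →
      HasFlag (IsLayerOf W Q) (upperSub W Γ' (upperSub W Γ V).toGMod).quot) ∧
    ∀ lam b,
      HasQDim (standardFamily W M lam b) V ∧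
      HasQDim (standardFamily W M lam b) (upperSub W Γ V).quot ∧
      HasQDim (standardFamily W M lam b) (upperSub W Γ V).toGMod ∧
      (lam ∈ Γ →
        qDimHom (standardFamily W M lam b) (upperSub W Γ V).quot =
          qDimHom (standardFamily W M lam b) V ∧
        qDimHom (standardFamily W M lam b) (upperSub W Γ V).toGMod = 0) ∧
      (lam ∉ Γ →
        qDimHom (standardFamily W M lam b) (upperSub W Γ V).quot = 0 ∧
        qDimHom (standardFamily W M lam b) (upperSub W Γ V).toGMod =
          qDimHom (standardFamily W M lam b) V) := by
  have hq := hV.of_surjective _ (upperSub W Γ V).mkQ_surjective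
  have hq' := hV'.of_surjective _ (upperSub W Γ V).mkQ_surjective
  have hs := hV.of_injective _ (upperSub W Γ V).ι_injective
  have hs' := hV'.of_injective _ (upperSub W Γ V).ι_injective
  obtain ⟨h1, h2⟩ := T.isGood_upperSub hQ hV hV' h hfin hΓ
  refine ⟨(isGood_iff_hasFlag_quot T hQ hq hq').1 h1, (isGood_iff_hasFlag_quot T hQ hs hs').1 h2,
    fun lam b => ?_⟩
  obtain ⟨s, d, x, hx⟩ := hM.exists_generator lam b
  refine ⟨hasQDim_standardize hx hV hV', hasQDim_standardize hx hq hq',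
    hasQDim_standardize hx hs hs', fun hlam => ⟨?_, ?_⟩, fun hlam => ⟨?_, ?_⟩⟩
  · exact (qDimHom_standardize_eq _ (T.weightMap_upperSub_π_bijective hΓ hlam V)).symm
  · exact qDimHom_standardize_eq_zero (weightPart_upperSub_eq_zero hlam V)
  · exact qDimHom_standardize_eq_zero (weightPart_quot_eq_zero hΓ hlam V)
  · exact qDimHom_standardize_eq _ (weightMap_upperSub_ι_bijective hΓ hlam V)

end GMod.IsTestFamily

end Families

/-! ### Restriction along homomorphisms of algebras -/

section Pullback

variable {k : Type u} [Field k] {I J : Type u}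

/-- A homomorphism of locally unital graded algebras. -/
structure LUGAlgebra.Map (C : LUGAlgebra k I) (D : LUGAlgebra k J) where
  idx : I → J
  app : ∀ {i j : I} {d : ℤ}, C.blk i j d →ₗ[k] D.blk (idx i) (idx j) d
  map_one : ∀ i, app (C.one i) = D.one (idx i)
  map_mul : ∀ {i j l : I} {d e f : ℤ} (h : d + e = f) (a : C.blk i j d) (b : C.blk j l e),
    app (C.mul h a b) = D.mul h (app a) (app b)

/-- Restriction of modules along a homomorphism of algebras. -/
def LUGAlgebra.Map.pullback {C : LUGAlgebra k I} {D : LUGAlgebra k J} (α : C.Map D) :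
    GMod D ⥤ GMod C where
  obj M :=
    { pc := fun i d => M.pc (α.idx i) d
      act := fun h => (M.act h).comp α.app
      one_act := fun v => by rw [LinearMap.comp_apply, α.map_one, M.one_act]
      mul_act := fun h₁ h₂ h₃ h₄ a b v => by
        rw [LinearMap.comp_apply, α.map_mul, M.mul_act h₁ h₂ h₃ h₄]
        rfl }
  map f := ⟨fun i d => f.app (α.idx i) d, fun h a v => f.app_act h (α.app a) v⟩

end Pullback

/-! ### Triangular basis, Cartan subalgebras and weight parts of the truncation -/

section Truncation

variable {k : Type u} [Field k] {I : Type u} {A : LUGAlgebra k I} {Λ : Type v} {W : Weights I Λ}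

namespace Weights

variable {Γ : Set Λ} {lam : Γ}

/-- A special index of weight `λ ∈ Γ` as an index of the truncation to `Γ`. -/
abbrev toRestrict (s : W.specialOver {lam.1}) : (W.restrict Γ).specialOver {lam} :=
  ⟨⟨s.1, s.2.1, Set.mem_of_eq_of_mem s.2.2 lam.2⟩, trivial, Subtype.ext s.2.2⟩

/-- A special index of weight `λ` of the truncation to `Γ` as an index of the original algebra. -/
abbrev ofRestrict (t : (W.restrict Γ).specialOver {lam}) : W.specialOver {lam.1} :=
  ⟨t.1.1, t.1.2.1, congrArg Subtype.val (show _ = lam from t.2.2)⟩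

end Weights

variable [PartialOrder Λ]

namespace TriangularBasis

variable (T : TriangularBasis A W) {Γ : Set Λ}

lemma mul_mem_idealGen_trunc (hΓ : IsLowerSet Γ) {lam : Γ} {s j : W.specialOver Γ} {t : I}
    (ht : t ∈ W.specialOver (Set.Iio lam.1)) {c e d : ℤ} (h : c + e = d) (a : A.blk s t c)
    (b : A.blk t j e) : A.mul h a b ∈ ((A.trunc (W.specialOver Γ)).idealGen
      ((W.restrict Γ).specialOver {mu | ¬ lam ≤ mu})).carrier s j d := by
  let t' : W.specialOver Γ := ⟨t, ht.1, hΓ (le_of_lt ht.2) lam.2⟩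
  have ht' : t' ∈ (W.restrict Γ).specialOver {mu | ¬ lam ≤ mu} :=
    ⟨trivial, fun hle => lt_irrefl _ (lt_of_lt_of_le ht.2 hle)⟩
  exact LUGAlgebra.mul_mem_idealGen (A := A.trunc (W.specialOver Γ)) ht'
    (i := s) (j := j) h a b

include T in
-- In rows of weight λ the ideal of the weights ≱ λ is already generated by the weights < λ, by
-- `idealGen_left_le`, and these belong to the lower set Γ. Hence A_λ is the same for A and A_Γ.
lemma mem_idealGen_trunc (hΓ : IsLowerSet Γ) {lam : Γ} (s j : W.specialOver Γ)
    (hs : W.dot ⟨s.1, s.2.1⟩ = lam.1) (d : ℤ) (a : A.blk s j d) :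
    a ∈ (A.idealGen (W.specialOver {mu | ¬ lam.1 ≤ mu})).carrier s j d ↔
      a ∈ ((A.trunc (W.specialOver Γ)).idealGen
        ((W.restrict Γ).specialOver {mu | ¬ lam ≤ mu})).carrier s j d := by
  -- P is the ideal of the truncation viewed inside `A.blk s j d`, which agrees with the block of
  -- the truncation only after unfolding.
  obtain ⟨P, hP⟩ : ∃ P : Submodule k (A.blk s j d), P = ((A.trunc (W.specialOver Γ)).idealGen
    ((W.restrict Γ).specialOver {mu | ¬ lam ≤ mu})).carrier s j d := ⟨_, rfl⟩
  have hmem : ∀ x, x ∈ P ↔ x ∈ ((A.trunc (W.specialOver Γ)).idealGen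
      ((W.restrict Γ).specialOver {mu | ¬ lam ≤ mu})).carrier s j d := by
    subst hP
    exact fun x => Iff.rfl
  refine Iff.trans ?_ (hmem a)
  constructor
  · intro ha
    have hle := T.idealGen_left_le ⟨s.1, s.2.1⟩ j d
    rw [hs] at hle
    have hle' : (A.idealGen (W.specialOver (Set.Iio lam.1))).carrier s j d ≤ P :=
      LUGAlgebra.idealGen_le fun t ht c e h a b => (hmem _).2 (mul_mem_idealGen_trunc hΓ ht h a b)
    exact hle' (hle ha)
  · intro ha
    have hle := LUGAlgebra.idealGen_le (A := A.trunc (W.specialOver Γ))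
      (S := (W.restrict Γ).specialOver {mu | ¬ lam ≤ mu}) (i := s) (j := j)
      (P := (A.idealGen (W.specialOver {mu | ¬ lam.1 ≤ mu})).carrier s j d)
      fun t ht c e h a b =>
        LUGAlgebra.mul_mem_idealGen (A := A) (t := t.1)
          (show t.1 ∈ W.specialOver {mu | ¬ lam.1 ≤ mu} from ⟨t.2.1, fun hle => ht.2 hle⟩) h a b
    exact hle ((hmem a).1 ha)

include T in
-- A basis element x h y of 1_i A 1_j passes through a weight at most that of i, hence in Γ, so no
-- basis element is lost.
lemma span_trunc (hΓ : IsLowerSet Γ) (i j : W.specialOver Γ) (d : ℤ) : Submodule.span k (Set.range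
    (fun p : Σ (s t : (W.restrict Γ).S) (c : {c : ℤ × ℤ × ℤ // c.1 + c.2.1 + c.2.2 = d}),
        T.X i ⟨s.1.1, s.1.2.1⟩ c.1.1 × T.H ⟨s.1.1, s.1.2.1⟩ ⟨t.1.1, t.1.2.1⟩ c.1.2.1 ×
          T.Y ⟨t.1.1, t.1.2.1⟩ j c.1.2.2 =>
      A.mul p.2.2.1.2 (A.mul rfl p.2.2.2.1.1 p.2.2.2.2.1.1) p.2.2.2.2.2.1)) = ⊤ := by
  rw [eq_top_iff]
  rintro a -
  refine T.induction ?_ a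
  intro s t c₁ c₂ c₃ c₁₂ h₁ h₂ x h y hx hh hy
  have hs : W.dot s ∈ Γ := by
    rcases T.X_cases (s := ⟨i.1, i.2.1⟩) hx with ⟨rfl, -, -⟩ | hlt
    · exact i.2.2
    · exact hΓ hlt.le i.2.2
  have ht : W.dot t ∈ Γ := T.dot_eq_of_mem_H hh ▸ hs
  subst h₁
  exact Submodule.subset_span ⟨⟨⟨⟨s.1, s.2, hs⟩, trivial⟩, ⟨⟨t.1, t.2, ht⟩, trivial⟩,
    ⟨(c₁, c₂, c₃), h₂⟩, ⟨x, hx⟩, ⟨h, hh⟩, ⟨y, hy⟩⟩, rfl⟩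
/-- The triangular basis of the truncation of `A` to a lower set of weights. -/
def trunc (hΓ : IsLowerSet Γ) : TriangularBasis (A.trunc (W.specialOver Γ)) (W.restrict Γ) where
  lower_finite lam := (T.lower_finite lam.1).preimage Subtype.val_injective.injOn
  fiber_finite lam := by
    refine Set.Finite.subset ((T.fiber_finite lam.1).preimage (f := fun s : (W.restrict Γ).S =>
      (⟨s.1.1, s.1.2.1⟩ : W.S)) fun s _ t _ h => ?_) fun s hs => congrArg Subtype.val hs
    exact Subtype.ext (Subtype.ext (congrArg (fun x : W.S => x.1) h))
  X i s d := T.X i ⟨s.1.1, s.1.2.1⟩ d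
  H s t d := T.H ⟨s.1.1, s.1.2.1⟩ ⟨t.1.1, t.1.2.1⟩ d
  Y t j d := T.Y ⟨t.1.1, t.1.2.1⟩ j d
  basis_linearIndependent i j d := by
    let g : (Σ (s t : (W.restrict Γ).S) (c : {c : ℤ × ℤ × ℤ // c.1 + c.2.1 + c.2.2 = d}),
        T.X i ⟨s.1.1, s.1.2.1⟩ c.1.1 × T.H ⟨s.1.1, s.1.2.1⟩ ⟨t.1.1, t.1.2.1⟩ c.1.2.1 ×
          T.Y ⟨t.1.1, t.1.2.1⟩ j c.1.2.2) →
        (Σ (s t : W.S) (c : {c : ℤ × ℤ × ℤ // c.1 + c.2.1 + c.2.2 = d}),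
          T.X i s c.1.1 × T.H s t c.1.2.1 × T.Y t j c.1.2.2) :=
      fun p => ⟨⟨p.1.1.1, p.1.1.2.1⟩, ⟨p.2.1.1.1, p.2.1.1.2.1⟩, p.2.2.1, p.2.2.2⟩
    have hg : Function.Injective g := by
      rintro ⟨s, t, x⟩ ⟨s', t', x'⟩ h
      obtain rfl : s = s' := Subtype.ext (Subtype.ext (congrArg (fun y => y.1.1) h))
      have h1 := eq_of_heq (Sigma.mk.inj h).2
      obtain rfl : t = t' := Subtype.ext (Subtype.ext (congrArg (fun y => y.1.1) h1))
      have h2 := eq_of_heq (Sigma.mk.inj h1).2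
      obtain rfl : x = x' := h2
      rfl
    exact (T.basis_linearIndependent i j d).comp g hg
  basis_span := T.span_trunc hΓ
  X_self_zero s := T.X_self_zero ⟨s.1.1, s.1.2.1⟩
  X_self_ne_zero s := T.X_self_ne_zero ⟨s.1.1, s.1.2.1⟩
  Y_self_zero s := T.Y_self_zero ⟨s.1.1, s.1.2.1⟩
  Y_self_ne_zero s := T.Y_self_ne_zero ⟨s.1.1, s.1.2.1⟩
  X_triangular s t hne := T.X_triangular ⟨s.1.1, s.1.2.1⟩ ⟨t.1.1, t.1.2.1⟩ fun h =>
    hne (Subtype.ext (Subtype.ext (congrArg (fun x : W.S => x.1) h)))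
  H_diagonal s t hne d h := Subtype.ext (T.H_diagonal ⟨s.1.1, s.1.2.1⟩ ⟨t.1.1, t.1.2.1⟩ (fun h =>
    hne (Subtype.ext (Subtype.ext (congrArg (fun x : W.S => x.1) h)))) d h)
  Y_triangular s t hne := T.Y_triangular ⟨s.1.1, s.1.2.1⟩ ⟨t.1.1, t.1.2.1⟩ fun h =>
    hne (Subtype.ext (Subtype.ext (congrArg (fun x : W.S => x.1) h)))
  finite_special i hi := (hi trivial).elim

include T

open GMod

/-- Only the weights < λ have to be tested, and they are present in the truncation. -/
lemma mem_upperSub_trunc (hΓ : IsLowerSet Γ) {lam : Γ} {V : GMod A} (s : W.specialOver Γ)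
    (hs : W.dot ⟨s.1, s.2.1⟩ = lam.1) (d : ℤ) (v : V.pc s d) :
    v ∈ (upperSub W {mu | ¬ lam.1 ≤ mu} V).carrier s d ↔
      v ∈ (upperSub (W.restrict Γ) {mu | ¬ lam ≤ mu} (jTrunc (W.specialOver Γ) V)).carrier s d := by
  constructor
  · intro hv t ht
    exact hv t.1 ⟨t.2.1, fun hle => ht.2 hle⟩
  · intro hv
    refine T.mem_upperSub_not_le (s := ⟨s.1, s.2.1⟩) hs fun t ht => ?_
    exact hv ⟨t, ht.1, hΓ (le_of_lt ht.2) lam.2⟩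
      ⟨trivial, fun hle => lt_irrefl _ (lt_of_lt_of_le ht.2 hle)⟩

/-- The comparison of the algebras `A_λ` of `A` and of its truncation. -/
def cartanToTrunc (hΓ : IsLowerSet Γ) (lam : Γ) :
    (A.cartan W lam.1).Map ((A.trunc (W.specialOver Γ)).cartan (W.restrict Γ) lam) where
  idx := Weights.toRestrict
  app {s t d} := Submodule.mapQ _ _ LinearMap.id
    fun a ha => (T.mem_idealGen_trunc hΓ (Weights.toRestrict s).1 (Weights.toRestrict t).1
      s.2.2 d a).1 ha
  map_one _ := rfl
  map_mul {s t r d e f} h a b := by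
    obtain ⟨a, rfl⟩ := cartanMk_surjective W lam.1 a
    obtain ⟨b, rfl⟩ := cartanMk_surjective W lam.1 b
    rfl

/-- The comparison of the algebras `A_λ` of the truncation of `A` and of `A`. -/
def cartanOfTrunc (hΓ : IsLowerSet Γ) (lam : Γ) :
    ((A.trunc (W.specialOver Γ)).cartan (W.restrict Γ) lam).Map (A.cartan W lam.1) where
  idx := Weights.ofRestrict
  app {s t d} := Submodule.mapQ _ _ LinearMap.id
    fun a ha => (T.mem_idealGen_trunc hΓ s.1 t.1 (Weights.ofRestrict s).2.2 d a).2 ha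
  map_one _ := rfl
  map_mul {s t r d e f} h a b := by
    obtain ⟨a, rfl⟩ := cartanMk_surjective (W.restrict Γ) lam a
    obtain ⟨b, rfl⟩ := cartanMk_surjective (W.restrict Γ) lam b
    rfl

/-- The modules over the algebras `A_λ` of `A` and of its truncation. -/
noncomputable def cartanEquiv (hΓ : IsLowerSet Γ) (lam : Γ) :
    GMod (A.cartan W lam.1) ≌ GMod ((A.trunc (W.specialOver Γ)).cartan (W.restrict Γ) lam) :=
  CategoryTheory.Equivalence.mk (T.cartanOfTrunc hΓ lam).pullback (T.cartanToTrunc hΓ lam).pullback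
    (NatIso.ofComponents (fun M => isoOfBijective
      ⟨fun _ _ => LinearMap.id, fun {s t d e f} h a v => by
        obtain ⟨a, rfl⟩ := cartanMk_surjective W lam.1 a
        rfl⟩ fun _ _ => Function.bijective_id) fun _ => rfl)
    (NatIso.ofComponents (fun M => isoOfBijective
      ⟨fun _ _ => LinearMap.id, fun {s t d e f} h a v => by
        obtain ⟨a, rfl⟩ := cartanMk_surjective (W.restrict Γ) lam a
        rfl⟩ fun _ _ => Function.bijective_id) fun _ => rfl)

/-- The weight parts of a module and of its truncation agree. -/
noncomputable def weightPartTruncIso (hΓ : IsLowerSet Γ) (lam : Γ) (V : GMod A) :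
    weightPart (W.restrict Γ) lam (jTrunc (W.specialOver Γ) V) ≅
      (T.cartanOfTrunc hΓ lam).pullback.obj (weightPart W lam.1 V) :=
  isoOfBijective
    ⟨fun t d =>
      { toFun := fun v =>
          ⟨v.1, (T.mem_upperSub_trunc hΓ t.1 (Weights.ofRestrict t).2.2 d v.1).2 v.2⟩
        map_add' := fun _ _ => rfl
        map_smul' := fun _ _ => rfl }, fun {s t d e f} h a v => by
        obtain ⟨a, rfl⟩ := cartanMk_surjective (W.restrict Γ) lam a
        rfl⟩
    fun t d => ⟨fun v w h => Subtype.ext (congrArg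
      (fun z : (weightPart W lam.1 V).pc (Weights.ofRestrict t) d => weightVal z) h),
      fun v => ⟨⟨v.1, (T.mem_upperSub_trunc hΓ t.1 (Weights.ofRestrict t).2.2 d v.1).1 v.2⟩, rfl⟩⟩

lemma injective_weightPart_trunc_iff (hΓ : IsLowerSet Γ) (lam : Γ) (V : GMod A) :
    Injective (weightPart (W.restrict Γ) lam (jTrunc (W.specialOver Γ) V)) ↔
      Injective (weightPart W lam.1 V) := by
  rw [← (T.cartanEquiv hΓ lam).map_injective_iff]
  exact ⟨Injective.of_iso (T.weightPartTruncIso hΓ lam V),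
    Injective.of_iso (T.weightPartTruncIso hΓ lam V).symm⟩

end TriangularBasis

end Truncation

/-! ### Flags of truncations -/

section TruncationFlags

variable {k : Type u} [Field k] {I : Type u} {A : LUGAlgebra k I} {Λ : Type v} {W : Weights I Λ}
  [PartialOrder Λ]

namespace GMod

/-- Truncation of homomorphisms. -/
def jTruncMap (S : Set I) {M N : GMod A} (f : M ⟶ N) : jTrunc S M ⟶ jTrunc S N :=
  ⟨fun t d => f.app t d, fun h a v => f.app_act h a v⟩

end GMod

namespace TriangularBasis

open GMod

variable (T : TriangularBasis A W) {Γ : Set Λ} (hΓ : IsLowerSet Γ)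

include T hΓ

/-- The weight parts of a truncation, as a linear map. -/
noncomputable def ofTruncPart {lam : Γ} {V : GMod A} (s : W.specialOver {lam.1}) (e : ℤ) :
    (weightPart (W.restrict Γ) lam (jTrunc (W.specialOver Γ) V)).pc (Weights.toRestrict s) e →ₗ[k]
      (weightPart W lam.1 V).pc s e :=
  (T.weightPartTruncIso hΓ lam V).hom.app (Weights.toRestrict s) e

/-- Truncation is exact and keeps the weight part at λ ∈ Γ, so a lift found over A_Γ is a lift over
A. -/
lemma isAcyclic_of_trunc {lam : Γ} {V : GMod A}
    (h : IsAcyclic (W.restrict Γ) lam (jTrunc (W.specialOver Γ) V)) : IsAcyclic W lam.1 V := by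
  intro E C f g hf hg hfg s d c
  obtain ⟨c', hc'⟩ := exists_weightVal (W := W.restrict Γ) (lam := lam)
    (M := jTrunc (W.specialOver Γ) C) (s := Weights.toRestrict s) (d := d)
    (v := weightVal (W := W) (s := s) c)
    ((T.mem_upperSub_trunc hΓ (Weights.toRestrict s).1 s.2.2 d _).1 (weightVal_mem c))
  obtain ⟨y, hy⟩ := h _ _ (jTruncMap _ f) (jTruncMap _ g) (fun t d => hf t d) (fun t d => hg t d)
    (fun t d => hfg t d) (Weights.toRestrict s) d c'
  exact ⟨T.ofTruncPart hΓ s d y, weightVal_injective ((congrArg weightVal hy).trans hc')⟩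

/-- Acyclicity over A_Γ quantifies over all exact sequences of A_Γ-modules, whereas weight lifts
concern V alone. They are therefore the condition that is carried from A to A_Γ; a lower set of Γ is
also a lower set of Λ. -/
lemma hasAllWeightLifts_trunc {V : GMod A} (hV : HasAllWeightLifts W V) :
    HasAllWeightLifts (W.restrict Γ) (jTrunc (W.specialOver Γ) V) := by
  intro Γ' lam hfin hΓ' hlam hIio i d φ
  obtain ⟨w, hw, hw'⟩ := hV (Subtype.val '' Γ') lam.1 (hfin.image _)
    (by
      rintro _ b hab ⟨a, ha, rfl⟩
      exact ⟨⟨b, hΓ hab a.2⟩, hΓ' (show (⟨b, hΓ hab a.2⟩ : Γ) ≤ a from hab) ha, rfl⟩)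
    (by
      rintro ⟨a, ha, h⟩
      exact hlam (Subtype.ext h ▸ ha))
    (fun b hb => ⟨⟨b, hΓ (le_of_lt hb) lam.2⟩, hIio hb, rfl⟩) i d
    (costdMk (fun p => (T.ofTruncPart hΓ p.1.1 p.1.2.2).comp
        (costdEval φ (Weights.toRestrict p.1.1) p.2))
      (fun p a ha => by
        have h0 := costdEval_eq_zero φ (Weights.toRestrict p.1.1) p.2 (a := a)
          ((T.mem_idealGen_trunc hΓ (Weights.toRestrict p.1.1).1 i p.1.1.2.2 _ a).1 ha)
        exact (congrArg (T.ofTruncPart hΓ p.1.1 p.1.2.2) h0).trans (map_zero _))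
      (fun s t x c y e z hx he hz hxe b a => by
        have h0 := costdEval_mul φ (Weights.toRestrict s) (Weights.toRestrict t) hx he hz hxe b a
        exact congrArg (T.ofTruncPart hΓ s z) h0))
  refine ⟨w, fun s hs => hw s ⟨s.2.1, _, hs.2, rfl⟩, fun s c e h a => ?_⟩
  exact hw' (Weights.ofRestrict s) c e h a

variable {Q : ∀ lam, GMod (A.cartan W lam) → Prop}
  {Q' : ∀ lam, GMod ((A.trunc (W.specialOver Γ)).cartan (W.restrict Γ) lam) → Prop}
  {V : GMod A} (hQQ : ∀ lam : Γ, Q' lam (weightPart (W.restrict Γ) lam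
    (jTrunc (W.specialOver Γ) V)) ↔ Q lam.1 (weightPart W lam.1 V))

include hQQ

/-- Acyclicity over A_Γ is recovered from the weight lifts, and the weight support is finite because
Γ is. -/
lemma hasFlag_trunc (hV : V.LocallyFiniteDimensional) (hV' : V.BoundedAbove) (hfin : Γ.Finite)
    (h : IsGood W Q V) :
    HasFlag (IsLayerOf (W.restrict Γ) Q') (jTrunc (W.specialOver Γ) V) := by
  have : Finite Γ := hfin
  exact (T.trunc hΓ).hasFlag_of_isGood (fun t d => hV t d) (fun t => hV' t)
    ⟨(T.trunc hΓ).isAcyclic_of_hasAllWeightLifts (T.hasAllWeightLifts_trunc hΓ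
      (T.hasAllWeightLifts_of_isAcyclic h.isAcyclic)), fun lam => (hQQ lam).2 (h.mem _)⟩
    (Set.toFinite _)

lemma isGood_of_hasFlag_trunc (hQ' : ∀ lam, IsExtensionClosed (Q' lam))
    (h : HasFlag (IsLayerOf (W.restrict Γ) Q') (jTrunc (W.specialOver Γ) V)) {lam : Λ}
    (hlam : lam ∈ Γ) : IsAcyclic W lam V ∧ Q lam (weightPart W lam V) :=
  have h' := (isGood_of_hasFlag hQ' (T.trunc hΓ) h).1
  ⟨T.isAcyclic_of_trunc hΓ (h'.isAcyclic ⟨lam, hlam⟩), (hQQ ⟨lam, hlam⟩).1 (h'.mem _)⟩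

end TriangularBasis

namespace GMod

variable (T : TriangularBasis A W) {V : GMod A} (hV : V.LocallyFiniteDimensional)
  (hV' : V.BoundedAbove)

include T hV hV'

/-- For the converse, the condition at λ is read off from the truncation to {μ ≤ λ}. -/
lemma isGood_iff_hasNablaFlag_trunc : IsGood W (fun _ N => Injective N) V ↔
    ∀ Γ : Set Λ, Γ.Finite → IsLowerSet Γ →
      HasNablaFlag (W.restrict Γ) (jTrunc (W.specialOver Γ) V) := by
  refine ⟨fun h Γ hfin hΓ => T.hasFlag_trunc hΓ (Q' := fun _ N => Injective N)
    (fun lam => T.injective_weightPart_trunc_iff hΓ lam V) hV hV' hfin h, fun h => ?_⟩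
  have H := fun lam : Λ => T.isGood_of_hasFlag_trunc (isLowerSet_Iic lam)
    (Q := fun _ N => Injective N) (Q' := fun _ N => Injective N)
    (fun mu => T.injective_weightPart_trunc_iff (isLowerSet_Iic lam) mu V)
    (fun _ => isExtensionClosed_injective) (h _ (T.lower_finite lam) (isLowerSet_Iic lam))
    (Set.mem_Iic.2 le_rfl)
  exact ⟨fun lam => (H lam).1, fun lam => (H lam).2⟩

omit T hV hV' in
lemma isBarNablaLayer_iff {lam : Λ} {M : GMod A} :
    IsBarNablaLayer W lam M ↔ IsLayerOf W (fun _ _ => True) lam M := by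
  simp [IsBarNablaLayer, IsLayerOf]

omit T hV hV' in
lemma hasBarNablaFlag_iff {M : GMod A} :
    HasBarNablaFlag W M ↔ HasFlag (IsLayerOf W fun _ _ => True) M :=
  ⟨HasFlag.mono fun _ _ => isBarNablaLayer_iff.1, HasFlag.mono fun _ _ => isBarNablaLayer_iff.2⟩

lemma isGood_iff_hasBarNablaFlag_trunc : IsGood W (fun _ _ => True) V ↔
    ∀ Γ : Set Λ, Γ.Finite → IsLowerSet Γ →
      HasBarNablaFlag (W.restrict Γ) (jTrunc (W.specialOver Γ) V) := by
  refine ⟨fun h Γ hfin hΓ => hasBarNablaFlag_iff.2 (T.hasFlag_trunc hΓ (Q' := fun _ _ => True)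
    (fun _ => Iff.rfl) hV hV' hfin h), fun h => ⟨fun lam => ?_, fun _ => trivial⟩⟩
  exact (T.isGood_of_hasFlag_trunc (isLowerSet_Iic lam) (Q := fun _ _ => True)
    (Q' := fun _ _ => True) (fun _ => Iff.rfl) (fun _ => isExtensionClosed_true)
    (hasBarNablaFlag_iff.1 (h _ (T.lower_finite lam) (isLowerSet_Iic lam)))
    (Set.mem_Iic.2 le_rfl)).1

omit T hV hV' in
lemma hasDescendingBarNablaFlag_iff {M : GMod A} :
    HasDescendingBarNablaFlag W M ↔ ∀ Γ : Set Λ, Γ.Finite → IsLowerSet Γ →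
      HasFlag (IsLayerOf W fun _ _ => True) (upperSub W Γ M).quot :=
  ⟨fun h Γ hfin hΓ => hasBarNablaFlag_iff.1 (h Γ hfin hΓ),
    fun h Γ hfin hΓ => hasBarNablaFlag_iff.2 (h Γ hfin hΓ)⟩

end GMod

end TruncationFlags

end GradedTriangular

/-! ### The theorem -/

theorem mainTheorem8 {k : Type u} [Field k] [IsAlgClosed k] {I : Type u} {Λ : Type v}
    [PartialOrder Λ] (A : LUGAlgebra k I) (hA : A.LocallyFiniteDimensional) (hA' : A.BoundedBelow)
    (W : Weights I Λ) (T : TriangularBasis A W)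
    {B : Λ → Type w} (L : ∀ lam, B lam → GMod (A.cartan W lam))
    (hL : ∀ lam, GMod.IsFullSetOfIrreducibles (L lam))
    (P : ∀ lam, B lam → GMod (A.cartan W lam)) (p : ∀ lam (b : B lam), P lam b ⟶ L lam b)
    (hp : ∀ lam (b : B lam), GMod.IsProjectiveCover (p lam b))
    (V : GMod A) (hV : V.LocallyFiniteDimensional) (hV' : V.BoundedAbove) :
    -- finite `∇`-flags
    List.TFAE [
      GMod.HasNablaFlag W V,
      (GMod.support (GMod.standardFamily W L) V).Finite ∧
        ∀ lam b, GMod.ExtVanishes 1 (GMod.standardFamily W L lam b) V,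
      (GMod.support (GMod.standardFamily W L) V).Finite ∧
        ∀ lam b, ∀ n ≥ 1, GMod.ExtVanishes n (GMod.standardFamily W L lam b) V] ∧
    -- finite `∇̄`-flags
    List.TFAE [
      GMod.HasBarNablaFlag W V,
      (GMod.support (GMod.standardFamily W P) V).Finite ∧
        ∀ lam b, GMod.ExtVanishes 1 (GMod.standardFamily W P lam b) V,
      (GMod.support (GMod.standardFamily W P) V).Finite ∧
        ∀ lam b, ∀ n ≥ 1, GMod.ExtVanishes n (GMod.standardFamily W P lam b) V] ∧
    -- descending `∇`-flags
    List.TFAE [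
      GMod.HasDescendingNablaFlag W V,
      ∀ Γ : Set Λ, Γ.Finite → IsLowerSet Γ →
        GMod.HasNablaFlag (W.restrict Γ) (GMod.jTrunc (W.specialOver Γ) V),
      ∀ lam b, GMod.ExtVanishes 1 (GMod.standardFamily W L lam b) V,
      ∀ lam b, ∀ n ≥ 1, GMod.ExtVanishes n (GMod.standardFamily W L lam b) V] ∧
    (GMod.HasDescendingNablaFlag W V → ∀ Γ : Set Λ, Γ.Finite → IsLowerSet Γ →
      GMod.HasDescendingNablaFlag W (GMod.upperSub W Γ V).quot ∧
      GMod.HasDescendingNablaFlag W (GMod.upperSub W Γ V).toGMod ∧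
      ∀ lam b,
        GMod.HasQDim (GMod.standardFamily W L lam b) V ∧
        GMod.HasQDim (GMod.standardFamily W L lam b) (GMod.upperSub W Γ V).quot ∧
        GMod.HasQDim (GMod.standardFamily W L lam b) (GMod.upperSub W Γ V).toGMod ∧
        (lam ∈ Γ →
          GMod.qDimHom (GMod.standardFamily W L lam b) (GMod.upperSub W Γ V).quot =
            GMod.qDimHom (GMod.standardFamily W L lam b) V ∧
          GMod.qDimHom (GMod.standardFamily W L lam b) (GMod.upperSub W Γ V).toGMod = 0) ∧
        (lam ∉ Γ →
          GMod.qDimHom (GMod.standardFamily W L lam b) (GMod.upperSub W Γ V).quot = 0 ∧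
          GMod.qDimHom (GMod.standardFamily W L lam b) (GMod.upperSub W Γ V).toGMod =
            GMod.qDimHom (GMod.standardFamily W L lam b) V)) ∧
    -- descending `∇̄`-flags
    List.TFAE [
      GMod.HasDescendingBarNablaFlag W V,
      ∀ Γ : Set Λ, Γ.Finite → IsLowerSet Γ →
        GMod.HasBarNablaFlag (W.restrict Γ) (GMod.jTrunc (W.specialOver Γ) V),
      ∀ lam b, GMod.ExtVanishes 1 (GMod.standardFamily W P lam b) V,
      ∀ lam b, ∀ n ≥ 1, GMod.ExtVanishes n (GMod.standardFamily W P lam b) V] ∧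
    (GMod.HasDescendingBarNablaFlag W V → ∀ Γ : Set Λ, Γ.Finite → IsLowerSet Γ →
      GMod.HasDescendingBarNablaFlag W (GMod.upperSub W Γ V).quot ∧
      GMod.HasDescendingBarNablaFlag W (GMod.upperSub W Γ V).toGMod ∧
      ∀ lam b,
        GMod.HasQDim (GMod.standardFamily W P lam b) V ∧
        GMod.HasQDim (GMod.standardFamily W P lam b) (GMod.upperSub W Γ V).quot ∧
        GMod.HasQDim (GMod.standardFamily W P lam b) (GMod.upperSub W Γ V).toGMod ∧
        (lam ∈ Γ →
          GMod.qDimHom (GMod.standardFamily W P lam b) (GMod.upperSub W Γ V).quot =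
            GMod.qDimHom (GMod.standardFamily W P lam b) V ∧
          GMod.qDimHom (GMod.standardFamily W P lam b) (GMod.upperSub W Γ V).toGMod = 0) ∧
        (lam ∉ Γ →
          GMod.qDimHom (GMod.standardFamily W P lam b) (GMod.upperSub W Γ V).quot = 0 ∧
          GMod.qDimHom (GMod.standardFamily W P lam b) (GMod.upperSub W Γ V).toGMod =
            GMod.qDimHom (GMod.standardFamily W P lam b) V)) := by
  have hQ : ∀ lam, GMod.IsExtensionClosed fun N : GMod (A.cartan W lam) => Injective N :=
    fun _ => GMod.isExtensionClosed_injective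
  have hQ' : ∀ lam, GMod.IsExtensionClosed fun _ : GMod (A.cartan W lam) => True :=
    fun _ => GMod.isExtensionClosed_true
  -- The ∇ statements are the case of injective weight parts tested by the L(b), and the ∇̄
  -- statements are the case of arbitrary weight parts tested by the P(b).
  have hI := T.isTestFamily_irreducible hL hA hA'
  have hP := T.isTestFamily_projective hL hp
  have hD := hI.tfae_hasFlag_quot T hQ hV hV'
  have hD' := hP.tfae_hasFlag_quot T hQ' hV hV'
  refine ⟨hI.tfae_hasFlag T hQ hV hV', ?_, ?_, fun h Γ hfin hΓ =>
    hI.upperSub_properties T hQ hV hV' ((hD.out 0 1).1 h) hfin hΓ, ?_, fun h Γ hfin hΓ => ?_⟩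
  · rw [GMod.hasBarNablaFlag_iff]
    exact hP.tfae_hasFlag T hQ' hV hV'
  · rw [← GMod.isGood_iff_hasNablaFlag_trunc T hV hV']
    exact hD
  · rw [← GMod.isGood_iff_hasBarNablaFlag_trunc T hV hV', GMod.hasDescendingBarNablaFlag_iff]
    exact hD'
  · rw [GMod.hasDescendingBarNablaFlag_iff, GMod.hasDescendingBarNablaFlag_iff]
    exact hP.upperSub_properties T hQ' hV hV'
      ((hD'.out 0 1).1 (GMod.hasDescendingBarNablaFlag_iff.1 h)) hfin hΓ
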